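/- Let $\Omega=\mathbb T\times\mathbb R$ with $\mathbb T=\mathbb R/\mathbb Z$, and for $\nu,\eta>0$ consider, for $u,b:\Omega\times[0,T)\to\mathbb R^2$ and $p:\Omega\times[0,T)\to\mathbb R$, the system $$\partial_t u+u\cdot\nabla u-\nu\partial_1^2u+\nabla p=b\cdot\nabla b,\qquad \partial_t b+u\cdot\nabla b-\eta\partial_1^2 b=b\cdot\nabla u,\qquad \nabla\cdot u=\nabla\cdot b=0,\qquad (u,b)|_{t=0}=(u_0,b_0).$$ A solution on $[0,T)$, $0<T\le\infty$, means: for each $f\in\{u,b\}$, $f,\partial_2 f$ are bounded in $L^2(\Omega)$ on every $[0,t]$, $t<T$, and $\partial_1 f,\partial_1\partial_2 f\in L^2((0,t)\times\Omega)$ (weak derivatives); $p$ is locally integrable on $[0,T)\times\Omega$; $u(t),b(t)$ are divergence free in the sense of distributions for every $t$; and for every $t\in[0,T)$ and every $\varphi\in C_c^\infty(\Omega;\mathbb R^2)$, $$\int_\Omega u(t)\cdot\varphi=\int_\Omega u_0\cdot\varphi+\int_0^t\!\!\int_\Omega\big[(b\cdot\nabla b-u\cdot\nabla u)\cdot\varphi-\nu\,\partial_1u\cdot\partial_1\varphi+p\,\nabla\cdot\varphi\big]\,dx\,dy\,d\tau,$$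 $$\int_\Omega b(t)\cdot\varphi=\int_\Omega b_0\cdot\varphi+\int_0^t\!\!\int_\Omega\big[(b\cdot\nabla u-u\cdot\nabla b)\cdot\varphi-\eta\,\partial_1b\cdot\partial_1\varphi\big]\,dx\,dy\,d\tau.$$ **Proposition.** There is an absolute constant $C_0>0$ such that for all $\nu,\eta>0$ there is $\delta_0>0$ with the following property. Let $0<\delta\le\delta_0$, let $u_0,b_0,\partial_2u_0,\partial_2b_0\in L^2(\Omega)$ satisfy $$\|(u_0,b_0)\|_{L^2}^2+\|(\partial_2u_0,\partial_2b_0)\|_{L^2}^2\le\delta,$$ and let $(u,b)$ be a solution on $[0,T)$, $0<T\le\infty$, with initial data $(u_0,b_0)$. Then for all $0<t<T$, $$\|(u,b)(t)\|_{L^2}^2+\|\partial_2(u,b)(t)\|_{L^2}^2+\overline C\int_0^t\|\partial_1(u,b)(\tau)\|_{L^2}^2\,d\tau+\overline C\int_0^t\|\partial_1\partial_2(u,b)(\tau)\|_{L^2}^2\,d\tau\le C_0\delta,\qquad \overline C=\min\{\nu,\eta\}.$$ -/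

import Mathlib

open MeasureTheory Set
open scoped ContDiff

noncomputable section

namespace MHD

/-- The strip `𝕋 × ℝ`, where `𝕋 = ℝ / ℤ` carries the Haar measure of total mass `1`
and the product carries the product measure. -/
abbrev Strip : Type := UnitAddCircle × ℝ

/-- Values of planar vector fields, with the Euclidean norm. -/
abbrev Vec : Type := EuclideanSpace ℝ (Fin 2)

/-- Displacement by `s` in the horizontal (`0`) or vertical (`1`) direction. -/
def shift (i : Fin 2) (s : ℝ) : Strip :=
  if i = 0 then ((s : UnitAddCircle), 0) else (0, s)

/-- Classical partial derivative on the strip; used on smooth functions only. -/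
def pderiv {E : Type*} [NormedAddCommGroup E] [NormedSpace ℝ E]
    (i : Fin 2) (f : Strip → E) (z : Strip) : E :=
  deriv (fun s : ℝ => f (z + shift i s)) 0

/-- Test functions on the strip: smooth (as functions on the plane that are `1`-periodic in
the first variable) and compactly supported. -/
structure IsTest {E : Type*} [NormedAddCommGroup E] [NormedSpace ℝ E] (φ : Strip → E) :
    Prop where
  smooth : ContDiff ℝ ∞ (fun q : ℝ × ℝ => φ ((q.1 : UnitAddCircle), q.2))
  compact : HasCompactSupport φ

/-- `g` is the weak (distributional) `i`-th partial derivative of `f`. -/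
structure HasWeakDeriv (i : Fin 2) (f g : Strip → Vec) : Prop where
  locInt : LocallyIntegrable f
  locInt_deriv : LocallyIntegrable g
  byParts : ∀ ψ : Strip → ℝ, IsTest ψ →
    ∫ z, pderiv i ψ z • f z = - ∫ z, ψ z • g z

/-- `∇ · v = 0` in the sense of distributions. -/
def IsDivFree (v : Strip → Vec) : Prop :=
  LocallyIntegrable v ∧ ∀ ψ : Strip → ℝ, IsTest ψ →
    ∫ z, (v z 0 * pderiv 0 ψ z + v z 1 * pderiv 1 ψ z) = 0

/-- Divergence of a smooth vector field. -/
def divergence (φ : Strip → Vec) (z : Strip) : ℝ :=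
  pderiv 0 φ z 0 + pderiv 1 φ z 1

/-- Square of the `L²` norm over the strip (only used for square-integrable fields). -/
def normSq (f : Strip → Vec) : ℝ := ∫ z, ‖f z‖ ^ 2

/-- The time interval `[0, T)`, where `T = ⊤` is allowed. -/
def timeInterval (T : EReal) : Set ℝ := {t | 0 ≤ t ∧ (t : EReal) < T}

/-- `f ∈ L²((0, t) × Ω)` for every `t` in `[0, T)`. -/
def LocL2 (T : EReal) (f : ℝ → Strip → Vec) : Prop :=
  ∀ t ∈ timeInterval T,
    MemLp (fun q : ℝ × Strip => f q.1 q.2) 2 ((volume.restrict (Ioc 0 t)).prod volume)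

/-- The time-dependent field `u` belongs, locally in time on `[0, T)`, to the anisotropic energy
class `u, ∂₂u ∈ L^∞_t L²`, `∂₁u, ∂₁∂₂u ∈ L²_t L²`; here `d1`, `d2`, `d12` are the weak derivatives
`∂₁u`, `∂₂u`, `∂₁∂₂u`. -/
structure InEnergyClass (T : EReal) (u d1 d2 d12 : ℝ → Strip → Vec) : Prop where
  locL2 : LocL2 T u
  locL2_d1 : LocL2 T d1
  locL2_d2 : LocL2 T d2
  locL2_d12 : LocL2 T d12
  memLp : ∀ t ∈ timeInterval T, MemLp (u t) 2
  memLp_d2 : ∀ t ∈ timeInterval T, MemLp (d2 t) 2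
  bounded : ∀ t ∈ timeInterval T, ∃ M : ℝ, ∀ s ∈ Icc 0 t, normSq (u s) + normSq (d2 s) ≤ M
  deriv_d2 : ∀ t ∈ timeInterval T, HasWeakDeriv 1 (u t) (d2 t)
  deriv_d1 : ∀ᵐ t ∂(volume.restrict (timeInterval T)), HasWeakDeriv 0 (u t) (d1 t)
  deriv_d12 : ∀ᵐ t ∂(volume.restrict (timeInterval T)), HasWeakDeriv 0 (d2 t) (d12 t)

/-- The convective term `(v · ∇) w = v¹ ∂₁w + v² ∂₂w`, given `∂₁w` and `∂₂w`. -/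
def convect (v w1 w2 : Strip → Vec) (z : Strip) : Vec :=
  v z 0 • w1 z + v z 1 • w2 z

/-- `(u, b)` is a solution on `[0, T)` of
`∂ₜu + u·∇u - ν ∂₁²u + ∇p = b·∇b`, `∂ₜb + u·∇b - η ∂₁²b = b·∇u`, `∇·u = ∇·b = 0`
on the strip, with initial data `(u₀, b₀)`.
Both evolution equations are tested against `φ` and integrated over `[0, t]`, for every `t`;
at `t = 0` they say that the initial data are attained. -/
structure IsSolution (ν η : ℝ) (T : EReal) (u₀ b₀ : Strip → Vec)
    (u u1 u2 u12 b b1 b2 b12 : ℝ → Strip → Vec) (p : ℝ → Strip → ℝ) : Prop where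
  class_u : InEnergyClass T u u1 u2 u12
  class_b : InEnergyClass T b b1 b2 b12
  pressure : ∀ t ∈ timeInterval T, ∀ R : ℝ,
    IntegrableOn (fun q : ℝ × Strip => p q.1 q.2)
      (Ioc (0 : ℝ) t ×ˢ {z : Strip | |z.2| ≤ R}) (volume.prod volume)
  div_u : ∀ t ∈ timeInterval T, IsDivFree (u t)
  div_b : ∀ t ∈ timeInterval T, IsDivFree (b t)
  momentum : ∀ t ∈ timeInterval T, ∀ φ : Strip → Vec, IsTest φ →
    ∫ z, inner ℝ (u t z) (φ z) = (∫ z, inner ℝ (u₀ z) (φ z)) +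
      ∫ τ in (0 : ℝ)..t, ∫ z,
        (inner ℝ (convect (b τ) (b1 τ) (b2 τ) z - convect (u τ) (u1 τ) (u2 τ) z) (φ z)
          - ν * inner ℝ (u1 τ z) (pderiv 0 φ z) + p τ z * divergence φ z)
  magnetic : ∀ t ∈ timeInterval T, ∀ φ : Strip → Vec, IsTest φ →
    ∫ z, inner ℝ (b t z) (φ z) = (∫ z, inner ℝ (b₀ z) (φ z)) +
      ∫ τ in (0 : ℝ)..t, ∫ z,
        (inner ℝ (convect (b τ) (u1 τ) (u2 τ) z - convect (u τ) (b1 τ) (b2 τ) z) (φ z)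
          - η * inner ℝ (b1 τ z) (pderiv 0 φ z))

end MHD

end

/-! Let E be the sum of the squared L² norms of (u,b) and ∂₂(u,b), let D be the same sum for ∂₁(u,b)
and ∂₁∂₂(u,b), and let c = min ν η. The core is the inequality E(t) + 2c∫D ≤ E(0) + 256∫√e·D, where
e is the ∂₂ part of E. For small data the last term is absorbed by the dissipation through a
continuity argument (`energy_le_of_superlinear`).

At the L² level the nonlinearity does no work: convection by a divergence-free field is
antisymmetric, and the coupling terms of the two equations cancel (`inner_force_add`). At the ∂₂
level only commutators ∂₂v·∇w tested against ∂₂z remain. Incompressibility turns ∂₂v² into -∂₁v¹, so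
each of them contains a horizontal derivative ∂₁f. This equals ∂₁(f - f̄), with f̄ the mean over the
circle, and integration by parts moves ∂₁ onto the other factors (`Good.abs_inner_bmul_le`). The
oscillation f - f̄ is bounded pointwise by ‖∂₁f‖ and ‖∂₁∂₂f‖ (`Good.bd_sub_avg`): an embedding
needing only f, ∂₁f, ∂₂f, ∂₁∂₂f in L² is combined with Poincaré's inequality. Each term thus has two
factors controlled by √D and one controlled by √e (`abs_inner_dq_commutator_le`).

Making this rigorous for weak solutions takes three devices. Vertical difference quotients replace
∂₂ and are removed at the end, since a second vertical derivative is not available. The energy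
equality is obtained by testing with a resolvent of the horizontal dissipation, evaluating on the
diagonal of a fine time partition, and then letting the resolvent parameter tend to zero
(`energy_equality`). The pressure disappears because all test fields are divergence free; that such
tests suffice is a density statement, proved with a stream function (`gen_mem_divSpace`).

Derivatives are treated throughout as strong derivatives of the translation group on L², so that
bounded operators commuting with translations preserve all the structure. -/

noncomputable section

namespace MHD

open Filter Topology
open scoped RealInnerProductSpace ENNReal

/-! ### Translations on L², strong derivatives, difference quotients and averages -/

section

/-- Square-integrable real functions on the strip. -/
abbrev L2 : Type := Lp ℝ 2 (volume : Measure Strip)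

theorem measurePreserving_add_strip (c : Strip) :
    MeasurePreserving (fun z : Strip => z + c) volume volume :=
  (measurePreserving_add_right (volume : Measure UnitAddCircle) c.1).prod
    (measurePreserving_add_right (volume : Measure ℝ) c.2)

/-- Translation `f ↦ f (· + c)` on `L²`. -/
def trans (c : Strip) : L2 →L[ℝ] L2 :=
  (Lp.compMeasurePreservingₗᵢ ℝ (fun z : Strip => z + c)
    (measurePreserving_add_strip c)).toContinuousLinearMap

theorem coeFn_trans (c : Strip) (f : L2) : trans c f =ᵐ[volume] fun z => f (z + c) :=
  Lp.coeFn_compMeasurePreserving f (measurePreserving_add_strip c)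

@[simp] theorem norm_trans (c : Strip) (f : L2) : ‖trans c f‖ = ‖f‖ :=
  Lp.norm_compMeasurePreserving f (measurePreserving_add_strip c)

theorem trans_add (c d : Strip) (f : L2) : trans (c + d) f = trans c (trans d f) := by
  apply Lp.ext
  have h := (measurePreserving_add_strip c).quasiMeasurePreserving.ae_eq_comp (coeFn_trans d f)
  filter_upwards [coeFn_trans (c + d) f, coeFn_trans c (trans d f), h] with z h1 h2 h3
  rw [h1, h2]
  simp only [Function.comp] at h3
  rw [h3, add_assoc]

theorem trans_comm (c d : Strip) (f : L2) : trans c (trans d f) = trans d (trans c f) := by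
  rw [← trans_add, ← trans_add, add_comm]

@[simp] theorem trans_zero (f : L2) : trans 0 f = f := by
  apply Lp.ext
  filter_upwards [coeFn_trans 0 f] with z h1
  rw [h1, add_zero]

@[simp] theorem inner_trans_trans (c : Strip) (f g : L2) : ⟪trans c f, trans c g⟫ = ⟪f, g⟫ :=
  (Lp.compMeasurePreservingₗᵢ ℝ (fun z : Strip => z + c)
    (measurePreserving_add_strip c)).inner_map_map f g

theorem inner_trans_left (c : Strip) (f g : L2) : ⟪trans c f, g⟫ = ⟪f, trans (-c) g⟫ := by
  rw [← inner_trans_trans (-c) (trans c f), ← trans_add, neg_add_cancel, trans_zero]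

theorem continuous_trans (f : L2) : Continuous fun c => trans c f := by
  have hg : Continuous fun c : Strip => (ContinuousMap.mk (fun z : Strip => z + c) (by fun_prop)) :=
    ContinuousMap.continuous_of_continuous_uncurry _
      (show Continuous fun p : Strip × Strip => p.2 + p.1 by fun_prop)
  exact Continuous.compMeasurePreservingLp (f := fun _ : Strip => f) continuous_const hg
    (fun c => measurePreserving_add_strip c) (by simp)

@[simp] theorem shift_zero (i : Fin 2) : shift i 0 = 0 := by
  unfold shift; split_ifs <;> simp

theorem shift_add (i : Fin 2) (s r : ℝ) : shift i (s + r) = shift i s + shift i r := by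
  unfold shift; split_ifs <;> simp

theorem shift_neg (i : Fin 2) (s : ℝ) : shift i (-s) = - shift i s := by
  rw [eq_neg_iff_add_eq_zero, ← shift_add, neg_add_cancel, shift_zero]

theorem shift_zero_one : shift 0 1 = 0 := by
  have : ((1 : ℝ) : UnitAddCircle) = 0 := AddCircle.coe_period 1
  simp [shift, this]

theorem continuous_shift (i : Fin 2) : Continuous (shift i) := by
  unfold shift
  split_ifs
  · exact (AddCircle.continuous_mk' 1).prodMk continuous_const
  · exact continuous_const.prodMk continuous_id

/-- The translation group in the `i`-th coordinate direction. -/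
def tr (i : Fin 2) (s : ℝ) : L2 →L[ℝ] L2 := trans (shift i s)

@[simp] theorem tr_zero (i : Fin 2) (f : L2) : tr i 0 f = f := by simp [tr]

theorem tr_add (i : Fin 2) (s r : ℝ) (f : L2) : tr i (s + r) f = tr i s (tr i r f) := by
  simp [tr, shift_add, trans_add]

@[simp] theorem norm_tr (i : Fin 2) (s : ℝ) (f : L2) : ‖tr i s f‖ = ‖f‖ := norm_trans _ _

theorem continuous_tr (i : Fin 2) (f : L2) : Continuous fun s => tr i s f :=
  (continuous_trans f).comp (continuous_shift i)

theorem inner_tr_left (i : Fin 2) (s : ℝ) (f g : L2) : ⟪tr i s f, g⟫ = ⟪f, tr i (-s) g⟫ := by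
  simp [tr, inner_trans_left, shift_neg]

/-- This is where horizontal periodicity enters: it makes horizontal derivatives have zero mean over
the circle. -/
theorem tr_zero_one (f : L2) : tr 0 1 f = f := by simp [tr, shift_zero_one]

/-- The weighted translation average `f ↦ ∫₀ʰ m(s) f(· + s eᵢ) ds`. -/
def wavg (i : Fin 2) (m : C(ℝ, ℝ)) (h : ℝ) : L2 →L[ℝ] L2 :=
  LinearMap.mkContinuousOfExistsBound
    { toFun := fun f => ∫ s in (0 : ℝ)..h, m s • tr i s f
      map_add' := fun f g => by
        rw [← intervalIntegral.integral_add]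
        · simp
        · exact (m.continuous.smul (continuous_tr i f)).intervalIntegrable _ _
        · exact (m.continuous.smul (continuous_tr i g)).intervalIntegrable _ _
      map_smul' := fun c f => by
        simp only [map_smul, RingHom.id_apply]
        rw [← intervalIntegral.integral_smul]
        congr 1; ext1 s; rw [smul_comm] }
    ⟨abs (∫ s in (0 : ℝ)..h, |m s|), fun f => by
      refine (intervalIntegral.norm_integral_le_abs_integral_norm).trans ?_
      simp only [norm_smul, norm_tr, Real.norm_eq_abs]
      rw [intervalIntegral.integral_mul_const, abs_mul, abs_of_nonneg (norm_nonneg f)]⟩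

theorem wavg_apply (i : Fin 2) (m : C(ℝ, ℝ)) (h : ℝ) (f : L2) :
    wavg i m h f = ∫ s in (0 : ℝ)..h, m s • tr i s f := rfl

theorem intervalIntegrable_smul_tr (i : Fin 2) (m : C(ℝ, ℝ)) (a b : ℝ) (f : L2) :
    IntervalIntegrable (fun s => m s • tr i s f) volume a b :=
  (m.continuous.smul (continuous_tr i f)).intervalIntegrable _ _

theorem norm_wavg_le (i : Fin 2) (m : C(ℝ, ℝ)) {h M : ℝ} (hh : 0 ≤ h)
    (hM : ∀ s ∈ Icc 0 h, |m s| ≤ M) (f : L2) : ‖wavg i m h f‖ ≤ h * M * ‖f‖ := by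
  rw [wavg_apply]
  have := intervalIntegral.norm_integral_le_of_norm_le_const (a := 0) (b := h)
    (f := fun s => m s • tr i s f) (C := M * ‖f‖) (fun s hs => by
      rw [uIoc_of_le hh] at hs
      rw [norm_smul, norm_tr]
      exact mul_le_mul_of_nonneg_right (hM s ⟨hs.1.le, hs.2⟩) (norm_nonneg _))
  rw [sub_zero, abs_of_nonneg hh] at this
  linarith

/-- A bounded operator commuting with all translations. -/
def TransComm (L : L2 →L[ℝ] L2) : Prop := ∀ c f, L (trans c f) = trans c (L f)

theorem transComm_trans (c : Strip) : TransComm (trans c) := fun d f => trans_comm c d f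

theorem transComm_tr (i : Fin 2) (s : ℝ) : TransComm (tr i s) := transComm_trans _

theorem transComm_wavg (i : Fin 2) (m : C(ℝ, ℝ)) (h : ℝ) : TransComm (wavg i m h) := by
  intro c f
  rw [wavg_apply, wavg_apply, ← (trans c).intervalIntegral_comp_comm
    (intervalIntegrable_smul_tr i m 0 h f)]
  simp [tr, trans_comm c]

theorem TransComm.tr {L : L2 →L[ℝ] L2} (hL : TransComm L) (i : Fin 2) (s : ℝ) (f : L2) :
    L (tr i s f) = MHD.tr i s (L f) := hL _ _

theorem TransComm.wavg {L : L2 →L[ℝ] L2} (hL : TransComm L) (i : Fin 2) (m : C(ℝ, ℝ)) (h : ℝ)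
    (f : L2) : L (wavg i m h f) = MHD.wavg i m h (L f) := by
  rw [wavg_apply, wavg_apply, ← L.intervalIntegral_comp_comm
    (intervalIntegrable_smul_tr i m 0 h f)]
  simp [hL.tr]

theorem TransComm.sub {L K : L2 →L[ℝ] L2} (hL : TransComm L) (hK : TransComm K) :
    TransComm (L - K) := fun c f => by simp [hL c f, hK c f]

theorem TransComm.smul {L : L2 →L[ℝ] L2} (hL : TransComm L) (a : ℝ) :
    TransComm (a • L) := fun c f => by simp [hL c f]

theorem transComm_id : TransComm (ContinuousLinearMap.id ℝ L2) := fun _ _ => rfl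

/-- `g` is the strong `L²` derivative of `f` in the `i`-th coordinate direction. -/
def LD (i : Fin 2) (f g : L2) : Prop := HasDerivAt (fun s => tr i s f) g 0

namespace LD

variable {i : Fin 2} {f g f' g' : L2}

theorem unique (h : LD i f g) (h' : LD i f g') : g = g' := HasDerivAt.unique h h'

theorem add (h : LD i f g) (h' : LD i f' g') : LD i (f + f') (g + g') := by
  unfold LD; simp only [map_add]; exact HasDerivAt.fun_add h h'

theorem sub (h : LD i f g) (h' : LD i f' g') : LD i (f - f') (g - g') := by
  unfold LD; simp only [map_sub]; exact HasDerivAt.fun_sub h h'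

theorem smul (a : ℝ) (h : LD i f g) : LD i (a • f) (a • g) := by
  unfold LD; simp only [map_smul]; exact HasDerivAt.fun_const_smul a h

theorem neg (h : LD i f g) : LD i (-f) (-g) := by
  unfold LD; simp only [map_neg]; exact HasDerivAt.fun_neg h

theorem map {L : L2 →L[ℝ] L2} (hL : TransComm L) (h : LD i f g) : LD i (L f) (L g) := by
  have := L.hasFDerivAt.comp_hasDerivAt (0 : ℝ) h
  simpa [LD, Function.comp_def, hL.tr] using this

theorem hasDerivAt (h : LD i f g) (s : ℝ) : HasDerivAt (fun r => tr i r f) (tr i s g) s := by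
  have h1 : HasDerivAt (fun r => tr i r (tr i s f)) (tr i s g) (s - s) := by
    simpa [LD] using h.map (transComm_tr i s)
  have h2 := HasDerivAt.comp_sub_const s s h1
  simpa [← tr_add] using h2

theorem sub_eq_integral (h : LD i f g) (a b : ℝ) : tr i b f - tr i a f = ∫ s in a..b, tr i s g :=
  (intervalIntegral.integral_eq_sub_of_hasDerivAt (fun s _ => h.hasDerivAt s)
    ((continuous_tr i g).intervalIntegrable _ _)).symm

/-- Converse of the fundamental theorem of calculus. Differentiability becomes a family of
identities between bounded operators, which is stable under limits and can be tested weakly. -/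
theorem of_sub_eq_integral (h : ∀ s, tr i s f - f = ∫ r in (0 : ℝ)..s, tr i r g) : LD i f g := by
  have h1 : HasDerivAt (fun s => ∫ r in (0 : ℝ)..s, tr i r g) (tr i 0 g) 0 :=
    intervalIntegral.integral_hasDerivAt_right ((continuous_tr i g).intervalIntegrable _ _)
      (continuous_tr i g).aestronglyMeasurable.stronglyMeasurableAtFilter
      (continuous_tr i g).continuousAt
  have h2 : (fun s => tr i s f) = fun s => f + ∫ r in (0 : ℝ)..s, tr i r g := by
    ext1 s; rw [← h s]; abel
  rw [LD, h2]
  simpa using h1.const_add f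

theorem norm_tr_sub_le (h : LD i f g) (s : ℝ) : ‖tr i s f - f‖ ≤ |s| * ‖g‖ := by
  have h1 := h.sub_eq_integral 0 s
  rw [tr_zero] at h1
  rw [h1]
  have := intervalIntegral.norm_integral_le_of_norm_le_const (a := 0) (b := s)
    (f := fun s => tr i s g) (C := ‖g‖) (fun s _ => by simp)
  rw [sub_zero] at this
  linarith

/-- Integration by parts: the inner product of two simultaneously translated functions is constant,
so its derivative vanishes. -/
theorem inner_eq (h : LD i f g) (h' : LD i f' g') : ⟪g, f'⟫ = -⟪f, g'⟫ := by
  have h1 : HasDerivAt (fun s => ⟪tr i s f, tr i s f'⟫) (⟪tr i 0 f, g'⟫ + ⟪g, tr i 0 f'⟫) 0 :=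
    HasDerivAt.inner ℝ h h'
  have h2 : (fun s => ⟪tr i s f, tr i s f'⟫) = fun _ => ⟪f, f'⟫ := by
    ext1 s; simp [tr]
  rw [h2] at h1
  have := h1.unique (hasDerivAt_const 0 _)
  simp only [tr_zero] at this
  linarith

end LD

/-- In integrated form the relation is an intersection of equalizers of continuous maps. -/
theorem isClosed_LD (i : Fin 2) : IsClosed {p : L2 × L2 | LD i p.1 p.2} := by
  have : {p : L2 × L2 | LD i p.1 p.2} =
      ⋂ s : ℝ, {p : L2 × L2 | tr i s p.1 - p.1 = wavg i 1 s p.2} := by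
    ext p
    simp only [mem_ofPred_eq, mem_iInter, wavg_apply, ContinuousMap.one_apply, one_smul]
    refine ⟨fun h s => ?_, LD.of_sub_eq_integral⟩
    simpa using h.sub_eq_integral 0 s
  rw [this]
  exact isClosed_iInter fun s => isClosed_eq (by fun_prop) (by fun_prop)

/-- Difference quotient in the `i`-th direction. -/
def dq (i : Fin 2) (h : ℝ) : L2 →L[ℝ] L2 := h⁻¹ • (tr i h - ContinuousLinearMap.id ℝ L2)

theorem dq_apply (i : Fin 2) (h : ℝ) (f : L2) : dq i h f = h⁻¹ • (tr i h f - f) := rfl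

theorem transComm_dq (i : Fin 2) (h : ℝ) : TransComm (dq i h) :=
  ((transComm_tr i h).sub transComm_id).smul _

/-- Mean over a segment in the `i`-th direction. -/
def avg (i : Fin 2) (h : ℝ) : L2 →L[ℝ] L2 := h⁻¹ • wavg i 1 h

theorem avg_apply (i : Fin 2) (h : ℝ) (f : L2) :
    avg i h f = h⁻¹ • ∫ s in (0 : ℝ)..h, tr i s f := by
  simp [avg, wavg_apply]

theorem transComm_avg (i : Fin 2) (h : ℝ) : TransComm (avg i h) :=
  (transComm_wavg _ _ _).smul _

theorem TransComm.avg {L : L2 →L[ℝ] L2} (hL : TransComm L) (i : Fin 2) (h : ℝ)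
    (f : L2) : L (avg i h f) = MHD.avg i h (L f) := by
  simp [MHD.avg, hL.wavg]

theorem norm_avg_le (i : Fin 2) {h : ℝ} (hh : 0 < h) (f : L2) : ‖avg i h f‖ ≤ ‖f‖ := by
  have := norm_wavg_le i 1 hh.le (M := 1) (by simp) f
  rw [avg, smul_apply, norm_smul, norm_inv, Real.norm_eq_abs,
    abs_of_pos hh, inv_mul_le_iff₀ hh]
  linarith

/-- The difference quotient is an average of the derivative, and averages are contractions; hence
bounds on difference quotients are uniform in the step. -/
theorem LD.dq_eq_avg {i : Fin 2} {f g : L2} (hf : LD i f g) (h : ℝ) : dq i h f = avg i h g := by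
  have := hf.sub_eq_integral 0 h
  rw [tr_zero] at this
  rw [dq_apply, avg_apply, this]

theorem LD.norm_dq_le {i : Fin 2} {f g : L2} (hf : LD i f g) {h : ℝ} (hh : 0 < h) :
    ‖dq i h f‖ ≤ ‖g‖ := by
  rw [hf.dq_eq_avg]; exact norm_avg_le i hh g

theorem LD_wavg_one (i : Fin 2) (h : ℝ) (f : L2) : LD i (wavg i 1 h f) (tr i h f - f) := by
  -- Translating an integral over a segment shifts its endpoints, so differentiation leaves only the
  -- boundary terms.
  have key : ∀ s, tr i s (wavg i 1 h f) = (∫ r in (0:ℝ)..(s + h), tr i r f)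
      - ∫ r in (0:ℝ)..s, tr i r f := by
    intro s
    have hi : ∀ a b, IntervalIntegrable (fun r => tr i r f) volume a b :=
      fun a b => (continuous_tr i f).intervalIntegrable _ _
    rw [intervalIntegral.integral_interval_sub_left (hi _ _) (hi _ _), wavg_apply]
    simp only [ContinuousMap.one_apply, one_smul]
    rw [← (tr i s).intervalIntegral_comp_comm (hi _ _)]
    simp only [← tr_add]
    rw [intervalIntegral.integral_comp_add_left (fun r => tr i r f)]
    simp
  have hd : ∀ s, HasDerivAt (fun s => ∫ r in (0:ℝ)..s, tr i r f) (tr i s f) s := fun s =>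
    intervalIntegral.integral_hasDerivAt_right ((continuous_tr i f).intervalIntegrable _ _)
      (continuous_tr i f).aestronglyMeasurable.stronglyMeasurableAtFilter
      (continuous_tr i f).continuousAt
  unfold LD
  simp only [key]
  have h1 := (HasDerivAt.comp_add_const (0 : ℝ) h (by simpa using hd h)).fun_sub (hd 0)
  rw [tr_zero] at h1
  exact h1

theorem LD_avg (i : Fin 2) (h : ℝ) (f : L2) : LD i (avg i h f) (dq i h f) :=
  (LD_wavg_one i h f).smul _

theorem tendsto_avg (i : Fin 2) (f : L2) :
    Tendsto (fun h => avg i h f) (𝓝[>] 0) (𝓝 f) := by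
  have hd : HasDerivAt (fun s => ∫ r in (0:ℝ)..s, tr i r f) (tr i 0 f) 0 :=
    intervalIntegral.integral_hasDerivAt_right ((continuous_tr i f).intervalIntegrable _ _)
      (continuous_tr i f).aestronglyMeasurable.stronglyMeasurableAtFilter
      (continuous_tr i f).continuousAt
  have := hd.tendsto_slope_zero_right
  simpa [avg_apply] using this

theorem LD.tendsto_dq {i : Fin 2} {f g : L2} (hf : LD i f g) :
    Tendsto (fun h => dq i h f) (𝓝[>] 0) (𝓝 g) := by
  simp only [hf.dq_eq_avg]; exact tendsto_avg i g

/-- Mixed derivatives commute. -/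
theorem LD.mixed {i j : Fin 2} {f f1 f2 f12 : L2} (h1 : LD i f f1) (h2 : LD j f f2)
    (h12 : LD i f2 f12) : LD j f1 f12 := by
  refine LD.of_sub_eq_integral fun s => ?_
  -- The increment of `f` in direction `j` is an integral of `f2`. Differentiating both expressions
  -- in direction `i` and using uniqueness gives the integrated form of the claim.
  have a1 : LD i (tr j s f - f) (tr j s f1 - f1) := (h1.map (transComm_tr j s)).sub h1
  have a2 : LD i (wavg j 1 s f2) (wavg j 1 s f12) := h12.map (transComm_wavg _ _ _)
  have e : tr j s f - f = wavg j 1 s f2 := by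
    have := h2.sub_eq_integral 0 s
    simpa [wavg_apply] using this
  rw [e] at a1
  rw [a1.unique a2]
  simp [wavg_apply]

end

/-! ### Test functions on the strip; weak derivatives in L² are strong -/

section

/-- The covering map from the plane to the strip. -/
def plane (q : ℝ × ℝ) : Strip := ((q.1 : UnitAddCircle), q.2)

/-- Unit coordinate vectors of the plane. -/
def dir (i : Fin 2) : ℝ × ℝ := if i = 0 then (1, 0) else (0, 1)

theorem continuous_plane : Continuous plane :=
  ((AddCircle.continuous_mk' 1).comp continuous_fst).prodMk continuous_snd

theorem plane_surjective : Function.Surjective plane := fun z => by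
  obtain ⟨x, hx⟩ := QuotientAddGroup.mk_surjective z.1
  exact ⟨(x, z.2), Prod.ext hx rfl⟩

theorem plane_add (q r : ℝ × ℝ) : plane (q + r) = plane q + plane r := by
  simp [plane]

theorem plane_add_shift (q : ℝ × ℝ) (i : Fin 2) (s : ℝ) :
    plane q + shift i s = plane (q + s • dir i) := by
  unfold shift dir plane
  split_ifs <;> simp

theorem isOpenQuotientMap_plane : IsOpenQuotientMap plane :=
  IsOpenQuotientMap.prodMap
    (QuotientAddGroup.isOpenQuotientMap_mk (N := AddSubgroup.zmultiples (1 : ℝ)))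
    (IsOpenQuotientMap.id (X := ℝ))

theorem measurePreserving_plane :
    MeasurePreserving plane ((volume.restrict (Ioc (0 : ℝ) 1)).prod volume) volume := by
  have h := (UnitAddCircle.measurePreserving_mk 0).prod (MeasurePreserving.id (volume : Measure ℝ))
  rw [zero_add] at h
  exact h

theorem integral_comp_plane {g : Strip → ℝ} (hg : AEStronglyMeasurable g volume) :
    ∫ q, g (plane q) ∂((volume.restrict (Ioc (0 : ℝ) 1)).prod volume) = ∫ z, g z := by
  rw [← measurePreserving_plane.map_eq] at hg ⊢
  exact (integral_map measurePreserving_plane.measurable.aemeasurable hg).symm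

namespace IsTest

variable {ψ χ : Strip → ℝ}

theorem continuous (h : IsTest ψ) : Continuous ψ :=
  isOpenQuotientMap_plane.isQuotientMap.continuous_iff.2 h.smooth.continuous

theorem memLp (h : IsTest ψ) (p : ℝ≥0∞) : MemLp ψ p volume :=
  h.continuous.memLp_of_hasCompactSupport h.compact

theorem hasDerivAt_plane (h : IsTest ψ) (i : Fin 2) (q : ℝ × ℝ) :
    HasDerivAt (fun s : ℝ => ψ (plane q + shift i s))
      (fderiv ℝ (fun q => ψ (plane q)) q (dir i)) 0 := by
  have h1 : HasFDerivAt (fun q => ψ (plane q)) (fderiv ℝ (fun q => ψ (plane q)) q)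
      (q + (0 : ℝ) • dir i) := by
    rw [zero_smul, add_zero]
    exact (h.smooth.differentiable (by simp) q).hasFDerivAt
  have h2 : HasDerivAt (fun s : ℝ => q + s • dir i) (dir i) 0 := by
    simpa using ((hasDerivAt_id (0 : ℝ)).smul_const (dir i)).const_add q
  have := h1.comp_hasDerivAt (0 : ℝ) h2
  simpa [Function.comp_def, plane_add_shift] using this

theorem pderiv_plane (h : IsTest ψ) (i : Fin 2) (q : ℝ × ℝ) :
    pderiv i ψ (plane q) = fderiv ℝ (fun q => ψ (plane q)) q (dir i) :=
  (h.hasDerivAt_plane i q).deriv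

theorem hasDerivAt (h : IsTest ψ) (i : Fin 2) (z : Strip) (s : ℝ) :
    HasDerivAt (fun r : ℝ => ψ (z + shift i r)) (pderiv i ψ (z + shift i s)) s := by
  obtain ⟨q, hq⟩ := plane_surjective (z + shift i s)
  have h1 := h.hasDerivAt_plane i q
  rw [← h.pderiv_plane, hq, ← sub_self s] at h1
  have h2 := HasDerivAt.comp_sub_const s s h1
  have e : (fun r => ψ (z + shift i s + shift i (r - s))) = fun r => ψ (z + shift i r) := by
    ext1 r
    rw [add_assoc, ← shift_add, add_sub_cancel]
  rwa [e] at h2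

theorem pderiv_eq_zero (i : Fin 2) {z : Strip} (hz : z ∉ tsupport ψ) : pderiv i ψ z = 0 := by
  have h1 : ∀ᶠ w in 𝓝 z, ψ w = 0 := notMem_tsupport_iff_eventuallyEq.1 hz
  have h2 : Tendsto (fun s : ℝ => z + shift i s) (𝓝 0) (𝓝 z) := by
    have : Continuous fun s : ℝ => z + shift i s := continuous_const.add (continuous_shift i)
    simpa using this.tendsto 0
  have h3 : (fun s : ℝ => ψ (z + shift i s)) =ᶠ[𝓝 0] fun _ => 0 := h2.eventually h1
  rw [pderiv, h3.deriv_eq, deriv_const]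

theorem pderiv (h : IsTest ψ) (i : Fin 2) : IsTest (pderiv i ψ) where
  smooth := by
    have : (fun q : ℝ × ℝ => MHD.pderiv i ψ ((q.1 : UnitAddCircle), q.2)) =
        fun q => fderiv ℝ (fun q => ψ (plane q)) q (dir i) := by
      ext1 q; exact h.pderiv_plane i q
    rw [this]
    exact (h.smooth.fderiv_right (m := ∞) (by simp)).clm_apply contDiff_const
  compact := HasCompactSupport.intro h.compact fun z hz => pderiv_eq_zero i hz

theorem comp_add (h : IsTest ψ) (c : Strip) : IsTest (fun z => ψ (z + c)) where
  smooth := by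
    obtain ⟨q, rfl⟩ := plane_surjective c
    have : (fun r : ℝ × ℝ => ψ (plane r + plane q)) = (fun r => ψ (plane r)) ∘ fun r => r + q := by
      ext1 r; simp [plane_add]
    exact this ▸ h.smooth.comp (contDiff_id.add contDiff_const)
  compact := h.compact.comp_homeomorph (Homeomorph.addRight c)

theorem pderiv_comp_add (i : Fin 2) (c : Strip) (ψ : Strip → ℝ) :
    MHD.pderiv i (fun z => ψ (z + c)) = fun z => MHD.pderiv i ψ (z + c) := by
  ext1 z; simp only [MHD.pderiv, add_right_comm]

theorem pderiv_comm (h : IsTest ψ) (i j : Fin 2) :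
    MHD.pderiv i (MHD.pderiv j ψ) = MHD.pderiv j (MHD.pderiv i ψ) := by
  ext1 z
  obtain ⟨q, rfl⟩ := plane_surjective z
  rw [(h.pderiv j).pderiv_plane, (h.pderiv i).pderiv_plane]
  have e : ∀ k, (fun q => MHD.pderiv k ψ (plane q)) =
      fun q => fderiv ℝ (fun q => ψ (plane q)) q (dir k) := fun k => by
    ext1 q; exact h.pderiv_plane k q
  have hs : ContDiff ℝ ∞ fun q => ψ (plane q) := h.smooth
  have hd : DifferentiableAt ℝ (fderiv ℝ (fun q => ψ (plane q))) q :=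
    (hs.fderiv_right (m := ∞) (by simp)).differentiable (by simp) q
  rw [e, e, fderiv_clm_apply hd (by fun_prop), fderiv_clm_apply hd (by fun_prop)]
  have h2 : minSmoothness ℝ 2 ≤ (∞ : WithTop ℕ∞) := by
    rw [minSmoothness_of_isRCLikeNormedField]
    exact WithTop.coe_le_coe.2 le_top
  have := (hs.contDiffAt (x := q)).isSymmSndFDerivAt h2
  simpa using this (dir i) (dir j)

theorem const_mul (h : IsTest ψ) (a : ℝ) : IsTest (fun z => a * ψ z) where
  smooth := contDiff_const.mul h.smooth
  compact := h.compact.mul_left (f := fun _ => a)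

end IsTest

open Classical in
/-- The class in `L²` of a function, and zero if it is not square-integrable. -/
def hat (f : Strip → ℝ) : L2 := if h : MemLp f 2 volume then h.toLp f else 0

theorem hat_eq {f : Strip → ℝ} (h : MemLp f 2 volume) : hat f = h.toLp f := dif_pos h

theorem coeFn_hat {f : Strip → ℝ} (h : MemLp f 2 volume) : hat f =ᵐ[volume] f := by
  rw [hat_eq h]; exact h.coeFn_toLp

theorem inner_eq_integral (f g : L2) : ⟪f, g⟫ = ∫ z, f z * g z := by
  rw [L2.inner_def]; congr 1; ext1 z; simp [mul_comm]

theorem inner_hat {g : Strip → ℝ} (h : MemLp g 2 volume) (f : L2) :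
    ⟪f, hat g⟫ = ∫ z, f z * g z := by
  rw [inner_eq_integral]
  refine integral_congr_ae ?_
  filter_upwards [coeFn_hat h] with z hz
  rw [hz]

theorem trans_hat (c : Strip) {f : Strip → ℝ} (h : MemLp f 2 volume) :
    trans c (hat f) = hat fun z => f (z + c) := by
  have h' : MemLp (fun z => f (z + c)) 2 volume :=
    h.comp_measurePreserving (measurePreserving_add_strip c)
  rw [hat_eq h, hat_eq h']; rfl

theorem hat_congr {f g : Strip → ℝ} (h : f =ᵐ[volume] g) : hat f = hat g := by
  by_cases hf : MemLp f 2 volume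
  · have hg := hf.ae_eq h
    rw [hat_eq hf, hat_eq hg]; exact MemLp.toLp_congr _ _ h
  · have hg : ¬ MemLp g 2 volume := fun hg => hf (hg.ae_eq h.symm)
    simp [hat, hf, hg]

/-- A bound on a compact set. -/
theorem norm_le_of_support {K : Set Strip} (hK : MeasurableSet K) (hμ : volume K ≠ (⊤ : ℝ≥0∞)) :
    ∃ C, 0 ≤ C ∧ ∀ (f : L2) (c : ℝ), 0 ≤ c → (∀ᵐ z, |f z| ≤ c) → (∀ᵐ z, z ∉ K → f z = 0) →
      ‖f‖ ≤ c * C := by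
  refine ⟨‖indicatorConstLp 2 hK hμ (1 : ℝ)‖, norm_nonneg _, fun f c hc h1 h2 => ?_⟩
  have : ‖f‖ ≤ ‖c • indicatorConstLp 2 hK hμ (1 : ℝ)‖ := by
    refine Lp.norm_le_norm_of_ae_le ?_
    filter_upwards [h1, h2, Lp.coeFn_smul c (indicatorConstLp 2 hK hμ (1 : ℝ)),
      indicatorConstLp_coeFn (p := 2) (hs := hK) (hμs := hμ) (c := (1 : ℝ))] with z a1 a2 a3 a4
    rw [a3, Pi.smul_apply, a4]
    by_cases hz : z ∈ K
    · simpa [hz, abs_of_nonneg hc] using a1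
    · simp [hz, a2 hz]
  rwa [norm_smul, Real.norm_eq_abs, abs_of_nonneg hc] at this

theorem IsTest.bounded {ψ : Strip → ℝ} (h : IsTest ψ) : ∃ M, 0 ≤ M ∧ ∀ z, |ψ z| ≤ M := by
  obtain ⟨M, hM⟩ := h.continuous.bounded_above_of_compact_support h.compact
  exact ⟨M, (norm_nonneg _).trans (hM 0), hM⟩

/-- The remainder is uniform in the base point because the second derivative is again a test
function, hence bounded. -/
theorem IsTest.taylor {ψ : Strip → ℝ} (h : IsTest ψ) (i : Fin 2) :
    ∃ M, 0 ≤ M ∧ ∀ z s, |ψ (z + shift i s) - ψ z - s * MHD.pderiv i ψ z| ≤ M * s ^ 2 := by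
  obtain ⟨M, hM0, hM⟩ := ((h.pderiv i).pderiv i).bounded
  refine ⟨M, hM0, fun z s => ?_⟩
  have h1 : ∀ r, |MHD.pderiv i ψ (z + shift i r) - MHD.pderiv i ψ z| ≤ M * |r| := by
    intro r
    have := Convex.norm_image_sub_le_of_norm_hasDerivWithin_le (s := univ) (x := 0) (y := r)
      (f := fun r => MHD.pderiv i ψ (z + shift i r)) (C := M)
      (fun x _ => ((h.pderiv i).hasDerivAt i z x).hasDerivWithinAt) (fun x _ => hM _)
      convex_univ (mem_univ _) (mem_univ _)
    simpa using this
  have h2 : ∀ x ∈ uIcc 0 s, HasDerivWithinAt (fun r => ψ (z + shift i r) - r * MHD.pderiv i ψ z)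
      (MHD.pderiv i ψ (z + shift i x) - MHD.pderiv i ψ z) (uIcc 0 s) x := fun x _ => by
    have := (h.hasDerivAt i z x).fun_sub ((hasDerivAt_id x).mul_const (MHD.pderiv i ψ z))
    simpa using this.hasDerivWithinAt
  have := Convex.norm_image_sub_le_of_norm_hasDerivWithin_le (s := uIcc 0 s) (x := 0) (y := s)
    (C := M * |s|) h2 (fun x hx => (h1 x).trans (mul_le_mul_of_nonneg_left
      (by simpa using abs_sub_left_of_mem_uIcc hx) hM0))
    (convex_uIcc _ _) left_mem_uIcc right_mem_uIcc
  simp only [shift_zero, add_zero, zero_mul, sub_zero, Real.norm_eq_abs] at this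
  rw [sub_right_comm]
  refine this.trans (le_of_eq ?_)
  rw [mul_assoc, abs_mul_abs_self, sq]

/-- The Taylor remainder is uniformly quadratic in `s` and, for |s| ≤ 1, supported in one fixed
compact set; so it is quadratic in L² norm as well. -/
theorem IsTest.LD {ψ : Strip → ℝ} (h : IsTest ψ) (i : Fin 2) :
    LD i (hat ψ) (hat (MHD.pderiv i ψ)) := by
  obtain ⟨M, hM0, hM⟩ := h.taylor i
  -- `K` contains every translate of the support that can occur for |s| ≤ 1.
  let K : Set Strip := (fun p : Strip × ℝ => p.1 - shift i p.2) '' (tsupport ψ ×ˢ Icc (-1) 1)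
  have hK : IsCompact K := (IsCompact.prod h.compact isCompact_Icc).image
    (continuous_fst.sub ((continuous_shift i).comp continuous_snd))
  obtain ⟨C, hC0, hC⟩ := norm_le_of_support hK.measurableSet hK.measure_lt_top.ne
  have key : ∀ s ∈ Icc (-1 : ℝ) 1,
      ‖tr i s (hat ψ) - hat ψ - s • hat (MHD.pderiv i ψ)‖ ≤ M * s ^ 2 * C := by
    intro s hs
    have hae : ∀ᵐ z, (tr i s (hat ψ) - hat ψ - s • hat (MHD.pderiv i ψ) : L2) z
        = ψ (z + shift i s) - ψ z - s * MHD.pderiv i ψ z := by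
      rw [tr, trans_hat _ (h.memLp 2)]
      filter_upwards [coeFn_hat (h.memLp 2), coeFn_hat ((h.comp_add (shift i s)).memLp 2),
        coeFn_hat ((h.pderiv i).memLp 2),
        Lp.coeFn_sub (hat (fun z => ψ (z + shift i s)) - hat ψ) (s • hat (MHD.pderiv i ψ)),
        Lp.coeFn_sub (hat (fun z => ψ (z + shift i s))) (hat ψ),
        Lp.coeFn_smul s (hat (MHD.pderiv i ψ))] with z a1 a2 a3 a4 a5 a6
      rw [a4, Pi.sub_apply, a5, Pi.sub_apply, a6, Pi.smul_apply, a1, a2, a3, smul_eq_mul]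
    refine hC _ _ (by positivity) ?_ ?_
    · filter_upwards [hae] with z hz
      rw [hz]; exact hM z s
    · filter_upwards [hae] with z hz hzK
      rw [hz]
      have n1 : z ∉ tsupport ψ := fun hz' => hzK ⟨(z, 0), ⟨hz', by simp⟩, by simp⟩
      have n2 : z + shift i s ∉ tsupport ψ := fun hz' => hzK ⟨(z + shift i s, s), ⟨hz', hs⟩,
        by simp⟩
      rw [image_eq_zero_of_notMem_tsupport n1, image_eq_zero_of_notMem_tsupport n2,
        IsTest.pderiv_eq_zero i n1]
      simp
  unfold MHD.LD
  rw [hasDerivAt_iff_isLittleO_nhds_zero]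
  have : (fun s => tr i (0 + s) (hat ψ) - tr i 0 (hat ψ) - s • hat (MHD.pderiv i ψ))
      =O[𝓝 0] fun s : ℝ => s ^ 2 := by
    refine Asymptotics.IsBigO.of_bound (M * C) ?_
    filter_upwards [Icc_mem_nhds (show (-1 : ℝ) < 0 by norm_num) one_pos] with s hs
    rw [zero_add, tr_zero]
    refine (key s hs).trans (le_of_eq ?_)
    rw [Real.norm_eq_abs, abs_of_nonneg (sq_nonneg s)]; ring
  exact this.trans_isLittleO (Asymptotics.isLittleO_pow_id one_lt_two)

/-- The periodic extension of a function supported in a period is smooth. -/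
theorem isTest_of_plane {χ : ℝ × ℝ → ℝ} (hχ : ContDiff ℝ ∞ χ) (hc : HasCompactSupport χ)
    (hs : tsupport χ ⊆ Ioo 0 1 ×ˢ univ) :
    ∃ ψ, IsTest ψ ∧ ∀ q ∈ Ioc (0 : ℝ) 1 ×ˢ univ, ψ (plane q) = χ q := by
  have hz : ∀ x y, x ∉ Ioo (0 : ℝ) 1 → χ (x, y) = 0 := fun x y hx =>
    image_eq_zero_of_notMem_tsupport fun h => hx (hs h).1
  -- The representative in (0,1]. It jumps at integers, where `χ` vanishes.
  let t : UnitAddCircle → ℝ := fun x => (AddCircle.equivIoc (1 : ℝ) 0 x : ℝ)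
  have ht : ∀ x, t x ∈ Ioc (0 : ℝ) 1 := fun x => by
    simpa using (AddCircle.equivIoc (1 : ℝ) 0 x).2
  have htc : ∀ x, ((t x : ℝ) : UnitAddCircle) = x := fun x =>
    (AddCircle.equivIoc (1 : ℝ) 0).symm_apply_apply x
  have hk : ∀ x : ℝ, ∃ k : ℤ, t x = x - k := fun x => by
    have := htc x
    rw [QuotientAddGroup.eq] at this
    obtain ⟨k, hk⟩ := AddSubgroup.mem_zmultiples_iff.1 this
    refine ⟨k, ?_⟩
    simp at hk; linarith
  refine ⟨fun z => χ (t z.1, z.2), ⟨?_, ?_⟩, ?_⟩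
  · rw [contDiff_iff_contDiffAt]
    rintro ⟨x₀, y₀⟩
    set n : ℤ := ⌊x₀⌋
    have hx1 : (n : ℝ) ≤ x₀ := Int.floor_le x₀
    have hx2 : x₀ < n + 1 := Int.lt_floor_add_one x₀
    -- Near `x₀` the integer separating a point from its representative is n - 1, n or n + 1. Of the
    -- three translates only the one with the right integer is nonzero, so the sum is a smooth local
    -- formula for the extension.
    have hev : (fun q : ℝ × ℝ => χ (t (q.1 : UnitAddCircle), q.2)) =ᶠ[𝓝 (x₀, y₀)]
        fun q => χ (q.1 - (n - 1), q.2) + χ (q.1 - n, q.2) + χ (q.1 - (n + 1), q.2) := by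
      have hn : Ioo ((n : ℝ) - 1) (n + 2) ×ˢ (univ : Set ℝ) ∈ 𝓝 (x₀, y₀) :=
        prod_mem_nhds (Ioo_mem_nhds (by linarith) (by linarith)) univ_mem
      filter_upwards [hn] with q hq
      obtain ⟨k, hk⟩ := hk q.1
      have h1 := ht (q.1 : UnitAddCircle)
      rw [hk] at h1 ⊢
      obtain ⟨⟨hq1, hq2⟩, -⟩ := hq
      have k1 : k < n + 2 := by
        have : (k : ℝ) < n + 2 := by linarith [h1.1]
        exact_mod_cast this
      have k2 : n - 2 < k := by
        have : (n : ℝ) - 2 < k := by linarith [h1.2]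
        exact_mod_cast this
      have hcases : k = n - 1 ∨ k = n ∨ k = n + 1 := by omega
      rcases hcases with rfl | rfl | rfl <;> push_cast at h1 ⊢
      · rw [hz (q.1 - n) _ (fun h => by linarith [h.1, h1.2]),
          hz (q.1 - (n + 1)) _ (fun h => by linarith [h.1, h1.2])]; ring
      · rw [hz (q.1 - (n - 1)) _ (fun h => by linarith [h.2, h1.1]),
          hz (q.1 - (n + 1)) _ (fun h => by linarith [h.1, h1.2])]; ring
      · rw [hz (q.1 - (n - 1)) _ (fun h => by linarith [h.2, h1.1]),
          hz (q.1 - n) _ (fun h => by linarith [h.2, h1.1])]; ring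
    refine ContDiffAt.congr_of_eventuallyEq ?_ hev
    have hc : ∀ a : ℝ, ContDiff ℝ ∞ fun q : ℝ × ℝ => χ (q.1 - a, q.2) := fun a =>
      hχ.comp ((contDiff_fst.sub contDiff_const).prodMk contDiff_snd)
    exact (((hc _).add (hc _)).add (hc _)).contDiffAt
  · refine HasCompactSupport.intro (IsCompact.image hc continuous_plane) fun z hzn => ?_
    refine image_eq_zero_of_notMem_tsupport fun h => hzn ⟨_, h, ?_⟩
    exact Prod.ext (htc z.1) rfl
  · rintro ⟨x, y⟩ ⟨hx, -⟩
    obtain ⟨k, hk⟩ := hk x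
    have h1 := ht (x : UnitAddCircle)
    have : k = 0 := by
      rw [hk] at h1
      have a : (k : ℝ) < 1 := by linarith [hx.2, h1.1]
      have b : (-1 : ℝ) < k := by linarith [hx.1, h1.2]
      have a' : k < 1 := by exact_mod_cast a
      have b' : -1 < k := by exact_mod_cast b
      omega
    simp only [plane]
    rw [hk, this]; simp

/-- Pull back to one open period in the plane, where compactly supported smooth functions extend
periodically to test functions on the strip, and apply the fundamental lemma of the calculus of
variations. -/
theorem eq_zero_of_inner_test {f : L2} (hf : ∀ ψ, IsTest ψ → ⟪f, hat ψ⟫ = 0) : f = 0 := by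
  set μ : Measure (ℝ × ℝ) := (volume.restrict (Ioc (0 : ℝ) 1)).prod volume with hμ
  have hμ' : μ = volume.restrict (Ioc (0 : ℝ) 1 ×ˢ univ) := by
    rw [hμ, Measure.volume_eq_prod, ← Measure.prod_restrict, Measure.restrict_univ]
  have hF : MemLp (fun q => f (plane q)) 2 μ :=
    (Lp.memLp f).comp_measurePreserving measurePreserving_plane
  set U : Set (ℝ × ℝ) := Ioo 0 1 ×ˢ univ
  have hU : IsOpen U := isOpen_Ioo.prod isOpen_univ
  have hUI : U ⊆ Ioc (0 : ℝ) 1 ×ˢ univ := prod_mono Ioo_subset_Ioc_self subset_rfl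
  have hloc : LocallyIntegrableOn (fun q => f (plane q)) U volume := by
    intro q hq
    refine ⟨_, mem_nhdsWithin_of_mem_nhds (Metric.closedBall_mem_nhds q one_pos) |> (fun h =>
      inter_mem h self_mem_nhdsWithin), ?_⟩
    have h1 : LocallyIntegrable (fun q => f (plane q)) μ := hF.locallyIntegrable (by norm_num)
    have h2 := h1.integrableOn_isCompact (isCompact_closedBall q 1)
    rw [hμ', IntegrableOn, Measure.restrict_restrict measurableSet_closedBall] at h2
    exact IntegrableOn.mono_set h2 (inter_subset_inter_right _ hUI)
  have h0 : ∀ᵐ q ∂volume, q ∈ U → f (plane q) = 0 := by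
    refine hU.ae_eq_zero_of_integral_contDiff_smul_eq_zero hloc fun χ h1 h2 h3 => ?_
    obtain ⟨ψ, hψ, e⟩ := isTest_of_plane h1 h2 h3
    have h4 := hf ψ hψ
    rw [inner_hat (hψ.memLp 2), ← integral_comp_plane (g := fun z => f z * ψ z)
      ((Lp.aestronglyMeasurable f).mul hψ.continuous.aestronglyMeasurable)] at h4
    change ∫ q, f (plane q) * ψ (plane q) ∂μ = 0 at h4
    rw [hμ'] at h4
    rw [← h4, ← setIntegral_eq_integral_of_forall_compl_eq_zero
      (s := Ioc (0 : ℝ) 1 ×ˢ univ)]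
    · refine setIntegral_congr_fun (measurableSet_Ioc.prod MeasurableSet.univ) fun q hq => ?_
      simp only [smul_eq_mul]
      rw [e q hq, mul_comm]
    · intro q hq
      rw [image_eq_zero_of_notMem_tsupport fun h => hq (hUI (h3 h)), zero_smul]
  have h1 : ∀ᵐ q ∂μ, f (plane q) = 0 := by
    rw [hμ', ae_restrict_iff' (measurableSet_Ioc.prod MeasurableSet.univ)]
    -- The line x = 1 is what the half-open period has in addition to the open one, and it is
    -- negligible.
    have hne : ∀ᵐ q : ℝ × ℝ, q.1 ≠ 1 := by
      have : ∀ᵐ x : ℝ, x ≠ 1 := by simp [ae_iff]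
      exact Measure.quasiMeasurePreserving_fst.ae this
    filter_upwards [h0, hne] with q hq hq1 hqI
    exact hq ⟨⟨hqI.1.1, lt_of_le_of_ne hqI.1.2 hq1⟩, trivial⟩
  have h2 : ∀ᵐ z, f z = 0 := by
    have hS : MeasurableSet {z | ¬ f z = 0} :=
      ((Lp.stronglyMeasurable f).measurable (measurableSet_singleton 0)).compl
    rw [ae_iff, ← measurePreserving_plane.measure_preimage hS.nullMeasurableSet]
    exact h1
  exact (Lp.eq_zero_iff_ae_eq_zero).2 h2

/-- Test functions are dense in `L²`. -/
theorem dense_test : Dense (Submodule.span ℝ {f : L2 | ∃ ψ, IsTest ψ ∧ f = hat ψ} : Set L2) := by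
  rw [Submodule.dense_iff_topologicalClosure_eq_top, Submodule.topologicalClosure_eq_top_iff,
    Submodule.eq_bot_iff]
  intro f hf
  refine eq_zero_of_inner_test fun ψ hψ => ?_
  rw [real_inner_comm]
  exact hf _ (Submodule.subset_span ⟨ψ, hψ, rfl⟩)

/-- A weak derivative in `L²` is a strong one. -/
theorem LD.of_weak {i : Fin 2} {f g : L2}
    (h : ∀ ψ, IsTest ψ → ⟪f, hat (pderiv i ψ)⟫ = -⟪g, hat ψ⟫) : LD i f g := by
  refine LD.of_sub_eq_integral fun s => ?_
  rw [← sub_eq_zero]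
  refine eq_zero_of_inner_test fun ψ hψ => ?_
  have hi : ∀ a b, IntervalIntegrable (fun r => tr i r g) volume a b :=
    fun a b => (continuous_tr i g).intervalIntegrable _ _
  -- The translation is moved onto the test function, which is strongly differentiable; the weak
  -- identity then converts its derivative back into `g`.
  have h1 : ∀ r, HasDerivAt (fun r => ⟪tr i r f, hat ψ⟫) ⟪tr i r g, hat ψ⟫ r := by
    intro r
    have e1 : (fun r => ⟪tr i r f, hat ψ⟫) = fun r => ⟪f, tr i (-r) (hat ψ)⟫ := by
      ext1 r; rw [inner_tr_left]
    have e2 : ⟪tr i r g, hat ψ⟫ = -⟪f, tr i (-r) (hat (pderiv i ψ))⟫ := by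
      have a1 := h _ (hψ.comp_add (shift i (-r)))
      rw [IsTest.pderiv_comp_add, ← trans_hat _ (hψ.memLp 2),
        ← trans_hat _ ((hψ.pderiv i).memLp 2)] at a1
      rw [inner_tr_left]
      change ⟪f, tr i (-r) (hat (pderiv i ψ))⟫ = _ at a1
      rw [a1, neg_neg]; rfl
    rw [e1, e2]
    have a2 := ((hψ.LD i).hasDerivAt (-r)).scomp r (hasDerivAt_neg r)
    have a3 := HasDerivAt.inner ℝ (hasDerivAt_const r f) a2
    simpa [Function.comp_def] using a3
  have h2 := intervalIntegral.integral_eq_sub_of_hasDerivAt (a := 0) (b := s) (fun r _ => h1 r)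
    (((continuous_tr i g).inner continuous_const).intervalIntegrable _ _)
  have h3 : ⟪∫ r in (0 : ℝ)..s, tr i r g, hat ψ⟫ = ∫ r in (0 : ℝ)..s, ⟪tr i r g, hat ψ⟫ := by
    have := (innerSL ℝ (hat ψ)).intervalIntegral_comp_comm (hi 0 s)
    simp only [innerSL_apply_apply] at this
    rw [real_inner_comm, ← this]
    congr 1; ext1 r; rw [real_inner_comm]
  rw [inner_sub_left, h3, h2, inner_sub_left, tr_zero, sub_self]

end

/-! ### Anisotropic embedding, products and the trilinear estimate -/

section

/-- The weight `s ↦ 1 - s`. -/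
def oneSub : C(ℝ, ℝ) := ⟨fun s => 1 - s, by fun_prop⟩

/-- The fundamental theorem of calculus applied to (1 - s) f(· + s eᵢ) on [0,1]: a function is
recovered from unit averages of itself and of its derivative, without boundary conditions. -/
theorem LD.eq_wavg {i : Fin 2} {f g : L2} (h : LD i f g) :
    f = wavg i 1 1 f - wavg i oneSub 1 g := by
  have hd : ∀ s ∈ uIcc (0 : ℝ) 1, HasDerivAt (fun s => (1 - s) • tr i s f)
      ((1 - s) • tr i s g + (-1 : ℝ) • tr i s f) s := fun s _ =>
    HasDerivAt.fun_smul (by simpa using (hasDerivAt_id s).const_sub 1) (h.hasDerivAt s)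
  have h1 : IntervalIntegrable (fun s => (1 - s) • tr i s g) volume 0 1 :=
    intervalIntegrable_smul_tr i oneSub 0 1 g
  have h2 : IntervalIntegrable (fun s => (-1 : ℝ) • tr i s f) volume 0 1 :=
    Continuous.intervalIntegrable (by have := continuous_tr i f; fun_prop) _ _
  have := intervalIntegral.integral_eq_sub_of_hasDerivAt hd (h1.add h2)
  rw [intervalIntegral.integral_add h1 h2] at this
  simp only [sub_self, zero_smul, tr_zero, sub_zero, one_smul, zero_sub, neg_smul,
    intervalIntegral.integral_neg] at this
  simp only [wavg_apply, ContinuousMap.one_apply, one_smul, oneSub, ContinuousMap.coe_mk]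
  rw [← neg_inj, ← this]; abel

theorem inner_wavg (i : Fin 2) (m : C(ℝ, ℝ)) (h : ℝ) (f θ : L2) :
    ⟪wavg i m h f, θ⟫ = ∫ s in (0 : ℝ)..h, m s * ⟪tr i s f, θ⟫ := by
  have := (innerSL ℝ θ).intervalIntegral_comp_comm (intervalIntegrable_smul_tr i m 0 h f)
  simp only [innerSL_apply_apply] at this
  rw [wavg_apply, real_inner_comm, ← this]
  congr 1; ext1 s; rw [inner_smul_right, real_inner_comm]

theorem enorm_eq_lintegral (f : L2) : ‖f‖ₑ = (∫⁻ z, ‖f z‖ₑ ^ (2 : ℝ)) ^ (1 / 2 : ℝ) := by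
  rw [Lp.enorm_def, eLpNorm_eq_lintegral_rpow_enorm_toReal (by simp) (by simp)]
  simp

theorem shift_add_shift (s r : ℝ) : shift 0 s + shift 1 r = plane (s, r) := by
  simp [shift, plane]

/-- Averages over a unit square, tested against an integrable function. -/
theorem enorm_inner_wavg_wavg_le {m₀ m₁ : C(ℝ, ℝ)} (h₀ : ∀ s ∈ Ioc (0 : ℝ) 1, |m₀ s| ≤ 1)
    (h₁ : ∀ s ∈ Ioc (0 : ℝ) 1, |m₁ s| ≤ 1) (G θ : L2) :
    ‖⟪wavg 0 m₀ 1 (wavg 1 m₁ 1 G), θ⟫‖ₑ ≤ ‖G‖ₑ * ∫⁻ z, ‖θ z‖ₑ := by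
  set ρ : Measure ℝ := volume.restrict (Ioc (0 : ℝ) 1)
  have hG : Measurable fun z => ‖G z‖ₑ := (Lp.stronglyMeasurable G).measurable.enorm
  have hθ : Measurable fun z => ‖θ z‖ₑ := (Lp.stronglyMeasurable θ).measurable.enorm
  have hm : Measurable fun p : (ℝ × ℝ) × Strip => ‖G (p.2 + plane p.1)‖ₑ * ‖θ p.2‖ₑ :=
    (hG.comp (measurable_snd.add (continuous_plane.measurable.comp measurable_fst))).mul
      (hθ.comp measurable_snd)
  have step : ∀ {m : C(ℝ, ℝ)} {i : Fin 2} (_ : ∀ s ∈ Ioc (0 : ℝ) 1, |m s| ≤ 1) (F : L2),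
      ‖⟪wavg i m 1 F, θ⟫‖ₑ ≤ ∫⁻ s, ‖⟪tr i s F, θ⟫‖ₑ ∂ρ := by
    intro m i hmi F
    rw [inner_wavg, intervalIntegral.integral_of_le zero_le_one]
    refine (enorm_integral_le_lintegral_enorm _).trans ?_
    refine setLIntegral_mono' measurableSet_Ioc fun s hs => ?_
    rw [enorm_mul]
    refine mul_le_of_le_one_left' ?_
    rw [Real.enorm_eq_ofReal_abs]
    exact ENNReal.ofReal_le_one.2 (hmi s hs)
  have pt : ∀ q : ℝ × ℝ, ‖⟪trans (plane q) G, θ⟫‖ₑ ≤ ∫⁻ z, ‖G (z + plane q)‖ₑ * ‖θ z‖ₑ := by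
    intro q
    rw [inner_eq_integral]
    refine (enorm_integral_le_lintegral_enorm _).trans (le_of_eq (lintegral_congr_ae ?_))
    filter_upwards [coeFn_trans (plane q) G] with z hz
    rw [hz, enorm_mul]
  -- Cauchy–Schwarz on a square of measure one. Its horizontal side is exactly one period, so
  -- enlarging the vertical side to the whole line gives the full L² norm and nothing is counted
  -- twice.
  have inner_le : ∀ z, ∫⁻ q, ‖G (z + plane q)‖ₑ ∂(ρ.prod ρ) ≤ ‖G‖ₑ := by
    intro z
    have hmz : Measurable fun q => ‖G (z + plane q)‖ₑ :=
      hG.comp (measurable_const.add continuous_plane.measurable)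
    have hs : ∫⁻ q, ‖G (z + plane q)‖ₑ ^ (2 : ℝ) ∂(ρ.prod volume) = ∫⁻ w, ‖G w‖ₑ ^ (2 : ℝ) := by
      have e1 := measurePreserving_plane.lintegral_comp (f := fun w => ‖G (z + w)‖ₑ ^ (2 : ℝ))
        ((hG.comp (measurable_const.add measurable_id)).pow_const _)
      have e2 := (measurePreserving_add_strip z).lintegral_comp (f := fun w => ‖G w‖ₑ ^ (2 : ℝ))
        (hG.pow_const _)
      rw [e1, ← e2]
      simp only [add_comm z]
    have h2 := ENNReal.lintegral_mul_le_Lp_mul_Lq (ρ.prod ρ) Real.HolderConjugate.two_two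
      hmz.aemeasurable (g := fun _ => 1) aemeasurable_const
    simp only [Pi.mul_apply, mul_one, ENNReal.one_rpow, lintegral_one] at h2
    have hu : (ρ.prod ρ) univ = 1 := by
      rw [← univ_prod_univ, Measure.prod_prod]; simp [ρ]
    rw [hu, ENNReal.one_rpow, mul_one] at h2
    refine h2.trans ?_
    rw [enorm_eq_lintegral, ← hs]
    refine ENNReal.rpow_le_rpow (lintegral_mono' ?_ le_rfl) (by norm_num)
    exact Measure.prod_mono le_rfl Measure.restrict_le_self
  calc ‖⟪wavg 0 m₀ 1 (wavg 1 m₁ 1 G), θ⟫‖ₑ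
      ≤ ∫⁻ s, ‖⟪tr 0 s (wavg 1 m₁ 1 G), θ⟫‖ₑ ∂ρ := step h₀ _
    _ ≤ ∫⁻ s, ∫⁻ r, ‖⟪trans (plane (s, r)) G, θ⟫‖ₑ ∂ρ ∂ρ := by
        refine lintegral_mono fun s => ?_
        rw [(transComm_tr 0 s).wavg]
        refine (step h₁ _).trans (le_of_eq ?_)
        refine lintegral_congr fun r => ?_
        rw [← shift_add_shift, add_comm, trans_add]; rfl
    _ ≤ ∫⁻ s, (∫⁻ r, (∫⁻ z, ‖G (z + plane (s, r))‖ₑ * ‖θ z‖ₑ) ∂ρ) ∂ρ :=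
        lintegral_mono fun s => lintegral_mono fun r => pt _
    _ = ∫⁻ q, (∫⁻ z, ‖G (z + plane q)‖ₑ * ‖θ z‖ₑ) ∂(ρ.prod ρ) :=
        (lintegral_prod (fun q => ∫⁻ z, ‖G (z + plane q)‖ₑ * ‖θ z‖ₑ)
          (Measurable.lintegral_prod_right (f := fun q z => ‖G (z + plane q)‖ₑ * ‖θ z‖ₑ)
            hm).aemeasurable).symm
    _ = ∫⁻ z, ∫⁻ q, ‖G (z + plane q)‖ₑ * ‖θ z‖ₑ ∂(ρ.prod ρ) :=
        lintegral_lintegral_swap hm.aemeasurable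
    _ = ∫⁻ z, (∫⁻ q, ‖G (z + plane q)‖ₑ ∂(ρ.prod ρ)) * ‖θ z‖ₑ := by
        refine lintegral_congr fun z => ?_
        rw [lintegral_mul_const]
        exact hG.comp (measurable_const.add continuous_plane.measurable)
    _ ≤ ∫⁻ z, ‖G‖ₑ * ‖θ z‖ₑ := lintegral_mono fun z => by gcongr; exact inner_le z
    _ = ‖G‖ₑ * ∫⁻ z, ‖θ z‖ₑ := lintegral_const_mul _ hθ

/-- Functions with `f, ∂₁f, ∂₂f, ∂₁∂₂f ∈ L²`. -/
structure Good (f f1 f2 f12 : L2) : Prop where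
  d1 : LD 0 f f1
  d2 : LD 1 f f2
  d12 : LD 0 f2 f12

namespace Good

variable {f f1 f2 f12 g g1 g2 g12 : L2}

theorem d21 (h : Good f f1 f2 f12) : LD 1 f1 f12 := h.d1.mixed h.d2 h.d12

theorem map {L : L2 →L[ℝ] L2} (hL : TransComm L) (h : Good f f1 f2 f12) :
    Good (L f) (L f1) (L f2) (L f12) := ⟨h.d1.map hL, h.d2.map hL, h.d12.map hL⟩

theorem sub (h : Good f f1 f2 f12) (h' : Good g g1 g2 g12) :
    Good (f - g) (f1 - g1) (f2 - g2) (f12 - g12) :=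
  ⟨h.d1.sub h'.d1, h.d2.sub h'.d2, h.d12.sub h'.d12⟩

end Good

/-- `a` is bounded by `M` almost everywhere. -/
def Bd (a : L2) (M : ℝ) : Prop := ∀ᵐ z, |a z| ≤ M

/-- The dual description of the supremum norm; indicators of sets of finite measure suffice as test
functions. -/
theorem bd_of_inner_le {f : L2} {C : ℝ}
    (h : ∀ (s : Set Strip) (hs : MeasurableSet s) (hμ : volume s ≠ (⊤ : ℝ≥0∞)),
      |⟪f, indicatorConstLp 2 hs hμ (1 : ℝ)⟫| ≤ C * (volume s).toReal) : Bd f C := by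
  have key : ∀ s, MeasurableSet s → volume s < (⊤ : ℝ≥0∞) →
      IntegrableOn f s volume ∧ |∫ z in s, f z| ≤ C * (volume s).toReal := by
    intro s hs hμ
    refine ⟨?_, ?_⟩
    · have : IsFiniteMeasure (volume.restrict s) := ⟨by simpa using hμ⟩
      exact ((Lp.memLp f).restrict s).integrable (by norm_num)
    have := h s hs hμ.ne
    rwa [real_inner_comm, L2.inner_indicatorConstLp_one] at this
  have c1 : ∀ s, MeasurableSet s → volume s < (⊤ : ℝ≥0∞) → IntegrableOn (fun _ : Strip => C) s volume :=
    fun s _ hμ => integrableOn_const hμ.ne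
  have e1 : 0 ≤ᵐ[volume] fun z => C - f z := by
    refine ae_nonneg_of_forall_setIntegral_nonneg_of_sigmaFinite
      (fun s hs hμ => (c1 s hs hμ).sub (key s hs hμ).1) fun s hs hμ => ?_
    rw [integral_sub (c1 s hs hμ) (key s hs hμ).1, setIntegral_const, smul_eq_mul]
    have := (abs_le.1 (key s hs hμ).2).2
    rw [Measure.real]; linarith
  have e2 : 0 ≤ᵐ[volume] fun z => C + f z := by
    refine ae_nonneg_of_forall_setIntegral_nonneg_of_sigmaFinite
      (fun s hs hμ => (c1 s hs hμ).add (key s hs hμ).1) fun s hs hμ => ?_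
    rw [integral_add (c1 s hs hμ) (key s hs hμ).1, setIntegral_const, smul_eq_mul]
    have := (abs_le.1 (key s hs hμ).2).1
    rw [Measure.real]; linarith
  filter_upwards [e1, e2] with z h1 h2
  simp only [Pi.zero_apply] at h1 h2
  exact abs_le.2 ⟨by linarith, by linarith⟩

/-- The anisotropic embedding into bounded functions. -/
theorem Good.bd {f f1 f2 f12 : L2} (h : Good f f1 f2 f12) :
    Bd f (‖f‖ + ‖f1‖ + ‖f2‖ + ‖f12‖) := by
  refine bd_of_inner_le fun s hs hμ => ?_
  set θ : L2 := indicatorConstLp 2 hs hμ (1 : ℝ)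
  have hθ : ∫⁻ z, ‖θ z‖ₑ = volume s := by
    rw [← lintegral_indicator_one hs]
    refine lintegral_congr_ae ?_
    filter_upwards [indicatorConstLp_coeFn (p := 2) (hs := hs) (hμs := hμ) (c := (1 : ℝ))]
      with z hz
    rw [hz]
    by_cases hzs : z ∈ s <;> simp [hzs]
  have b1 : ∀ s ∈ Ioc (0 : ℝ) 1, |(1 : C(ℝ, ℝ)) s| ≤ 1 := by simp
  have b2 : ∀ s ∈ Ioc (0 : ℝ) 1, |oneSub s| ≤ 1 := fun s hs => by
    simp only [oneSub, ContinuousMap.coe_mk]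
    exact abs_le.2 ⟨by linarith [hs.2], by linarith [hs.1]⟩
  have main : ∀ {m₀ m₁ : C(ℝ, ℝ)} (_ : ∀ s ∈ Ioc (0 : ℝ) 1, |m₀ s| ≤ 1)
      (_ : ∀ s ∈ Ioc (0 : ℝ) 1, |m₁ s| ≤ 1) (G : L2),
      |⟪wavg 0 m₀ 1 (wavg 1 m₁ 1 G), θ⟫| ≤ ‖G‖ * (volume s).toReal := by
    intro m₀ m₁ h₀ h₁ G
    have := enorm_inner_wavg_wavg_le h₀ h₁ G θ
    rw [hθ, Real.enorm_eq_ofReal_abs] at this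
    have h3 := ENNReal.toReal_mono (ENNReal.mul_ne_top enorm_ne_top hμ) this
    rw [ENNReal.toReal_ofReal (abs_nonneg _), ENNReal.toReal_mul, toReal_enorm] at h3
    exact h3
  -- The one-dimensional representation is used in both directions, so that `f` becomes a
  -- combination of averages over unit squares of `f`, `f1`, `f2`, `f12`.
  have e1 := congrArg (wavg 0 1 1) h.d2.eq_wavg
  have e2 := congrArg (wavg 0 oneSub 1) h.d21.eq_wavg
  rw [map_sub] at e1 e2
  have e0 : ⟪f, θ⟫ = ⟪(wavg 0 1 1 (wavg 1 1 1 f) - wavg 0 1 1 (wavg 1 oneSub 1 f2))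
      - (wavg 0 oneSub 1 (wavg 1 1 1 f1) - wavg 0 oneSub 1 (wavg 1 oneSub 1 f12)), θ⟫ := by
    rw [← e1, ← e2, ← h.d1.eq_wavg]
  rw [e0]
  simp only [inner_sub_left]
  have m1 := abs_le.1 (main b1 b1 f)
  have m2 := abs_le.1 (main b1 b2 f2)
  have m3 := abs_le.1 (main b2 b1 f1)
  have m4 := abs_le.1 (main b2 b2 f12)
  rw [add_mul, add_mul, add_mul, abs_le]
  constructor <;> linarith [m1.1, m1.2, m2.1, m2.2, m3.1, m3.2, m4.1, m4.2]

/-- Product of a bounded and a square-integrable function. -/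
def bmul (a g : L2) : L2 := hat fun z => a z * g z

theorem bmul_comm (a g : L2) : bmul a g = bmul g a := by
  simp only [bmul, mul_comm]

namespace Bd

variable {a b g k : L2} {M N : ℝ}

theorem memLp (ha : Bd a M) (g : L2) : MemLp (fun z => a z * g z) 2 volume := by
  refine (Lp.memLp g).of_le_mul (c := M)
    ((Lp.aestronglyMeasurable a).mul (Lp.aestronglyMeasurable g)) ?_
  filter_upwards [ha] with z hz
  rw [norm_mul]
  exact mul_le_mul_of_nonneg_right hz (norm_nonneg _)

theorem coeFn (ha : Bd a M) (g : L2) : bmul a g =ᵐ[volume] fun z => a z * g z :=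
  coeFn_hat (ha.memLp g)

theorem norm_le (ha : Bd a M) (g : L2) : ‖bmul a g‖ ≤ M * ‖g‖ := by
  refine Lp.norm_le_mul_norm_of_ae_le_mul ?_
  filter_upwards [ha.coeFn g, ha] with z h1 h2
  rw [h1, norm_mul]
  exact mul_le_mul_of_nonneg_right h2 (norm_nonneg _)

theorem trans (ha : Bd a M) (c : Strip) : Bd (trans c a) M := by
  have h := (measurePreserving_add_strip c).quasiMeasurePreserving.ae ha
  filter_upwards [h, coeFn_trans c a] with z h1 h2
  rwa [h2]

theorem trans_bmul (ha : Bd a M) (c : Strip) (g : L2) :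
    MHD.trans c (bmul a g) = bmul (MHD.trans c a) (MHD.trans c g) := by
  rw [bmul, trans_hat _ (ha.memLp g)]
  refine hat_congr ?_
  filter_upwards [coeFn_trans c a, coeFn_trans c g] with z h1 h2
  rw [h1, h2]

theorem bmul_sub (ha : Bd a M) (g k : L2) : bmul a (g - k) = bmul a g - bmul a k := by
  apply Lp.ext
  filter_upwards [ha.coeFn g, ha.coeFn k, ha.coeFn (g - k), Lp.coeFn_sub g k,
    Lp.coeFn_sub (bmul a g) (bmul a k)] with z h1 h2 h3 h4 h5
  rw [h3, h4, h5, Pi.sub_apply, Pi.sub_apply, h1, h2]; ring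

theorem bmul_smul (ha : Bd a M) (c : ℝ) (g : L2) : bmul a (c • g) = c • bmul a g := by
  apply Lp.ext
  filter_upwards [ha.coeFn g, ha.coeFn (c • g), Lp.coeFn_smul c g,
    Lp.coeFn_smul c (bmul a g)] with z h1 h2 h3 h4
  rw [h2, h3, h4, Pi.smul_apply, Pi.smul_apply, h1]; simp only [smul_eq_mul]; ring

theorem sub_bmul (ha : Bd a M) (hb : Bd b N) (g : L2) :
    bmul (a - b) g = bmul a g - bmul b g := by
  have hab : Bd (a - b) (M + N) := by
    filter_upwards [ha, hb, Lp.coeFn_sub a b] with z h1 h2 h3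
    rw [h3, Pi.sub_apply]
    exact (abs_sub _ _).trans (add_le_add h1 h2)
  apply Lp.ext
  filter_upwards [ha.coeFn g, hb.coeFn g, hab.coeFn g, Lp.coeFn_sub a b,
    Lp.coeFn_sub (bmul a g) (bmul b g)] with z h1 h2 h3 h4 h5
  rw [h3, h4, h5, Pi.sub_apply, Pi.sub_apply, h1, h2]; ring

theorem inner_bmul (ha : Bd a M) (f g : L2) : ⟪f, bmul a g⟫ = ∫ z, a z * f z * g z := by
  rw [bmul, inner_hat (ha.memLp g)]
  congr 1; ext1 z; ring

theorem tendsto (ha : Bd a M) {ι : Type*} {l : Filter ι} {u : ι → L2}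
    (hu : Tendsto u l (𝓝 g)) : Tendsto (fun x => bmul a (u x)) l (𝓝 (bmul a g)) := by
  rw [tendsto_iff_norm_sub_tendsto_zero] at hu ⊢
  refine squeeze_zero (fun _ => norm_nonneg _) (fun x => ?_) (by simpa using hu.const_mul M)
  rw [← ha.bmul_sub]
  exact ha.norm_le _

end Bd

/-- Integration by parts for a product of three functions, two of which are bounded. -/
theorem integral_triple_by_parts {i : Fin 2} {a a' g g' k k' : L2} {M N : ℝ} (ha : LD i a a')
    (hg : LD i g g') (hk : LD i k k') (hM : Bd a M) (hN : Bd k N) :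
    ⟪a', bmul k g⟫ + ⟪g', bmul a k⟫ + ⟪k', bmul a g⟫ = 0 := by
  -- Discrete Leibniz rule: the three differences telescope to the translate of the triple product
  -- minus the product itself, whose integral vanishes by translation invariance. Each term is
  -- arranged so that only `a` or `k` needs a pointwise bound in the limit.
  have key : ∀ s, ⟪dq i s a, tr i s (bmul k g)⟫ + ⟪dq i s g, bmul a (tr i s k)⟫
      + ⟪dq i s k, bmul a g⟫ = 0 := by
    intro s
    have hNs : Bd (tr i s k) N := hN.trans _
    simp only [dq_apply, inner_smul_left, inner_sub_left, ← mul_add]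
    refine mul_eq_zero_of_right _ ?_
    have e1 : ⟪tr i s a, tr i s (bmul k g)⟫ = ⟪a, bmul k g⟫ := inner_trans_trans _ _ _
    have e2 : tr i s (bmul k g) = bmul (tr i s k) (tr i s g) := hN.trans_bmul _ _
    rw [e1, e2, hN.inner_bmul, hNs.inner_bmul, hM.inner_bmul, hM.inner_bmul, hM.inner_bmul,
      hM.inner_bmul]
    have c1 : ∫ z, k z * a z * g z = ∫ z, a z * k z * g z := by congr 1; ext1 z; ring
    have c2 : ∫ z, tr i s k z * a z * tr i s g z = ∫ z, a z * tr i s g z * tr i s k z := by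
      congr 1; ext1 z; ring
    have c3 : ∫ z, a z * tr i s k z * g z = ∫ z, a z * g z * tr i s k z := by
      congr 1; ext1 z; ring
    rw [c1, c2, c3]; ring
  have ht : ∀ f : L2, Tendsto (fun s => tr i s f) (𝓝[>] 0) (𝓝 f) := fun f => by
    have := (continuous_tr i f).tendsto 0
    rw [tr_zero] at this
    exact this.mono_left nhdsWithin_le_nhds
  have h1 := (ha.tendsto_dq).inner (𝕜 := ℝ) (ht (bmul k g))
  have h2 := (hg.tendsto_dq).inner (𝕜 := ℝ) (hM.tendsto (ht k))
  have h3 := (hk.tendsto_dq).inner (𝕜 := ℝ) (tendsto_const_nhds (x := bmul a g))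
  have h4 := (h1.add h2).add h3
  simp only [key] at h4
  exact tendsto_nhds_unique h4 tendsto_const_nhds |>.symm ▸ rfl

/-- The mean in the horizontal variable is invariant under horizontal translation. -/
theorem tr_avg_zero_one (s : ℝ) (f : L2) : tr 0 s (avg 0 1 f) = avg 0 1 f := by
  have h := LD_avg 0 1 f
  rw [dq_apply, tr_zero_one, sub_self, smul_zero] at h
  have := h.sub_eq_integral 0 s
  simpa [sub_eq_zero] using this

/-- Poincaré's inequality in the horizontal variable: average the bound on a translation increment
over translations of length at most one. -/
theorem norm_sub_avg_le {f f1 : L2} (h : LD 0 f f1) : ‖f - avg 0 1 f‖ ≤ ‖f1‖ := by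
  have e : f - avg 0 1 f = -∫ s in (0 : ℝ)..1, (tr 0 s f - f) := by
    rw [intervalIntegral.integral_sub ((continuous_tr 0 f).intervalIntegrable _ _)
      (continuous_const.intervalIntegrable _ _), avg_apply]
    simp
  rw [e, norm_neg]
  have := intervalIntegral.norm_integral_le_of_norm_le_const (a := 0) (b := 1)
    (f := fun s => tr 0 s f - f) (C := ‖f1‖) (fun s hs => by
      rw [uIoc_of_le zero_le_one] at hs
      refine (h.norm_tr_sub_le s).trans (mul_le_of_le_one_left (norm_nonneg _) ?_)
      rw [abs_of_pos hs.1]; exact hs.2)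
  simpa using this

/-- The oscillation in the horizontal variable is bounded by the dissipation. -/
theorem Good.bd_sub_avg {f f1 f2 f12 : L2} (h : Good f f1 f2 f12) :
    Bd (f - avg 0 1 f) (2 * (‖f1‖ + ‖f12‖)) ∧ LD 0 (f - avg 0 1 f) f1 := by
  have z : ∀ g, dq 0 1 g = 0 := fun g => by rw [dq_apply, tr_zero_one, sub_self, smul_zero]
  -- Horizontal derivatives have zero horizontal mean, so subtracting the mean changes `f` and `f2`
  -- but not `f1` and `f12`; Poincaré's inequality then bounds the first two by the last two.
  have h0 : avg 0 1 f1 = 0 := by rw [← h.d1.dq_eq_avg, z]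
  have h1 : avg 0 1 f12 = 0 := by rw [← h.d12.dq_eq_avg, z]
  have hg := h.sub (h.map (transComm_avg 0 1))
  rw [h0, h1, sub_zero, sub_zero] at hg
  refine ⟨?_, hg.d1⟩
  filter_upwards [hg.bd] with z hz
  have := norm_sub_avg_le h.d1
  have := norm_sub_avg_le h.d12
  linarith

/-- The anisotropic trilinear estimate. -/
theorem Good.abs_inner_bmul_le {f f1 f2 f12 k k1 k2 k12 g g1 : L2} (hf : Good f f1 f2 f12)
    (hk : Good k k1 k2 k12) (hg : LD 0 g g1) :
    |⟪f1, bmul k g⟫| ≤ 2 * (‖f1‖ + ‖f12‖) * (‖g1‖ * ‖k‖ + ‖k1‖ * ‖g‖) := by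
  obtain ⟨hb, hd⟩ := hf.bd_sub_avg
  have h := integral_triple_by_parts hd hg hk.d1 hb hk.bd
  -- `f1` is also the derivative of the oscillation of `f`. The mean of `f`, which the dissipation
  -- does not control, therefore never appears.
  have e : ⟪f1, bmul k g⟫ = -⟪g1, bmul (f - avg 0 1 f) k⟫ - ⟪k1, bmul (f - avg 0 1 f) g⟫ := by
    linarith
  have b1 := (abs_real_inner_le_norm g1 (bmul (f - avg 0 1 f) k)).trans
    (mul_le_mul_of_nonneg_left (hb.norm_le k) (norm_nonneg _))
  have b2 := (abs_real_inner_le_norm k1 (bmul (f - avg 0 1 f) g)).trans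
    (mul_le_mul_of_nonneg_left (hb.norm_le g) (norm_nonneg _))
  rw [e, abs_le]
  rw [abs_le] at b1 b2
  constructor <;> nlinarith [b1.1, b1.2, b2.1, b2.2]

/-- Convection by a divergence-free field is antisymmetric. -/
theorem convect_antisymm {v0 v01 v02 v012 v1 v11 v12 v112 w w1 w2 w12 k k1 k2 k12 : L2}
    (h0 : Good v0 v01 v02 v012) (h1 : Good v1 v11 v12 v112) (hdiv : v01 + v12 = 0)
    (hw : Good w w1 w2 w12) (hk : Good k k1 k2 k12) :
    ⟪bmul v0 w1 + bmul v1 w2, k⟫ + ⟪bmul v0 k1 + bmul v1 k2, w⟫ = 0 := by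
  -- One integration by parts per direction; in the sum the terms with a derivative on the
  -- transporting field combine to the divergence and cancel.
  have e0 := integral_triple_by_parts h0.d1 hw.d1 hk.d1 h0.bd hk.bd
  have e1 := integral_triple_by_parts h1.d2 hw.d2 hk.d2 h1.bd hk.bd
  have hs : v12 = -v01 := by rw [eq_neg_iff_add_eq_zero, add_comm, hdiv]
  have s : ∀ {a : L2} {M : ℝ} (_ : Bd a M) (f g : L2), ⟪bmul a f, g⟫ = ⟪f, bmul a g⟫ := by
    intro a M ha f g
    rw [real_inner_comm, ha.inner_bmul, ha.inner_bmul]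
    congr 1; ext1 z; ring
  rw [hs, inner_neg_left] at e1
  rw [inner_add_left, inner_add_left, s h0.bd, s h0.bd, s h1.bd, s h1.bd]
  linarith

end

/-! ### Abstract energy equality: passage to the diagonal -/

section

/-- A discrete product rule passes to the limit of fine partitions. -/
theorem sub_eq_two_mul_integral_diag {T : ℝ} (hT : 0 < T) {q κ : ℝ → ℝ} {K : ℝ → ℝ → ℝ}
    (hκ : IntegrableOn κ (Ioc 0 T))
    (hq : ∀ s t, 0 ≤ s → s ≤ t → t ≤ T → q t - q s = ∫ τ in s..t, (K τ t + K τ s))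
    (hmeas : ∀ t ∈ Icc 0 T, AEStronglyMeasurable (fun τ => K τ t) (volume.restrict (Ioc 0 T)))
    (hb : ∀ᵐ τ ∂(volume.restrict (Ioc 0 T)), ∀ t ∈ Icc 0 T, |K τ t| ≤ κ τ)
    (hc : ∀ᵐ τ ∂(volume.restrict (Ioc 0 T)), ContinuousOn (K τ) (Icc 0 T)) :
    AEStronglyMeasurable (fun τ => K τ τ) (volume.restrict (Ioc 0 T)) ∧
      q T - q 0 = 2 * ∫ τ in (0 : ℝ)..T, K τ τ := by
  set δ : ℕ → ℝ := fun n => T / (n + 1)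
  have hδ : ∀ n, 0 < δ n := fun n => by positivity
  have hδT : ∀ n : ℕ, ((n + 1 : ℕ) : ℝ) * δ n = T := fun n => by
    simp only [δ]; push_cast; field_simp
  -- `up` and `dn` are the right and left endpoints of the cell containing τ. Cells are open on the
  -- left and closed on the right, matching the ceiling.
  let up : ℕ → ℝ → ℝ := fun n τ => (⌈τ / δ n⌉₊ : ℝ) * δ n
  let dn : ℕ → ℝ → ℝ := fun n τ => ((⌈τ / δ n⌉₊ : ℝ) - 1) * δ n
  have hle : ∀ n : ℕ, ∀ i ≤ n + 1, (i : ℝ) * δ n ∈ Icc 0 T := fun n i hi => by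
    refine ⟨by have := hδ n; positivity, ?_⟩
    rw [← hδT n]
    exact mul_le_mul_of_nonneg_right (by exact_mod_cast hi) (hδ n).le
  have hceil : ∀ n i : ℕ, ∀ τ ∈ Ioc ((i : ℝ) * δ n) (((i + 1 : ℕ) : ℝ) * δ n), ⌈τ / δ n⌉₊ = i + 1 := by
    intro n i τ hτ
    rw [Nat.ceil_eq_iff (by omega)]
    constructor
    · rw [lt_div_iff₀ (hδ n)]; simpa using hτ.1
    · rw [div_le_iff₀ (hδ n)]; exact hτ.2
  have hrange : ∀ n, ∀ τ ∈ Ioc 0 T, up n τ ∈ Icc 0 T ∧ dn n τ ∈ Icc 0 T ∧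
      |up n τ - τ| ≤ δ n ∧ |dn n τ - τ| ≤ δ n := by
    intro n τ hτ
    have h1 : 0 < τ / δ n := div_pos hτ.1 (hδ n)
    have h2 : 1 ≤ ⌈τ / δ n⌉₊ := Nat.ceil_pos.2 h1
    have h3 : ⌈τ / δ n⌉₊ ≤ n + 1 := by
      rw [Nat.ceil_le, div_le_iff₀ (hδ n), hδT]; exact hτ.2
    have h4 : τ ≤ (⌈τ / δ n⌉₊ : ℝ) * δ n := by
      rw [← div_le_iff₀ (hδ n)]; exact Nat.le_ceil _
    have h5 : ((⌈τ / δ n⌉₊ : ℝ) - 1) * δ n ≤ τ := by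
      rw [← le_div_iff₀ (hδ n)]; linarith [Nat.ceil_lt_add_one h1.le]
    have h6 : (0 : ℝ) ≤ ((⌈τ / δ n⌉₊ : ℝ) - 1) * δ n :=
      mul_nonneg (by have : (1 : ℝ) ≤ ⌈τ / δ n⌉₊ := by exact_mod_cast h2
                     linarith) (hδ n).le
    refine ⟨hle n _ h3, ⟨h6, h5.trans hτ.2⟩, abs_le.2 ⟨?_, ?_⟩, abs_le.2 ⟨?_, ?_⟩⟩ <;>
      simp only [up, dn] <;> nlinarith [hδ n]
  have hKi : ∀ t ∈ Icc 0 T, IntegrableOn (fun τ => K τ t) (Ioc 0 T) := fun t ht =>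
    Integrable.mono' hκ (hmeas t ht) (by filter_upwards [hb] with τ h using h t ht)
  -- The second argument is frozen at the two endpoints of the current cell. The integral telescopes
  -- to `q T - q 0` for every `n`, while `G n τ` tends to twice the diagonal value.
  let G : ℕ → ℝ → ℝ := fun n τ => K τ (up n τ) + K τ (dn n τ)
  have hpiece : ∀ n i : ℕ, i < n + 1 → EqOn
      (fun τ => K τ (((i + 1 : ℕ) : ℝ) * δ n) + K τ ((i : ℝ) * δ n)) (G n)
      (uIoc ((i : ℝ) * δ n) (((i + 1 : ℕ) : ℝ) * δ n)) := by
    intro n i hi τ hτ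
    rw [uIoc_of_le (mul_le_mul_of_nonneg_right (by simp) (hδ n).le)] at hτ
    simp only [G, up, dn, hceil n i τ hτ]
    push_cast; ring_nf
  have hpieceI : ∀ n i : ℕ, i < n + 1 → IntervalIntegrable (G n) volume ((i : ℝ) * δ n)
      (((i + 1 : ℕ) : ℝ) * δ n) := by
    intro n i hi
    refine IntervalIntegrable.congr (hpiece n i hi) ?_
    rw [intervalIntegrable_iff_integrableOn_Ioc_of_le
      (mul_le_mul_of_nonneg_right (by simp) (hδ n).le)]
    refine IntegrableOn.mono_set ((hKi _ (hle n _ hi)).add (hKi _ (hle n _ hi.le))) ?_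
    exact Ioc_subset_Ioc (hle n i hi.le).1 (hle n (i + 1) hi).2
  have hGi : ∀ n, IntervalIntegrable (G n) volume 0 T := by
    intro n
    have := IntervalIntegrable.trans_iterate (a := fun i : ℕ => (i : ℝ) * δ n) (hpieceI n)
    rw [hδT] at this
    simpa using this
  have hGint : ∀ n, ∫ τ in (0 : ℝ)..T, G n τ = q T - q 0 := by
    intro n
    have h1 := intervalIntegral.sum_integral_adjacent_intervals
      (a := fun i : ℕ => (i : ℝ) * δ n) (hpieceI n)
    rw [hδT] at h1
    simp only [CharP.cast_eq_zero, zero_mul] at h1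
    have h2 := Finset.sum_range_sub (fun i : ℕ => q ((i : ℝ) * δ n)) (n + 1)
    rw [hδT] at h2
    simp only [CharP.cast_eq_zero, zero_mul] at h2
    rw [← h1, ← h2]
    refine Finset.sum_congr rfl fun i hi => ?_
    rw [Finset.mem_range] at hi
    rw [hq _ _ (hle n i hi.le).1 (mul_le_mul_of_nonneg_right (by simp) (hδ n).le)
      (hle n (i + 1) hi).2]
    exact (intervalIntegral.integral_congr_ae
      (Eventually.of_forall fun τ hτ => hpiece n i hi hτ)).symm
  have hδ0 : Tendsto δ atTop (𝓝 0) := by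
    have := (tendsto_one_div_add_atTop_nhds_zero_nat (𝕜 := ℝ)).const_mul T
    simpa [δ, div_eq_mul_inv] using this
  have hlim : ∀ᵐ τ ∂(volume.restrict (Ioc 0 T)),
      Tendsto (fun n => G n τ) atTop (𝓝 (K τ τ + K τ τ)) := by
    filter_upwards [hc, ae_restrict_mem measurableSet_Ioc] with τ hτc hτ
    have hcw := hτc τ (Ioc_subset_Icc_self hτ)
    have aux : ∀ r : ℕ → ℝ → ℝ, (∀ n, r n τ ∈ Icc 0 T ∧ |r n τ - τ| ≤ δ n) →
        Tendsto (fun n => K τ (r n τ)) atTop (𝓝 (K τ τ)) := by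
      intro r hr
      refine hcw.tendsto.comp (tendsto_nhdsWithin_iff.2 ⟨?_, Eventually.of_forall fun n => (hr n).1⟩)
      rw [tendsto_iff_dist_tendsto_zero]
      exact squeeze_zero (fun _ => dist_nonneg) (fun n => (hr n).2) hδ0
    exact (aux up fun n => ⟨(hrange n τ hτ).1, (hrange n τ hτ).2.2.1⟩).add
      (aux dn fun n => ⟨(hrange n τ hτ).2.1, (hrange n τ hτ).2.2.2⟩)
  have hGm : ∀ n, AEStronglyMeasurable (G n) (volume.restrict (Ioc 0 T)) := fun n =>
    (hGi n).1.aestronglyMeasurable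
  have hm2 : AEStronglyMeasurable (fun τ => K τ τ + K τ τ) (volume.restrict (Ioc 0 T)) :=
    aestronglyMeasurable_of_tendsto_ae atTop hGm hlim
  refine ⟨?_, ?_⟩
  · have := hm2.const_mul (1 / 2)
    refine this.congr (Eventually.of_forall fun τ => ?_)
    simp only; ring
  · have h := tendsto_integral_of_dominated_convergence (fun τ => κ τ + κ τ) hGm (hκ.add hκ)
      (fun n => by
        filter_upwards [hb, ae_restrict_mem measurableSet_Ioc] with τ h hτ
        exact (norm_add_le _ _).trans (add_le_add (h _ (hrange n τ hτ).1)
          (h _ (hrange n τ hτ).2.1))) hlim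
    simp only [← intervalIntegral.integral_of_le hT.le, hGint] at h
    have h2 := tendsto_nhds_unique h tendsto_const_nhds
    rw [← h2, ← intervalIntegral.integral_const_mul]
    congr 1; ext1 τ; ring

/-! ### Abstract energy equality: resolvent regularization -/

section Abstract

variable {V H : Type*} [NormedAddCommGroup V] [InnerProductSpace ℝ V]
  [NormedAddCommGroup H] [InnerProductSpace ℝ H] {ι d : V →L[ℝ] H}

variable {J : H →L[ℝ] V} {ε : ℝ}

/-- The defining form is symmetric. This turns increments of ⟪w, ι J w⟫ into a sum of two tested
increments. -/
theorem resolvent_symm (hJ : ∀ f y, ⟪ι (J f), ι y⟫ + ε * ⟪d (J f), d y⟫ = ⟪f, ι y⟫) (f g : H) :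
    ⟪f, ι (J g)⟫ = ⟪g, ι (J f)⟫ := by
  rw [← hJ f, ← hJ g, real_inner_comm (ι (J g)), real_inner_comm (d (J g))]

/-- Take `y = J f` in the defining relation and discard the nonnegative `d` term. -/
theorem norm_resolvent_le (hε : 0 < ε)
    (hJ : ∀ f y, ⟪ι (J f), ι y⟫ + ε * ⟪d (J f), d y⟫ = ⟪f, ι y⟫) (f : H) : ‖ι (J f)‖ ≤ ‖f‖ := by
  have h := hJ f (J f)
  rw [real_inner_self_eq_norm_mul_norm, real_inner_self_eq_norm_mul_norm] at h
  have h2 := real_inner_le_norm f (ι (J f))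
  have h3 : 0 ≤ ε * (‖d (J f)‖ * ‖d (J f)‖) := by positivity
  by_contra! hlt
  nlinarith [norm_nonneg f]

/-- Take `y = J (ι v) - v`. The result bounds the derivative of the regularization uniformly in ε
and gives convergence in `H` at rate √ε. -/
theorem resolvent_bounds (hε : 0 < ε)
    (hJ : ∀ f y, ⟪ι (J f), ι y⟫ + ε * ⟪d (J f), d y⟫ = ⟪f, ι y⟫) (v : V) :
    ‖d (J (ι v))‖ ≤ ‖d v‖ ∧ ‖ι (J (ι v)) - ι v‖ ^ 2 ≤ ε * ‖d v‖ ^ 2 := by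
  set z := J (ι v)
  have h := hJ (ι v) (z - v)
  have h1 : ‖ι z - ι v‖ ^ 2 + ε * ‖d z‖ ^ 2 = ε * ⟪d z, d v⟫ := by
    rw [← real_inner_self_eq_norm_sq, ← real_inner_self_eq_norm_sq]
    simp only [map_sub, inner_sub_left, inner_sub_right] at h ⊢
    rw [real_inner_comm (ι z) (ι v)] at *
    linarith
  have h2 := real_inner_le_norm (d z) (d v)
  have h3 : ‖d z‖ ≤ ‖d v‖ := by
    by_contra! hlt
    have : ‖d z‖ * ‖d v‖ < ‖d z‖ ^ 2 := by nlinarith [norm_nonneg (d v)]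
    nlinarith [sq_nonneg ‖ι z - ι v‖]
  refine ⟨h3, ?_⟩
  have : ‖d z‖ * ‖d v‖ ≤ ‖d v‖ ^ 2 := by nlinarith [norm_nonneg (d v)]
  nlinarith [sq_nonneg ‖d z‖]

variable {Js : ℕ → H →L[ℝ] V} {εs : ℕ → ℝ}

theorem tendsto_resolvent_apply (h0 : Tendsto εs atTop (𝓝 0)) (hε : ∀ n, 0 < εs n)
    (hJ : ∀ n f y, ⟪ι (Js n f), ι y⟫ + εs n * ⟪d (Js n f), d y⟫ = ⟪f, ι y⟫) (v : V) :
    Tendsto (fun n => ι (Js n (ι v))) atTop (𝓝 (ι v)) := by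
  rw [tendsto_iff_norm_sub_tendsto_zero]
  have h1 : Tendsto (fun n => ‖ι (Js n (ι v)) - ι v‖ ^ 2) atTop (𝓝 0) :=
    squeeze_zero (fun _ => sq_nonneg _) (fun n => (resolvent_bounds (hε n) (hJ n) v).2)
      (by simpa using h0.mul_const (‖d v‖ ^ 2))
  have := h1.sqrt
  simpa [Real.sqrt_sq] using this

/-- Convergence on the range of `ι` extends to its closure by contractivity. At the endpoint times a
field is only known to lie in this closure. -/
theorem tendsto_resolvent (h0 : Tendsto εs atTop (𝓝 0)) (hε : ∀ n, 0 < εs n)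
    (hJ : ∀ n f y, ⟪ι (Js n f), ι y⟫ + εs n * ⟪d (Js n f), d y⟫ = ⟪f, ι y⟫) {f : H}
    (hf : f ∈ closure (range ι)) : Tendsto (fun n => ι (Js n f)) atTop (𝓝 f) := by
  rw [Metric.tendsto_atTop]
  intro r hr
  obtain ⟨_, ⟨v, rfl⟩, hv⟩ := Metric.mem_closure_iff.1 hf (r / 3) (by positivity)
  obtain ⟨N, hN⟩ := Metric.tendsto_atTop.1 (tendsto_resolvent_apply h0 hε hJ v) (r / 3)
    (by positivity)
  refine ⟨N, fun n hn => ?_⟩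
  have h1 : dist (ι (Js n f)) (ι (Js n (ι v))) ≤ dist f (ι v) := by
    rw [dist_eq_norm, dist_eq_norm, ← map_sub, ← map_sub]
    exact norm_resolvent_le (hε n) (hJ n) _
  have h2 := dist_triangle4 (ι (Js n f)) (ι (Js n (ι v))) (ι v) f
  have h3 := hN n hn
  rw [dist_comm (ι v) f] at h2
  linarith

variable [CompleteSpace V] [CompleteSpace H]

/-- The resolvent of the form `⟪d x, d y⟫`. -/
theorem exists_resolvent (hn : ∀ x y : V, ⟪x, y⟫ = ⟪ι x, ι y⟫ + ⟪d x, d y⟫) (hε : 0 < ε) :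
    ∃ J : H →L[ℝ] V, ∀ f y, ⟪ι (J f), ι y⟫ + ε * ⟪d (J f), d y⟫ = ⟪f, ι y⟫ := by
  have hn2 : ∀ x : V, ‖x‖ * ‖x‖ = ‖ι x‖ * ‖ι x‖ + ‖d x‖ * ‖d x‖ := fun x => by
    simpa only [real_inner_self_eq_norm_mul_norm] using hn x x
  let B : V →L[ℝ] V →L[ℝ] ℝ := LinearMap.mkContinuous₂
    (LinearMap.mk₂ ℝ (fun x y : V => ⟪ι x, ι y⟫ + ε * ⟪d x, d y⟫)
      (fun x x' y => by simp only [map_add, inner_add_left]; ring)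
      (fun c x y => by simp only [map_smul, real_inner_smul_left, smul_eq_mul]; ring)
      (fun x y y' => by simp only [map_add, inner_add_right]; ring)
      (fun c x y => by simp only [map_smul, real_inner_smul_right, smul_eq_mul]; ring))
    (‖ι‖ * ‖ι‖ + ε * (‖d‖ * ‖d‖)) (fun x y => by
      simp only [LinearMap.mk₂_apply]
      have h1 := (norm_inner_le_norm (𝕜 := ℝ) (ι x) (ι y)).trans
        (mul_le_mul (ι.le_opNorm x) (ι.le_opNorm y) (norm_nonneg _) (by positivity))
      have h2 := (norm_inner_le_norm (𝕜 := ℝ) (d x) (d y)).trans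
        (mul_le_mul (d.le_opNorm x) (d.le_opNorm y) (norm_nonneg _) (by positivity))
      refine (norm_add_le _ _).trans ?_
      rw [norm_mul, Real.norm_eq_abs ε, abs_of_pos hε]
      have := mul_le_mul_of_nonneg_left h2 hε.le
      nlinarith)
  have hB : ∀ x y, B x y = ⟪ι x, ι y⟫ + ε * ⟪d x, d y⟫ := fun _ _ => rfl
  have hc : IsCoercive B := by
    -- The form dominates `min 1 ε` times the squared norm of `V`, so Lax–Milgram applies; composing
    -- the inverse with the adjoint of `ι` gives `J`.
    refine ⟨min 1 ε, lt_min one_pos hε, fun u => ?_⟩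
    rw [hB, mul_assoc, hn2, real_inner_self_eq_norm_mul_norm, real_inner_self_eq_norm_mul_norm,
      mul_add]
    exact add_le_add (mul_le_of_le_one_left (mul_self_nonneg _) (min_le_left _ _))
      (mul_le_mul_of_nonneg_right (min_le_right _ _) (mul_self_nonneg _))
  refine ⟨(hc.continuousLinearEquivOfBilin.symm : V →L[ℝ] V) ∘L ContinuousLinearMap.adjoint ι,
    fun f y => ?_⟩
  rw [← hB, ← IsCoercive.continuousLinearEquivOfBilin_apply hc]
  simp [ContinuousLinearMap.adjoint_inner_left]

/-- The regularizations are bounded in `V` and converge after applying `ι`, hence converge weakly in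
`V`. Subtracting the `H` part of the inner product leaves the claimed limit. -/
theorem tendsto_resolvent_energy (hn : ∀ x y : V, ⟪x, y⟫ = ⟪ι x, ι y⟫ + ⟪d x, d y⟫)
    (hinj : Function.Injective ι) (h0 : Tendsto εs atTop (𝓝 0)) (hε : ∀ n, 0 < εs n)
    (hJ : ∀ n f y, ⟪ι (Js n f), ι y⟫ + εs n * ⟪d (Js n f), d y⟫ = ⟪f, ι y⟫) (v : V) :
    Tendsto (fun n => ⟪d v, d (Js n (ι v))⟫) atTop (𝓝 (‖d v‖ ^ 2)) := by
  set z : ℕ → V := fun n => Js n (ι v)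
  have hbd : ∀ n, ‖z n‖ ≤ ‖v‖ := by
    intro n
    have h1 := norm_resolvent_le (hε n) (hJ n) (ι v)
    have h2 := (resolvent_bounds (hε n) (hJ n) v).1
    have h3 : ‖z n‖ ^ 2 ≤ ‖v‖ ^ 2 := by
      rw [← real_inner_self_eq_norm_sq, ← real_inner_self_eq_norm_sq, hn, hn]
      simp only [real_inner_self_eq_norm_sq]
      gcongr
    exact (pow_le_pow_iff_left₀ (norm_nonneg _) (norm_nonneg _) two_ne_zero).1 h3
  -- The orthogonal complement of the range of the adjoint is the kernel of `ι`, which is trivial.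
  -- Weak convergence may therefore be tested on vectors coming from `H`.
  have hdense : DenseRange (ContinuousLinearMap.adjoint ι) := by
    have h1 := Submodule.dense_iff_topologicalClosure_eq_top.2
      ((Submodule.topologicalClosure_eq_top_iff
        (K := (ContinuousLinearMap.adjoint ι).range)).2 (by
          rw [Submodule.eq_bot_iff]
          intro y hy
          refine hinj ?_
          rw [map_zero]
          refine ext_inner_left ℝ fun f => ?_
          rw [inner_zero_right, ← ContinuousLinearMap.adjoint_inner_left]
          exact hy _ ⟨f, rfl⟩))
    exact h1
  have hweak : ∀ y : V, Tendsto (fun n => ⟪y, z n⟫) atTop (𝓝 ⟪y, v⟫) := by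
    intro y
    rw [Metric.tendsto_atTop]
    intro r hr
    obtain ⟨_, ⟨f, rfl⟩, hf⟩ := Metric.mem_closure_iff.1 (hdense y) (r / (3 * (‖v‖ + 1)))
      (by positivity)
    have ht : Tendsto (fun n => ⟪f, ι (z n)⟫) atTop (𝓝 ⟪f, ι v⟫) :=
      tendsto_const_nhds.inner (tendsto_resolvent_apply h0 hε hJ v)
    obtain ⟨N, hN⟩ := Metric.tendsto_atTop.1 ht (r / 3) (by positivity)
    refine ⟨N, fun n hn' => ?_⟩
    have e := hN n hn'
    rw [Real.dist_eq, ← ContinuousLinearMap.adjoint_inner_left ι (z n) f,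
      ← ContinuousLinearMap.adjoint_inner_left ι v f, abs_lt] at e
    set y' := ContinuousLinearMap.adjoint ι f
    rw [dist_eq_norm] at hf
    have small : ∀ x : V, ‖x‖ ≤ ‖v‖ → |⟪y - y', x⟫| ≤ r / 3 := by
      intro x hx
      refine (abs_real_inner_le_norm _ _).trans ?_
      have : ‖y - y'‖ * ‖x‖ ≤ r / (3 * (‖v‖ + 1)) * (‖v‖ + 1) :=
        mul_le_mul hf.le (by linarith) (norm_nonneg _) (by positivity)
      refine this.trans (le_of_eq ?_)
      field_simp
    have s1 := abs_le.1 (small (z n) (hbd n))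
    have s2 := abs_le.1 (small v le_rfl)
    rw [inner_sub_left] at s1 s2
    rw [Real.dist_eq, abs_lt]
    constructor <;> linarith [s1.1, s1.2, s2.1, s2.2, e.1, e.2]
  have h1 := (hweak v).sub ((tendsto_const_nhds (x := ι v)).inner (𝕜 := ℝ)
    (tendsto_resolvent_apply h0 hε hJ v))
  have e1 : ∀ n, ⟪v, z n⟫ - ⟪ι v, ι (Js n (ι v))⟫ = ⟪d v, d (z n)⟫ := fun n => by
    rw [hn]; simp [z]
  have e2 : ⟪v, v⟫ - ⟪ι v, ι v⟫ = ‖d v‖ ^ 2 := by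
    rw [hn, add_sub_cancel_left, real_inner_self_eq_norm_sq]
  simp only [e1, e2] at h1
  exact h1

/-- Energy equality for an abstract parabolic equation with integrable forcing. -/
theorem energy_equality (hn : ∀ x y : V, ⟪x, y⟫ = ⟪ι x, ι y⟫ + ⟪d x, d y⟫)
    (hinj : Function.Injective ι) {T M ν : ℝ} (hT : 0 < T) {w F : ℝ → H} {v : ℝ → V} {κ : ℝ → ℝ}
    (hM : ∀ t ∈ Icc 0 T, ‖w t‖ ≤ M)
    (hv : ∀ᵐ τ ∂(volume.restrict (Ioc 0 T)), ι (v τ) = w τ)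
    (hκ : IntegrableOn κ (Ioc 0 T))
    (hF : ∀ᵐ τ ∂(volume.restrict (Ioc 0 T)), ‖F τ‖ ≤ κ τ)
    (hd : ∀ᵐ τ ∂(volume.restrict (Ioc 0 T)), ‖d (v τ)‖ ^ 2 ≤ κ τ)
    (mF : ∀ φ, AEStronglyMeasurable (fun τ => ⟪F τ, φ⟫) (volume.restrict (Ioc 0 T)))
    (md : ∀ φ, AEStronglyMeasurable (fun τ => ⟪d (v τ), φ⟫) (volume.restrict (Ioc 0 T)))
    (heq : ∀ t ∈ Icc 0 T, ∀ y : V, ⟪w t, ι y⟫ = ⟪w 0, ι y⟫ +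
      ∫ τ in (0 : ℝ)..t, (⟪F τ, ι y⟫ - ν * ⟪d (v τ), d y⟫))
    (h0 : w 0 ∈ closure (range ι)) (h1 : w T ∈ closure (range ι)) :
    ‖w T‖ ^ 2 - ‖w 0‖ ^ 2 = 2 * ∫ τ in (0 : ℝ)..T, (⟪F τ, w τ⟫ - ν * ‖d (v τ)‖ ^ 2) := by
  have hM0 : 0 ≤ M := (norm_nonneg _).trans (hM 0 ⟨le_rfl, hT.le⟩)
  set ℓ : ℝ → V → ℝ := fun τ y => ⟪F τ, ι y⟫ - ν * ⟪d (v τ), d y⟫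
  have hd1 : ∀ᵐ τ ∂(volume.restrict (Ioc 0 T)), ‖d (v τ)‖ ≤ 1 + κ τ := by
    filter_upwards [hd] with τ h
    nlinarith [sq_nonneg (‖d (v τ)‖ - 1)]
  have hκ1 : IntegrableOn (fun τ => 1 + κ τ) (Ioc 0 T) :=
    (integrableOn_const (by simp)).add hκ
  have hℓb : ∀ᵐ τ ∂(volume.restrict (Ioc 0 T)), ∀ y,
      |ℓ τ y| ≤ κ τ * ‖ι y‖ + |ν| * ((1 + κ τ) * ‖d y‖) := by
    filter_upwards [hF, hd1] with τ a1 a2 y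
    refine (abs_sub _ _).trans (add_le_add ?_ ?_)
    · exact (abs_real_inner_le_norm _ _).trans (mul_le_mul_of_nonneg_right a1 (norm_nonneg _))
    · rw [abs_mul]
      exact mul_le_mul_of_nonneg_left ((abs_real_inner_le_norm _ _).trans
        (mul_le_mul_of_nonneg_right a2 (norm_nonneg _))) (abs_nonneg _)
  have hℓm : ∀ y, AEStronglyMeasurable (fun τ => ℓ τ y) (volume.restrict (Ioc 0 T)) := fun y =>
    (mF _).sub ((md _).const_mul ν)
  have hℓi : ∀ y, IntegrableOn (fun τ => ℓ τ y) (Ioc 0 T) := fun y => by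
    refine Integrable.mono' (g := fun τ => κ τ * ‖ι y‖ + |ν| * ((1 + κ τ) * ‖d y‖))
      ((hκ.mul_const _).add ((hκ1.mul_const _).const_mul _)) (hℓm y) ?_
    filter_upwards [hℓb] with τ h using h y
  have hℓii : ∀ y s t, 0 ≤ s → s ≤ t → t ≤ T → IntervalIntegrable (fun τ => ℓ τ y) volume s t :=
    fun y s t hs hst ht => by
      rw [intervalIntegrable_iff_integrableOn_Ioc_of_le hst]
      exact (hℓi y).mono_set (Ioc_subset_Ioc hs ht)
  have hinc : ∀ s t, 0 ≤ s → s ≤ t → t ≤ T → ∀ y, ⟪w t - w s, ι y⟫ = ∫ τ in s..t, ℓ τ y := by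
    intro s t hs hst ht y
    rw [inner_sub_left, heq t ⟨hs.trans hst, ht⟩, heq s ⟨hs, hst.trans ht⟩,
      ← intervalIntegral.integral_interval_sub_left (hℓii y 0 t le_rfl (hs.trans hst) ht)
        (hℓii y 0 s le_rfl hs (hst.trans ht))]
    simp only [ℓ]; ring
  have hcont : ∀ y, ContinuousOn (fun t => ⟪w t, ι y⟫) (Icc 0 T) := by
    intro y
    have h2 : ContinuousOn (fun t => ⟪w 0, ι y⟫ + ∫ τ in (0 : ℝ)..t, ℓ τ y) (Icc 0 T) := by
      refine continuousOn_const.add ?_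
      have := intervalIntegral.continuousOn_primitive_interval (a := 0) (b := T)
        (f := fun τ => ℓ τ y) (μ := volume) (by
          rw [uIcc_of_le hT.le, integrableOn_Icc_iff_integrableOn_Ioc]; exact hℓi y)
      rwa [uIcc_of_le hT.le] at this
    exact h2.congr fun t ht => heq t ht y
  set εs : ℕ → ℝ := fun n => 1 / ((n : ℝ) + 1)
  have hε : ∀ n, 0 < εs n := fun n => by positivity
  have hε0 : Tendsto εs atTop (𝓝 0) := tendsto_one_div_add_atTop_nhds_zero_nat
  choose Js hJ using fun n => exists_resolvent hn (hε n)
  -- For fixed `n` the vector `Js n (w t)` is an admissible test vector, although `w t` itself need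
  -- not lie in `V` at every time.
  have hstep : ∀ n, AEStronglyMeasurable (fun τ => ℓ τ (Js n (w τ))) (volume.restrict (Ioc 0 T)) ∧
      ⟪w T, ι (Js n (w T))⟫ - ⟪w 0, ι (Js n (w 0))⟫ =
        2 * ∫ τ in (0 : ℝ)..T, ℓ τ (Js n (w τ)) := by
    intro n
    refine sub_eq_two_mul_integral_diag (q := fun t => ⟪w t, ι (Js n (w t))⟫)
      (K := fun τ t => ℓ τ (Js n (w t)))
      (κ := fun τ => κ τ * M + |ν| * ((1 + κ τ) * (‖d ∘L Js n‖ * M))) hT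
      ((hκ.mul_const _).add ((hκ1.mul_const _).const_mul _)) ?_ (fun t _ => hℓm _) ?_ ?_
    · intro s t hs hst ht
      rw [intervalIntegral.integral_add (hℓii _ s t hs hst ht) (hℓii _ s t hs hst ht),
        ← hinc s t hs hst ht, ← hinc s t hs hst ht, inner_sub_left, inner_sub_left,
        resolvent_symm (hJ n) (w t) (w s)]
      ring
    · filter_upwards [hℓb, hF, hd1] with τ hτ a1 a2 t ht
      have k0 : 0 ≤ κ τ := (norm_nonneg _).trans a1
      refine (hτ _).trans (add_le_add ?_ ?_)
      · exact mul_le_mul_of_nonneg_left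
          ((norm_resolvent_le (hε n) (hJ n) _).trans (hM t ht)) k0
      · refine mul_le_mul_of_nonneg_left (mul_le_mul_of_nonneg_left ?_ (by linarith))
          (abs_nonneg _)
        exact ((d ∘L Js n).le_opNorm (w t)).trans
          (mul_le_mul_of_nonneg_left (hM t ht) (norm_nonneg _))
    · refine Eventually.of_forall fun τ => ?_
      -- By symmetry and the resolvent relation, the functional at `Js n (w t)` equals ⟪w t, ι y⟫
      -- with `y` depending on τ and `n` but not on `t`. Continuity in `t` thus needs only the weak
      -- continuity supplied by the equation.
      refine (hcont (Js n (F τ) - (ν / εs n) • (v τ - Js n (ι (v τ))))).congr fun t ht => ?_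
      simp only [ℓ, map_sub, map_smul, inner_sub_right, real_inner_smul_right]
      rw [resolvent_symm (hJ n) (F τ), real_inner_comm (d (Js n (w t))),
        resolvent_symm (hJ n) (w t) (ι (v τ)), real_inner_comm (ι (Js n (w t))) (ι (v τ)),
        ← hJ n (w t) (v τ), add_sub_cancel_left]
      have := (hε n).ne'
      field_simp
  have hl := (((tendsto_const_nhds (x := w T)).inner (𝕜 := ℝ)
    (tendsto_resolvent hε0 hε hJ h1)).sub ((tendsto_const_nhds (x := w 0)).inner (𝕜 := ℝ)
    (tendsto_resolvent hε0 hε hJ h0)))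
  -- The dominating function is independent of `n` because, for almost every τ, `w τ = ι (v τ)` and
  -- the resolvent does not increase ‖d (v τ)‖.
  have hr := tendsto_integral_of_dominated_convergence (μ := volume.restrict (Ioc 0 T))
    (F := fun n τ => ℓ τ (Js n (w τ))) (f := fun τ => ⟪F τ, w τ⟫ - ν * ‖d (v τ)‖ ^ 2)
    (fun τ => κ τ * M + |ν| * κ τ) (fun n => (hstep n).1)
    ((hκ.mul_const _).add (hκ.const_mul _)) (fun n => by
      filter_upwards [hF, hd, hv, ae_restrict_mem measurableSet_Ioc] with τ a1 a2 a3 hτ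
      have hw := hM τ (Ioc_subset_Icc_self hτ)
      refine (abs_sub _ _).trans (add_le_add ?_ ?_)
      · exact (abs_real_inner_le_norm _ _).trans (mul_le_mul a1
          ((norm_resolvent_le (hε n) (hJ n) _).trans hw) (norm_nonneg _)
          ((norm_nonneg _).trans a1))
      · rw [abs_mul]
        refine mul_le_mul_of_nonneg_left ?_ (abs_nonneg _)
        refine (abs_real_inner_le_norm _ _).trans (le_trans ?_ a2)
        rw [← a3, sq]
        exact mul_le_mul_of_nonneg_left (resolvent_bounds (hε n) (hJ n) _).1 (norm_nonneg _))
    (by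
      filter_upwards [hv] with τ a3
      rw [← a3]
      exact ((tendsto_const_nhds (x := F τ)).inner (𝕜 := ℝ)
        (tendsto_resolvent_apply hε0 hε hJ _)).sub
        ((tendsto_resolvent_energy hn hinj hε0 hε hJ _).const_mul ν))
  simp only [← intervalIntegral.integral_of_le hT.le] at hr
  have hr2 := hr.const_mul 2
  simp only [← (hstep _).2] at hr2
  have := tendsto_nhds_unique hl hr2
  rwa [real_inner_self_eq_norm_sq, real_inner_self_eq_norm_sq] at this

end Abstract

end

/-! ### The closure of the divergence-free test fields -/

section

/-- Square-integrable planar fields. -/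
abbrev Pair : Type := WithLp 2 (L2 × L2)

/-- Square-integrable planar fields together with a derivative. -/
abbrev Quad : Type := WithLp 2 (Pair × Pair)

/-- The field with given components. -/
def pair (p q : L2) : Pair := WithLp.toLp 2 (p, q)

/-- The field and derivative with given components. -/
def gen (p q p1 q1 : L2) : Quad := WithLp.toLp 2 (pair p q, pair p1 q1)

theorem inner_pair (p q p' q' : L2) : ⟪pair p q, pair p' q'⟫ = ⟪p, p'⟫ + ⟪q, q'⟫ := by
  simp [pair, WithLp.prod_inner_apply]

theorem norm_pair_sq (p q : L2) : ‖pair p q‖ ^ 2 = ‖p‖ ^ 2 + ‖q‖ ^ 2 := by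
  rw [← real_inner_self_eq_norm_sq, inner_pair, real_inner_self_eq_norm_sq,
    real_inner_self_eq_norm_sq]

theorem inner_gen (p q p1 q1 p' q' p1' q1' : L2) :
    ⟪gen p q p1 q1, gen p' q' p1' q1'⟫ = ⟪p, p'⟫ + ⟪q, q'⟫ + ⟪p1, p1'⟫ + ⟪q1, q1'⟫ := by
  rw [gen, gen, WithLp.prod_inner_apply]
  simp only [inner_pair]
  ring

theorem gen_add (p q p1 q1 p' q' p1' q1' : L2) :
    gen p q p1 q1 + gen p' q' p1' q1' = gen (p + p') (q + q') (p1 + p1') (q1 + q1') := rfl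

/-- The field part. -/
def fieldL : Quad →L[ℝ] Pair := WithLp.fstL 2 ℝ Pair Pair

/-- The derivative part. -/
def derivL : Quad →L[ℝ] Pair := WithLp.sndL 2 ℝ Pair Pair

@[simp] theorem fieldL_gen (p q p1 q1 : L2) : fieldL (gen p q p1 q1) = pair p q := rfl

@[simp] theorem derivL_gen (p q p1 q1 : L2) : derivL (gen p q p1 q1) = pair p1 q1 := rfl

theorem inner_quad (x y : Quad) : ⟪x, y⟫ = ⟪fieldL x, fieldL y⟫ + ⟪derivL x, derivL y⟫ :=
  WithLp.prod_inner_apply x y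

/-- First component. -/
def comp0 : Pair →L[ℝ] L2 := WithLp.fstL 2 ℝ L2 L2

/-- Second component. -/
def comp1 : Pair →L[ℝ] L2 := WithLp.sndL 2 ℝ L2 L2

@[simp] theorem comp0_pair (p q : L2) : comp0 (pair p q) = p := rfl

@[simp] theorem comp1_pair (p q : L2) : comp1 (pair p q) = q := rfl

theorem pair_comp (x : Pair) : pair (comp0 x) (comp1 x) = x := rfl

theorem gen_comp (x : Quad) : gen (comp0 (fieldL x)) (comp1 (fieldL x)) (comp0 (derivL x))
    (comp1 (derivL x)) = x := rfl

section

variable {E : Type*} [NormedAddCommGroup E] [NormedSpace ℝ E]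

/-- Assemble a field from component maps. -/
def pairL (A B : E →L[ℝ] L2) : E →L[ℝ] Pair :=
  ((WithLp.prodContinuousLinearEquiv 2 ℝ L2 L2).symm : L2 × L2 →L[ℝ] Pair) ∘L A.prod B

/-- Assemble a field with derivative from component maps. -/
def genL (A B C D : E →L[ℝ] L2) : E →L[ℝ] Quad :=
  ((WithLp.prodContinuousLinearEquiv 2 ℝ Pair Pair).symm : Pair × Pair →L[ℝ] Quad) ∘L
    (pairL A B).prod (pairL C D)

end

/-- An operator acting on all components. -/
def quad (L : L2 →L[ℝ] L2) : Quad →L[ℝ] Quad :=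
  genL (L ∘L comp0 ∘L fieldL) (L ∘L comp1 ∘L fieldL) (L ∘L comp0 ∘L derivL) (L ∘L comp1 ∘L derivL)

theorem quad_gen (L : L2 →L[ℝ] L2) (p q p1 q1 : L2) :
    quad L (gen p q p1 q1) = gen (L p) (L q) (L p1) (L q1) := rfl

theorem quad_apply (L : L2 →L[ℝ] L2) (x : Quad) :
    quad L x = gen (L (comp0 (fieldL x))) (L (comp1 (fieldL x))) (L (comp0 (derivL x)))
      (L (comp1 (derivL x))) := rfl

/-- Divergence-free test fields paired with their horizontal derivative. -/
def divTests : Set Quad := {x | ∃ φ₀ φ₁ : Strip → ℝ, IsTest φ₀ ∧ IsTest φ₁ ∧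
  (∀ z, pderiv 0 φ₀ z + pderiv 1 φ₁ z = 0) ∧
  x = gen (hat φ₀) (hat φ₁) (hat (pderiv 0 φ₀)) (hat (pderiv 0 φ₁))}

/-- Closure of the divergence-free test fields. -/
def divSpace : Submodule ℝ Quad := (Submodule.span ℝ divTests).topologicalClosure

theorem isClosed_divSpace : IsClosed (divSpace : Set Quad) :=
  Submodule.isClosed_topologicalClosure _

instance : CompleteSpace divSpace := Submodule.topologicalClosure.completeSpace _

theorem divTests_subset : divTests ⊆ divSpace := fun _ hx =>
  Submodule.le_topologicalClosure _ (Submodule.subset_span hx)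

theorem divSpace_le {K : Submodule ℝ Quad} (hK : IsClosed (K : Set Quad)) (h : divTests ⊆ K) :
    divSpace ≤ K :=
  Submodule.topologicalClosure_minimal _ (Submodule.span_le.2 h) hK

theorem quad_trans_mem (c : Strip) {x : Quad} (hx : x ∈ divSpace) :
    quad (trans c) x ∈ divSpace := by
  have h : divSpace ≤ divSpace.comap (quad (trans c)).toLinearMap := by
    refine divSpace_le (isClosed_divSpace.preimage (quad (trans c)).continuous) ?_
    rintro _ ⟨φ₀, φ₁, h0, h1, hd, rfl⟩
    refine divTests_subset ⟨_, _, h0.comp_add c, h1.comp_add c, fun z => ?_, ?_⟩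
    · rw [IsTest.pderiv_comp_add, IsTest.pderiv_comp_add]; exact hd _
    · rw [IsTest.pderiv_comp_add, IsTest.pderiv_comp_add, ← trans_hat c (h0.memLp 2),
        ← trans_hat c (h1.memLp 2), ← trans_hat c ((h0.pderiv 0).memLp 2),
        ← trans_hat c ((h1.pderiv 0).memLp 2)]
      rfl
  exact h hx

theorem quad_dq_mem (i : Fin 2) (h : ℝ) {x : Quad} (hx : x ∈ divSpace) :
    quad (dq i h) x ∈ divSpace :=
  divSpace.smul_mem h⁻¹ (divSpace.sub_mem (quad_trans_mem (shift i h) hx) hx)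

/-- A weighted average is a superposition of translates, all of which stay in the space; pairing
with an orthogonal vector therefore gives zero under the integral. -/
theorem quad_wavg_mem (i : Fin 2) (m : C(ℝ, ℝ)) (h : ℝ) {x : Quad} (hx : x ∈ divSpace) :
    quad (wavg i m h) x ∈ divSpace := by
  rw [← Submodule.orthogonal_orthogonal divSpace, Submodule.mem_orthogonal]
  intro y hy
  rw [← gen_comp y, quad_apply, inner_gen]
  simp only [real_inner_comm (wavg i m h _) _, inner_wavg]
  have hi : ∀ f g : L2, IntervalIntegrable (fun s => m s * ⟪tr i s f, g⟫) volume 0 h := fun f g =>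
    (m.continuous.mul ((continuous_tr i f).inner continuous_const)).intervalIntegrable _ _
  rw [← intervalIntegral.integral_add (hi _ _) (hi _ _), ← intervalIntegral.integral_add
    ((hi _ _).add (hi _ _)) (hi _ _), ← intervalIntegral.integral_add
    (((hi _ _).add (hi _ _)).add (hi _ _)) (hi _ _)]
  refine (intervalIntegral.integral_congr (g := fun _ => (0 : ℝ)) fun s _ => ?_).trans (by simp)
  have := (Submodule.mem_orthogonal' _ _).1 hy _ (quad_trans_mem (shift i s) hx)
  rw [← gen_comp y, quad_apply, inner_gen] at this
  simp only [real_inner_comm (trans _ _) _] at this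
  simp only [← mul_add]
  exact mul_eq_zero_of_right _ this

theorem quad_avg_mem (i : Fin 2) (h : ℝ) {x : Quad} (hx : x ∈ divSpace) :
    quad (avg i h) x ∈ divSpace :=
  divSpace.smul_mem h⁻¹ (quad_wavg_mem i 1 h hx)

theorem IsTest.neg {ψ : Strip → ℝ} (h : IsTest ψ) : IsTest (fun z => -ψ z) := by
  simpa using h.const_mul (-1)

theorem hat_neg {f : Strip → ℝ} (h : MemLp f 2 volume) : hat (fun z => -f z) = -hat f := by
  rw [hat_eq h, hat_eq (show MemLp (fun z => -f z) 2 volume from h.neg)]; rfl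

theorem pderiv_neg (i : Fin 2) (f : Strip → ℝ) :
    pderiv i (fun z => -f z) = fun z => -pderiv i f z := by
  ext1 z; simp [pderiv]

/-- Averages are contractions uniformly in `h`, so they can be composed along a convergent family.
-/
theorem tendsto_avg_comp (i : Fin 2) {u : ℝ → L2} {f : L2} (hu : Tendsto u (𝓝[>] 0) (𝓝 f)) :
    Tendsto (fun h => avg i h (u h)) (𝓝[>] 0) (𝓝 f) := by
  have h1 : Tendsto (fun h => avg i h (u h - f)) (𝓝[>] 0) (𝓝 0) := by
    rw [tendsto_iff_norm_sub_tendsto_zero] at hu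
    refine squeeze_zero_norm' ?_ hu
    filter_upwards [self_mem_nhdsWithin] with h hh
    exact norm_avg_le i hh _
  have := h1.add (tendsto_avg i f)
  simpa using this

/-- Averaging over a small rectangle. -/
def avg3 (h : ℝ) : L2 →L[ℝ] L2 := avg 0 h ∘L avg 0 h ∘L avg 1 h

theorem avg3_apply (h : ℝ) (f : L2) : avg3 h f = avg 0 h (avg 0 h (avg 1 h f)) := rfl

theorem tendsto_avg3 (f : L2) : Tendsto (fun h => avg3 h f) (𝓝[>] 0) (𝓝 f) :=
  tendsto_avg_comp 0 (tendsto_avg_comp 0 (tendsto_avg 1 f))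

theorem quad_avg3 (h : ℝ) (p q p1 q1 : L2) : quad (avg3 h) (gen p q p1 q1) =
    quad (avg 0 h) (quad (avg 0 h) (quad (avg 1 h) (gen p q p1 q1))) := by
  simp only [quad_gen, avg3_apply]

/-- The averaged skew gradient, as a bounded operator. -/
def skewGrad (h : ℝ) : L2 →L[ℝ] Quad := genL
  (-(avg 0 h ∘L avg 0 h ∘L dq 1 h)) (avg 0 h ∘L avg 1 h ∘L dq 0 h)
  (-(avg 0 h ∘L dq 0 h ∘L dq 1 h)) (avg 1 h ∘L dq 0 h ∘L dq 0 h)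

theorem skewGrad_apply (h : ℝ) (f : L2) : skewGrad h f =
    gen (-(avg 0 h (avg 0 h (dq 1 h f)))) (avg 0 h (avg 1 h (dq 0 h f)))
      (-(avg 0 h (dq 0 h (dq 1 h f)))) (avg 1 h (dq 0 h (dq 0 h f))) := rfl

/-- The averages absorb every derivative into a difference quotient. One vertical average and two
horizontal ones are what the second-order terms require. -/
theorem skewGrad_eq {Ψ Ψ1 Ψ2 Ψ11 Ψ12 : L2} (h1 : LD 0 Ψ Ψ1) (h2 : LD 1 Ψ Ψ2)
    (h11 : LD 0 Ψ1 Ψ11) (h12 : LD 0 Ψ2 Ψ12) (h : ℝ) :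
    skewGrad h Ψ = quad (avg3 h) (gen (-Ψ2) Ψ1 (-Ψ12) Ψ11) := by
  have c : ∀ f, avg 1 h (avg 0 h f) = avg 0 h (avg 1 h f) := fun f =>
    (transComm_avg 1 h).avg 0 h f
  rw [quad_gen, skewGrad_apply]
  simp only [avg3_apply, map_neg]
  rw [h2.dq_eq_avg, h1.dq_eq_avg, (transComm_dq 0 h).avg 1 h, h12.dq_eq_avg,
    (transComm_dq 0 h).avg 0 h, h11.dq_eq_avg]
  simp only [c]

/-- For a test stream function this is an average of a divergence-free test field. The operator is
bounded on L², so density of test functions covers every stream function and no cut-off at infinity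
is needed. -/
theorem skewGrad_mem (h : ℝ) (f : L2) : skewGrad h f ∈ divSpace := by
  have hc : IsClosed (divSpace.comap (skewGrad h).toLinearMap : Set L2) :=
    isClosed_divSpace.preimage (skewGrad h).continuous
  have hs : Submodule.span ℝ {f : L2 | ∃ ψ, IsTest ψ ∧ f = hat ψ} ≤
      divSpace.comap (skewGrad h).toLinearMap := by
    rw [Submodule.span_le]
    rintro _ ⟨ψ, hψ, rfl⟩
    have e : skewGrad h (hat ψ) ∈ divSpace := by
      rw [skewGrad_eq (hψ.LD 0) (hψ.LD 1) ((hψ.pderiv 0).LD 0) ((hψ.pderiv 1).LD 0), quad_avg3]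
      have m : gen (-hat (pderiv 1 ψ)) (hat (pderiv 0 ψ)) (-hat (pderiv 0 (pderiv 1 ψ)))
          (hat (pderiv 0 (pderiv 0 ψ))) ∈ divSpace := by
        refine divTests_subset ⟨_, _, (hψ.pderiv 1).neg, hψ.pderiv 0, fun z => ?_, ?_⟩
        · rw [pderiv_neg, hψ.pderiv_comm 0 1]; ring
        · rw [pderiv_neg, hat_neg ((hψ.pderiv 1).memLp 2),
            hat_neg (((hψ.pderiv 1).pderiv 0).memLp 2)]
      exact quad_avg_mem 0 h (quad_avg_mem 0 h (quad_avg_mem 1 h m))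
    exact e
  exact hc.closure_subset_iff.2 hs (dense_test f)

/-- Square-integrable skew gradients are limits of divergence-free test fields. -/
theorem gen_skewGrad_mem {Ψ Ψ1 Ψ2 Ψ11 Ψ12 : L2} (h1 : LD 0 Ψ Ψ1) (h2 : LD 1 Ψ Ψ2)
    (h11 : LD 0 Ψ1 Ψ11) (h12 : LD 0 Ψ2 Ψ12) : gen (-Ψ2) Ψ1 (-Ψ12) Ψ11 ∈ divSpace := by
  have hlim : Tendsto (fun h => quad (avg3 h) (gen (-Ψ2) Ψ1 (-Ψ12) Ψ11)) (𝓝[>] 0)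
      (𝓝 (gen (-Ψ2) Ψ1 (-Ψ12) Ψ11)) := by
    have c1 : Continuous fun x : (L2 × L2) × (L2 × L2) => gen x.1.1 x.1.2 x.2.1 x.2.2 :=
      (WithLp.prod_continuous_toLp 2 Pair Pair).comp
        (((WithLp.prod_continuous_toLp 2 L2 L2).comp continuous_fst).prodMk
          ((WithLp.prod_continuous_toLp 2 L2 L2).comp continuous_snd))
    simp only [quad_gen]
    exact (c1.tendsto ((-Ψ2, Ψ1), (-Ψ12, Ψ11))).comp
      (((tendsto_avg3 _).prodMk_nhds (tendsto_avg3 _)).prodMk_nhds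
        ((tendsto_avg3 _).prodMk_nhds (tendsto_avg3 _)))
  refine isClosed_divSpace.mem_of_tendsto hlim (Eventually.of_forall fun h => ?_)
  rw [← skewGrad_eq h1 h2 h11 h12]
  exact skewGrad_mem h Ψ

theorem integrable_integral_of_eq_prod {μ : Measure Strip} {ρ : Measure ℝ} [SFinite ρ]
    (hμ : μ = (volume : Measure UnitAddCircle).prod ρ) {g : Strip → ℝ} (hg : Integrable g μ) :
    Integrable (fun y : ℝ => ∫ x : UnitAddCircle, g (x, y)) ρ := by
  subst hμ; exact hg.integral_prod_right

theorem ae_integrable_strip {g : Strip → ℝ} (hg : Integrable g volume) :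
    ∀ᵐ x : UnitAddCircle, Integrable (fun y : ℝ => g (x, y)) := Integrable.prod_right_ae hg

theorem integral_strip {g : Strip → ℝ} (hg : Integrable g volume) :
    ∫ z, g z = ∫ y : ℝ, ∫ x : UnitAddCircle, g (x, y) := integral_prod_symm g hg

theorem ae_ae_shift {i : Fin 2} {f : L2} (h : ∀ s, tr i s f = f) :
    ∀ᵐ z, ∀ᵐ s : ℝ, f (z + shift i s) = f z := by
  have hf : Measurable f := (Lp.stronglyMeasurable f).measurable
  have hm : MeasurableSet {x : ℝ × Strip | f (x.2 + shift i x.1) = f x.2} :=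
    measurableSet_eq_fun (hf.comp (measurable_snd.add
      ((continuous_shift i).measurable.comp measurable_fst))) (hf.comp measurable_snd)
  refine (Measure.ae_ae_comm (p := fun (s : ℝ) (z : Strip) => f (z + shift i s) = f z) hm).1
    (Eventually.of_forall fun s => ?_)
  have h1 := coeFn_trans (shift i s) f
  have h2 : trans (shift i s) f = f := h s
  rw [h2] at h1
  filter_upwards [h1] with z hz using hz.symm

/-- A square-integrable function invariant under vertical translation vanishes. -/
theorem eq_zero_of_tr_one_eq {f : L2} (h : ∀ s, tr 1 s f = f) : f = 0 := by
  have h1 := ae_ae_shift h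
  have h2 : ∀ᵐ x : UnitAddCircle, Integrable (fun y : ℝ => f (x, y) ^ 2) :=
    ae_integrable_strip (g := fun z => f z ^ 2) (Lp.memLp f).integrable_sq
  have h3 : ∀ᵐ z : Strip, Integrable (fun y : ℝ => f (z.1, y) ^ 2) :=
    Measure.quasiMeasurePreserving_fst.ae h2
  rw [Lp.eq_zero_iff_ae_eq_zero]
  filter_upwards [h1, h3] with z a1 a2
  have a3 : Integrable (fun s : ℝ => f (z + shift 1 s) ^ 2) := by
    have := a2.comp_add_left z.2
    simpa [shift, Prod.add_def] using this
  -- On almost every vertical line the function is constant and square integrable over an infinite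
  -- line.
  have a4 : Integrable (fun _ : ℝ => f z ^ 2) := a3.congr (by
    filter_upwards [a1] with s hs
    rw [hs])
  rw [integrable_const_iff] at a4
  rcases a4 with a5 | a5
  · simpa using a5
  · exact absurd a5 (by simp [isFiniteMeasure_iff])

/-- Horizontally invariant horizontal fields are limits of divergence-free test fields. -/
theorem shear_mem {m : L2} (h : ∀ s, tr 0 s m = m) : gen m 0 0 0 ∈ divSpace := by
  rw [← Submodule.orthogonal_orthogonal divSpace, Submodule.mem_orthogonal]
  intro y hy
  set f : L2 := comp0 (fieldL y)
  have e : ⟪y, gen m 0 0 0⟫ = ⟪f, m⟫ := by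
    conv_lhs => rw [← gen_comp y]
    rw [inner_gen]; simp [f]
  rw [e]
  -- The fields (χ(y), 0) are divergence-free tests with zero horizontal derivative. An orthogonal
  -- vector thus has a first field component of vanishing horizontal mean, and this kills the
  -- pairing with a function of `y` alone.
  have h0 : ∀ χ : ℝ → ℝ, ContDiff ℝ ∞ χ → HasCompactSupport χ → ∫ z : Strip, f z * χ z.2 = 0 := by
    intro χ h1 h2
    have ht : IsTest (fun z : Strip => χ z.2) := ⟨h1.comp contDiff_snd,
      HasCompactSupport.intro (isCompact_univ.prod h2) fun z hz =>
        image_eq_zero_of_notMem_tsupport fun hz' => hz ⟨trivial, hz'⟩⟩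
    have hz : IsTest (fun _ : Strip => (0 : ℝ)) := ⟨contDiff_const, HasCompactSupport.zero⟩
    have hp : pderiv 0 (fun z : Strip => χ z.2) = fun _ => 0 := by
      ext1 z; simp [pderiv, shift]
    have hq : ∀ i, pderiv i (fun _ : Strip => (0 : ℝ)) = fun _ => 0 := fun i => by
      ext1 z; simp [pderiv]
    have h00 : hat (fun _ => 0) = 0 := by
      rw [hat_eq (hz.memLp 2)]; rfl
    have hm : gen (hat fun z : Strip => χ z.2) 0 0 0 ∈ divSpace := by
      refine divTests_subset ⟨_, _, ht, hz, fun z => ?_, ?_⟩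
      · rw [hp, hq]; simp
      · rw [hp, hq, h00]
    have := (Submodule.mem_orthogonal' _ _).1 hy _ hm
    rw [← gen_comp y, inner_gen, inner_zero_right, inner_zero_right, inner_zero_right, add_zero,
      add_zero, add_zero, inner_hat (ht.memLp 2)] at this
    exact this
  have hFi : ∀ K : Set ℝ, IsCompact K → IntegrableOn (fun z : Strip => f z) (univ ×ˢ K) volume := by
    intro K hK
    have : IsFiniteMeasure (volume.restrict (univ ×ˢ K : Set Strip)) :=
      ⟨by simpa using (isCompact_univ.prod hK).measure_lt_top⟩
    exact ((Lp.memLp f).restrict _).integrable (by norm_num)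
  have hF : LocallyIntegrable (fun y : ℝ => ∫ x : UnitAddCircle, f (x, y)) := by
    rw [locallyIntegrable_iff]
    intro K hK
    have e : (volume : Measure Strip).restrict (univ ×ˢ K) =
        (volume : Measure UnitAddCircle).prod (volume.restrict K) := by
      rw [Measure.volume_eq_prod, ← Measure.prod_restrict, Measure.restrict_univ]
    have h1 : Integrable (fun z : Strip => f z) (volume.restrict (univ ×ˢ K)) := hFi K hK
    exact integrable_integral_of_eq_prod e h1
  have hF0 : ∀ᵐ y : ℝ, ∫ x : UnitAddCircle, f (x, y) = 0 := by
    refine ae_eq_zero_of_integral_contDiff_smul_eq_zero hF fun χ h1 h2 => ?_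
    have hi : Integrable (fun z : Strip => f z * χ z.2) := by
      have ht : IsTest (fun z : Strip => χ z.2) := ⟨h1.comp contDiff_snd,
        HasCompactSupport.intro (isCompact_univ.prod h2) fun z hz =>
          image_eq_zero_of_notMem_tsupport fun hz' => hz ⟨trivial, hz'⟩⟩
      exact (Lp.memLp f).integrable_mul (ht.memLp 2)
    have h3 := h0 χ h1 h2
    rw [integral_strip hi] at h3
    rw [← h3]
    congr 1; ext1 y
    rw [smul_eq_mul, mul_comm]
    exact (integral_mul_const (χ y) _).symm
  have hm : ∀ᵐ z : Strip, m z = ∫ x : UnitAddCircle, m (x, z.2) := by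
    filter_upwards [ae_ae_shift h] with z hz
    have h1 : ∫ s in (0 : ℝ)..(0 + 1), m (z + shift 0 s) = m z := by
      rw [intervalIntegral.integral_congr_ae (g := fun _ => m z)
        (by filter_upwards [hz] with s hs _ using hs)]
      simp
    have h2 := UnitAddCircle.intervalIntegral_preimage 0 (fun x => m (z + (x, 0)))
    simp only [shift, if_true] at h1
    rw [← h1, h2]
    have h3 := integral_add_left_eq_self (μ := (volume : Measure UnitAddCircle))
      (fun x => m (x, z.2)) z.1
    rw [← h3]
    simp [Prod.add_def]
  have hi := (Lp.memLp f).integrable_mul (Lp.memLp m)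
  have hi2 : Integrable (fun z : Strip => f z * ∫ x : UnitAddCircle, m (x, z.2)) := hi.congr (by
    filter_upwards [hm] with z hz
    simp only [Pi.mul_apply]; rw [← hz])
  rw [inner_eq_integral, integral_congr_ae
    (g := fun z : Strip => f z * ∫ x : UnitAddCircle, m (x, z.2))
    (by filter_upwards [hm] with z hz; rw [← hz])]
  rw [integral_strip hi2]
  refine integral_eq_zero_of_ae ?_
  filter_upwards [hF0] with y hy
  simp only [integral_mul_const, hy, zero_mul, Pi.zero_apply]

/-- The weight `s ↦ s - 1/2`. -/
def subHalf : C(ℝ, ℝ) := ⟨fun s => s - 1 / 2, by fun_prop⟩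

/-- Integrate by parts against s - 1/2: the two boundary values, each with weight one half, agree by
periodicity. -/
theorem LD.wavg_subHalf {p p1 : L2} (h : LD 0 p p1) : wavg 0 subHalf 1 p1 = p - avg 0 1 p := by
  have hd : ∀ s ∈ uIcc (0 : ℝ) 1, HasDerivAt (fun s => (s - 1 / 2 : ℝ) • tr 0 s p)
      ((s - 1 / 2 : ℝ) • tr 0 s p1 + (1 : ℝ) • tr 0 s p) s := fun s _ =>
    HasDerivAt.fun_smul (by simpa using (hasDerivAt_id s).sub_const (1 / 2)) (h.hasDerivAt s)
  have h1 : IntervalIntegrable (fun s => (s - 1 / 2 : ℝ) • tr 0 s p1) volume 0 1 :=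
    intervalIntegrable_smul_tr 0 subHalf 0 1 p1
  have h2 : IntervalIntegrable (fun s => (1 : ℝ) • tr 0 s p) volume 0 1 :=
    Continuous.intervalIntegrable (by have := continuous_tr 0 p; fun_prop) _ _
  have := intervalIntegral.integral_eq_sub_of_hasDerivAt hd (h1.add h2)
  rw [intervalIntegral.integral_add h1 h2] at this
  simp only [tr_zero, tr_zero_one, one_smul] at this
  rw [avg_apply, inv_one, one_smul, wavg_apply]
  simp only [subHalf, ContinuousMap.coe_mk]
  rw [eq_sub_iff_add_eq, this, ← sub_smul]
  norm_num

/-- The horizontal primitive of a function with zero horizontal mean. -/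
theorem LD_wavg_subHalf {q : L2} (hq : avg 0 1 q = 0) : LD 0 (wavg 0 subHalf 1 q) q := by
  have hc := continuous_tr 0 q
  have hi : ∀ a b, IntervalIntegrable (fun r => r • tr 0 r q) volume a b := fun a b =>
    Continuous.intervalIntegrable (by fun_prop) a b
  have hz : ∫ s in (0 : ℝ)..1, tr 0 s q = 0 := by
    rw [avg_apply, inv_one, one_smul] at hq; exact hq
  -- The zero mean removes the constant part of the weight, leaving a primitive of `r • tr 0 r q`
  -- between `s` and `s + 1`. Its derivative at zero is `q` by periodicity.
  have key : ∀ s, tr 0 s (wavg 0 subHalf 1 q) =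
      (∫ r in (0 : ℝ)..(s + 1), r • tr 0 r q) - ∫ r in (0 : ℝ)..s, r • tr 0 r q := by
    intro s
    rw [intervalIntegral.integral_interval_sub_left (hi _ _) (hi _ _), wavg_apply,
      ← (tr 0 s).intervalIntegral_comp_comm (intervalIntegrable_smul_tr 0 subHalf 0 1 q)]
    have e : ∀ r, tr 0 s (subHalf r • tr 0 r q) =
        (s + r) • tr 0 (s + r) q - (s + 1 / 2) • tr 0 s (tr 0 r q) := by
      intro r
      rw [map_smul, tr_add, ← sub_smul]
      simp only [subHalf, ContinuousMap.coe_mk]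
      congr 1; ring
    simp only [e]
    rw [intervalIntegral.integral_sub
      (Continuous.intervalIntegrable (by fun_prop) _ _)
      (Continuous.intervalIntegrable (by fun_prop) _ _),
      intervalIntegral.integral_smul,
      (tr 0 s).intervalIntegral_comp_comm (hc.intervalIntegrable _ _), hz, map_zero, smul_zero,
      sub_zero, intervalIntegral.integral_comp_add_left (fun r => r • tr 0 r q)]
    simp
  have hd : ∀ s, HasDerivAt (fun s => ∫ r in (0 : ℝ)..s, r • tr 0 r q) (s • tr 0 s q) s := fun s =>
    have hcc : Continuous fun r => r • tr 0 r q := by fun_prop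
    intervalIntegral.integral_hasDerivAt_right (hi _ _)
      hcc.aestronglyMeasurable.stronglyMeasurableAtFilter hcc.continuousAt
  unfold LD
  simp only [key]
  have h1 := (HasDerivAt.comp_add_const (0 : ℝ) 1 (by simpa using hd 1)).fun_sub (hd 0)
  simpa [tr_zero_one] using h1

/-- The vertical component of a divergence-free field has zero horizontal mean. -/
theorem avg_eq_zero_of_div {p p1 q : L2} (h0 : LD 0 p p1) (h1 : LD 1 q (-p1)) :
    avg 0 1 q = 0 := by
  have z : avg 0 1 p1 = 0 := by
    rw [← h0.dq_eq_avg, dq_apply, tr_zero_one, sub_self, smul_zero]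
  -- The horizontal mean of `q` has zero vertical derivative, so it is vertically invariant; square
  -- integrability forces it to vanish.
  have h2 := h1.map (transComm_avg 0 1)
  rw [map_neg, z, neg_zero] at h2
  refine eq_zero_of_tr_one_eq fun s => ?_
  have := h2.sub_eq_integral 0 s
  simpa [sub_eq_zero] using this

/-- Since `q` has zero horizontal mean, it has a horizontal primitive, which serves as stream
function: its skew gradient is the field minus the horizontal mean of `p`. That mean is a shear
flow, approximated separately. -/
theorem gen_mem_divSpace {p p1 q q1 : L2} (hp : LD 0 p p1) (hq : LD 0 q q1) (h1 : LD 1 q (-p1)) :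
    gen p q p1 q1 ∈ divSpace := by
  have hz := avg_eq_zero_of_div hp h1
  have z : avg 0 1 p1 = 0 := by
    rw [← hp.dq_eq_avg, dq_apply, tr_zero_one, sub_self, smul_zero]
  have a1 := LD_wavg_subHalf hz
  have a2 := h1.map (transComm_wavg 0 subHalf 1)
  rw [map_neg, hp.wavg_subHalf] at a2
  have a3 : LD 0 (-(p - avg 0 1 p)) (-p1) := by
    have := (hp.sub (hp.map (transComm_avg 0 1))).neg
    rwa [z, sub_zero] at this
  have m1 := gen_skewGrad_mem a1 a2 hq a3
  have m2 := shear_mem (m := avg 0 1 p) fun s => tr_avg_zero_one s p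
  have := divSpace.add_mem m1 m2
  rw [gen_add] at this
  simpa using this

theorem LD_of_mem_divSpace {x : Quad} (hx : x ∈ divSpace) :
    LD 0 (comp0 (fieldL x)) (comp0 (derivL x)) ∧ LD 0 (comp1 (fieldL x)) (comp1 (derivL x)) := by
  let K : Submodule ℝ Quad :=
    { carrier := {x | LD 0 (comp0 (fieldL x)) (comp0 (derivL x)) ∧
        LD 0 (comp1 (fieldL x)) (comp1 (derivL x))}
      add_mem' := fun {a b} ha hb => by
        refine ⟨?_, ?_⟩ <;> simp only [map_add]
        exacts [ha.1.add hb.1, ha.2.add hb.2]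
      zero_mem' := by
        have : LD 0 (0 : L2) 0 := by
          simpa [LD] using hasDerivAt_const (0 : ℝ) (0 : L2)
        exact ⟨by simpa using this, by simpa using this⟩
      smul_mem' := fun c a ha => by
        refine ⟨?_, ?_⟩ <;> simp only [map_smul]
        exacts [ha.1.smul c, ha.2.smul c] }
  have hK : IsClosed (K : Set Quad) := by
    have c0 : Continuous fun x : Quad => (comp0 (fieldL x), comp0 (derivL x)) := by fun_prop
    have c1 : Continuous fun x : Quad => (comp1 (fieldL x), comp1 (derivL x)) := by fun_prop
    exact ((isClosed_LD 0).preimage c0).inter ((isClosed_LD 0).preimage c1)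
  refine divSpace_le (K := K) hK ?_ hx
  rintro _ ⟨φ₀, φ₁, h0, h1, -, rfl⟩
  exact ⟨h0.LD 0, h1.LD 0⟩

/-- The field part on the closure of the divergence-free test fields. -/
def divField : divSpace →L[ℝ] Pair := fieldL ∘L divSpace.subtypeL

/-- The derivative part on the closure of the divergence-free test fields. -/
def divDeriv : divSpace →L[ℝ] Pair := derivL ∘L divSpace.subtypeL

theorem inner_divSpace (x y : divSpace) :
    ⟪x, y⟫ = ⟪divField x, divField y⟫ + ⟪divDeriv x, divDeriv y⟫ := inner_quad _ _

/-- The second half of an element is the strong horizontal derivative of the first half, by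
closedness of the derivative, so the field determines it. -/
theorem injective_divField : Function.Injective divField := by
  rw [injective_iff_map_eq_zero]
  rintro ⟨x, hx⟩ h0
  obtain ⟨a, b⟩ := LD_of_mem_divSpace hx
  have h0' : fieldL x = 0 := h0
  have hz : LD 0 (0 : L2) 0 := by
    simpa [LD] using hasDerivAt_const (0 : ℝ) (0 : L2)
  rw [h0', map_zero] at a b
  have e : x = 0 := by
    rw [← gen_comp x, h0', a.unique hz, b.unique hz]; rfl
  exact Subtype.ext e

/-- No horizontal derivative of `q` is assumed; horizontal averaging creates one and preserves the
divergence condition. This serves times at which only the field and its vertical derivative are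
known to be in L². -/
theorem mem_closure_range_divField {p q q2 : L2} (hq : LD 1 q q2) (hp : LD 0 p (-q2)) :
    pair p q ∈ closure (range divField) := by
  have ht : Tendsto (fun h => pair (avg 0 h p) (avg 0 h q)) (𝓝[>] 0) (𝓝 (pair p q)) :=
    ((WithLp.prod_continuous_toLp 2 L2 L2).tendsto (p, q)).comp
      ((tendsto_avg 0 p).prodMk_nhds (tendsto_avg 0 q))
  refine mem_closure_of_tendsto ht (Eventually.of_forall fun h => ?_)
  have h1 : LD 1 (avg 0 h q) (-(dq 0 h p)) := by
    have := hq.map (transComm_avg 0 h)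
    rwa [hp.dq_eq_avg, map_neg, neg_neg]
  exact ⟨⟨_, gen_mem_divSpace (LD_avg 0 h p) (LD_avg 0 h q) h1⟩, rfl⟩

end

/-! ### Convection terms and vertical commutators -/

section

/-- A divergence-free field with its weak derivatives. -/
structure VGood (v v1 v2 v12 : Fin 2 → L2) : Prop where
  good : ∀ j, Good (v j) (v1 j) (v2 j) (v12 j)
  div : v1 0 + v2 1 = 0

/-- Components of `(v · ∇) w`. -/
def conv (v w1 w2 : Fin 2 → L2) (j : Fin 2) : L2 := bmul (v 0) (w1 j) + bmul (v 1) (w2 j)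

variable {v v1 v2 v12 w w1 w2 w12 z z1 z2 z12 : Fin 2 → L2}

theorem conv_antisymm (hv : VGood v v1 v2 v12) (hw : VGood w w1 w2 w12) (hz : VGood z z1 z2 z12)
    (j : Fin 2) : ⟪conv v w1 w2 j, z j⟫ + ⟪conv v z1 z2 j, w j⟫ = 0 :=
  convect_antisymm (hv.good 0) (hv.good 1) hv.div (hw.good j) (hz.good j)

/-- Discrete Leibniz rule. The translate sits on the transporting factor, so the leading term is
again convection by a divergence-free field. -/
theorem dq_bmul {a : L2} {M : ℝ} (ha : Bd a M) (i : Fin 2) (h : ℝ) (g : L2) :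
    dq i h (bmul a g) = bmul (tr i h a) (dq i h g) + bmul (dq i h a) g := by
  have hT : Bd (tr i h a) M := ha.trans _
  have e : tr i h (bmul a g) = bmul (tr i h a) (tr i h g) := ha.trans_bmul _ g
  rw [dq_apply, dq_apply, dq_apply, hT.bmul_smul, hT.bmul_sub, e, bmul_comm (h⁻¹ • _) g]
  have hx : bmul g (h⁻¹ • (tr i h a - a)) = h⁻¹ • bmul (tr i h a - a) g := by
    rw [← bmul_comm, bmul, bmul]
    have hab : Bd (tr i h a - a) (M + M) := by
      filter_upwards [hT, ha, Lp.coeFn_sub (tr i h a) a] with z h1 h2 h3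
      rw [h3, Pi.sub_apply]
      exact (abs_sub _ _).trans (add_le_add h1 h2)
    apply Lp.ext
    have hm := (hab.memLp g)
    have hm2 : MemLp (fun z => (h⁻¹ • (tr i h a - a) : L2) z * g z) 2 volume := by
      refine (memLp_congr_ae ?_).1 (hm.const_mul h⁻¹)
      filter_upwards [Lp.coeFn_smul h⁻¹ (tr i h a - a)] with z hz
      rw [hz]; simp [mul_assoc]
    filter_upwards [coeFn_hat hm, coeFn_hat hm2, Lp.coeFn_smul h⁻¹ (tr i h a - a),
      Lp.coeFn_smul h⁻¹ (hat fun z => (tr i h a - a : L2) z * g z)] with z h1 h2 h3 h4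
    rw [h4, Pi.smul_apply, h1, h2, h3, Pi.smul_apply]; simp [mul_assoc]
  rw [hx, hT.sub_bmul ha]
  simp only [smul_sub]; abel

theorem dq_conv (hv : VGood v v1 v2 v12) (w1 w2 : Fin 2 → L2) (i : Fin 2) (h : ℝ) (j : Fin 2) :
    dq i h (conv v w1 w2 j) =
      (bmul (tr i h (v 0)) (dq i h (w1 j)) + bmul (tr i h (v 1)) (dq i h (w2 j))) +
      (bmul (dq i h (v 0)) (w1 j) + bmul (dq i h (v 1)) (w2 j)) := by
  rw [conv, map_add, dq_bmul (hv.good 0).bd, dq_bmul (hv.good 1).bd]; abel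

/-- The first product contains `w1`. In the second, incompressibility replaces the vertical quotient
of `v 1` by minus an average of `v1 0`. Both are then trilinear terms with a horizontal derivative,
each bounded by 8 R² S. -/
theorem abs_inner_dq_commutator_le (hv : VGood v v1 v2 v12) (hw : VGood w w1 w2 w12)
    (hz : VGood z z1 z2 z12) {R S h : ℝ} (hh : 0 < h) (j : Fin 2)
    (hvS : ‖v2 0‖ ≤ S) (hwS : ‖w2 j‖ ≤ S) (hzS : ‖z2 j‖ ≤ S)
    (hv1 : ‖v1 0‖ ≤ R) (hv12 : ‖v12 0‖ ≤ R) (hw1 : ‖w1 j‖ ≤ R) (hw12 : ‖w12 j‖ ≤ R)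
    (hz12 : ‖z12 j‖ ≤ R) :
    |⟪bmul (dq 1 h (v 0)) (w1 j) + bmul (dq 1 h (v 1)) (w2 j), dq 1 h (z j)⟫|
      ≤ 16 * (R ^ 2 * S) := by
  have hR : 0 ≤ R := (norm_nonneg _).trans hw1
  have hS : 0 ≤ S := (norm_nonneg _).trans hwS
  have hk := (hz.good j).map (transComm_dq 1 h)
  have hv0 := (hv.good 0).map (transComm_dq 1 h)
  have hv1' := (hv.good 1).map (transComm_dq 1 h)
  have ha := (hv.good 0).map (transComm_avg 1 h)
  have n1 : ‖dq 1 h (z j)‖ ≤ S := ((hz.good j).d2.norm_dq_le hh).trans hzS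
  have n2 : ‖dq 1 h (z1 j)‖ ≤ R := ((hz.good j).d21.norm_dq_le hh).trans hz12
  have n3 : ‖dq 1 h (v 0)‖ ≤ S := ((hv.good 0).d2.norm_dq_le hh).trans hvS
  have n4 : ‖dq 1 h (v1 0)‖ ≤ R := ((hv.good 0).d21.norm_dq_le hh).trans hv12
  have n5 : ‖avg 1 h (v1 0)‖ ≤ R := (norm_avg_le 1 hh _).trans hv1
  have n6 : ‖avg 1 h (v12 0)‖ ≤ R := (norm_avg_le 1 hh _).trans hv12
  have e1 : ⟪bmul (dq 1 h (v 0)) (w1 j), dq 1 h (z j)⟫ =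
      ⟪w1 j, bmul (dq 1 h (z j)) (dq 1 h (v 0))⟫ := by
    rw [real_inner_comm, hv0.bd.inner_bmul, hk.bd.inner_bmul]
    congr 1; ext1 x; ring
  have e2 : ⟪bmul (dq 1 h (v 1)) (w2 j), dq 1 h (z j)⟫ =
      -⟪avg 1 h (v1 0), bmul (dq 1 h (z j)) (w2 j)⟫ := by
    have e : -avg 1 h (v1 0) = dq 1 h (v 1) := by
      rw [(hv.good 1).d2.dq_eq_avg, ← map_neg, neg_eq_of_add_eq_zero_right hv.div]
    rw [real_inner_comm, ← inner_neg_left, e, hv1'.bd.inner_bmul, hk.bd.inner_bmul]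
    congr 1; ext1 x; ring
  have b1 := (hw.good j).abs_inner_bmul_le hk hv0.d1
  have b2 := ha.abs_inner_bmul_le hk (hw.good j).d12
  have c1 : 2 * (‖w1 j‖ + ‖w12 j‖) * (‖dq 1 h (v1 0)‖ * ‖dq 1 h (z j)‖
      + ‖dq 1 h (z1 j)‖ * ‖dq 1 h (v 0)‖) ≤ 2 * (R + R) * (R * S + R * S) := by gcongr
  have c2 : 2 * (‖avg 1 h (v1 0)‖ + ‖avg 1 h (v12 0)‖) * (‖w12 j‖ * ‖dq 1 h (z j)‖
      + ‖dq 1 h (z1 j)‖ * ‖w2 j‖) ≤ 2 * (R + R) * (R * S + R * S) := by gcongr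
  rw [inner_add_left, e1, e2]
  have := abs_add_le ⟪w1 j, bmul (dq 1 h (z j)) (dq 1 h (v 0))⟫
    (-⟪avg 1 h (v1 0), bmul (dq 1 h (z j)) (w2 j)⟫)
  rw [abs_neg] at this
  nlinarith

/-- All derivatives of a field bounded in `L²`. -/
structure NormBd (v1 v2 v12 : Fin 2 → L2) (R S : ℝ) : Prop where
  d1 : ∀ j, ‖v1 j‖ ≤ R
  d2 : ∀ j, ‖v2 j‖ ≤ S
  d12 : ∀ j, ‖v12 j‖ ≤ R

/-- The leading terms of the two Leibniz expansions cancel by antisymmetry, leaving two commutators.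
-/
theorem abs_inner_dq_conv_le (hv : VGood v v1 v2 v12) (hw : VGood w w1 w2 w12)
    (hz : VGood z z1 z2 z12) {R S h : ℝ} (hh : 0 < h) (bv : NormBd v1 v2 v12 R S)
    (bw : NormBd w1 w2 w12 R S) (bz : NormBd z1 z2 z12 R S) (j : Fin 2) :
    |⟪dq 1 h (conv v w1 w2 j), dq 1 h (z j)⟫ + ⟪dq 1 h (conv v z1 z2 j), dq 1 h (w j)⟫|
      ≤ 32 * (R ^ 2 * S) := by
  have hdiv : tr 1 h (v1 0) + tr 1 h (v2 1) = 0 := by rw [← map_add, hv.div, map_zero]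
  have e := convect_antisymm ((hv.good 0).map (transComm_tr 1 h))
    ((hv.good 1).map (transComm_tr 1 h)) hdiv ((hw.good j).map (transComm_dq 1 h))
    ((hz.good j).map (transComm_dq 1 h))
  have b1 := abs_inner_dq_commutator_le hv hw hz hh j (bv.d2 0) (bw.d2 j) (bz.d2 j) (bv.d1 0)
    (bv.d12 0) (bw.d1 j) (bw.d12 j) (bz.d12 j)
  have b2 := abs_inner_dq_commutator_le hv hz hw hh j (bv.d2 0) (bz.d2 j) (bw.d2 j) (bv.d1 0)
    (bv.d12 0) (bz.d1 j) (bz.d12 j) (bw.d12 j)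
  rw [dq_conv hv, dq_conv hv, inner_add_left, inner_add_left _ _ (dq 1 h (w j))]
  rw [abs_le] at *
  constructor <;> linarith [b1.1, b1.2, b2.1, b2.2]

variable {u u1 u2 u12 b b1 b2 b12 : Fin 2 → L2}

/-- The magnetic stretching terms cancel between the two equations; the two self-transport terms
vanish individually. -/
theorem inner_force_add (hu : VGood u u1 u2 u12) (hb : VGood b b1 b2 b12) (j : Fin 2) :
    ⟪conv b b1 b2 j - conv u u1 u2 j, u j⟫ + ⟪conv b u1 u2 j - conv u b1 b2 j, b j⟫ = 0 := by
  have h1 := conv_antisymm hb hb hu j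
  have h2 := conv_antisymm hu hu hu j
  have h3 := conv_antisymm hu hb hb j
  rw [inner_sub_left, inner_sub_left]
  linarith

theorem abs_inner_dq_force_add_le (hu : VGood u u1 u2 u12) (hb : VGood b b1 b2 b12) {R S h : ℝ}
    (hh : 0 < h) (bu : NormBd u1 u2 u12 R S) (bb : NormBd b1 b2 b12 R S) (j : Fin 2) :
    |⟪dq 1 h (conv b b1 b2 j - conv u u1 u2 j), dq 1 h (u j)⟫ +
      ⟪dq 1 h (conv b u1 u2 j - conv u b1 b2 j), dq 1 h (b j)⟫| ≤ 64 * (R ^ 2 * S) := by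
  have h1 := abs_inner_dq_conv_le hb hb hu hh bb bb bu j
  have h2 := abs_inner_dq_conv_le hu hu hu hh bu bu bu j
  have h3 := abs_inner_dq_conv_le hu hb hb hh bu bb bb j
  rw [map_sub, map_sub, inner_sub_left, inner_sub_left]
  rw [abs_le] at *
  constructor <;> linarith [h1.1, h1.2, h2.1, h2.2, h3.1, h3.2]

/-- Sum of the squared norms of a field and its derivatives. -/
def sq4 (v v1 v2 v12 : Fin 2 → L2) : ℝ :=
  ∑ j, (‖v j‖ ^ 2 + ‖v1 j‖ ^ 2 + ‖v2 j‖ ^ 2 + ‖v12 j‖ ^ 2)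

/-- One factor is bounded by the embedding and the other is in L²; Young's inequality leaves a sum
of squares. Along a solution this is integrable in time, as required of the forcing in the energy
equality. -/
theorem norm_conv_le (hv : VGood v v1 v2 v12) (w w12 : Fin 2 → L2) (j : Fin 2) :
    ‖conv v w1 w2 j‖ ≤ 2 * (sq4 v v1 v2 v12 + sq4 w w1 w2 w12) := by
  have h0 := (hv.good 0).bd.norm_le (w1 j)
  have h1 := (hv.good 1).bd.norm_le (w2 j)
  have h2 := norm_add_le (bmul (v 0) (w1 j)) (bmul (v 1) (w2 j))
  have hw : ‖w1 j‖ ^ 2 + ‖w2 j‖ ^ 2 ≤ sq4 w w1 w2 w12 := by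
    refine le_trans ?_ (Finset.single_le_sum (fun k _ => by positivity) (Finset.mem_univ j))
    nlinarith [sq_nonneg ‖w j‖, sq_nonneg ‖w12 j‖]
  simp only [sq4, Fin.sum_univ_two] at hw ⊢
  rw [conv]
  have key : ∀ a b c d e : ℝ, (a + b + c + d) * e ≤ a ^ 2 + b ^ 2 + c ^ 2 + d ^ 2 + e ^ 2 := by
    intro a b c d e
    nlinarith [sq_nonneg (2 * a - e), sq_nonneg (2 * b - e), sq_nonneg (2 * c - e),
      sq_nonneg (2 * d - e)]
  have k0 := key ‖v 0‖ ‖v1 0‖ ‖v2 0‖ ‖v12 0‖ ‖w1 j‖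
  have k1 := key ‖v 1‖ ‖v1 1‖ ‖v2 1‖ ‖v12 1‖ ‖w2 j‖
  nlinarith [sq_nonneg ‖v 0‖, sq_nonneg ‖v1 0‖, sq_nonneg ‖v2 0‖, sq_nonneg ‖v12 0‖,
    sq_nonneg ‖v 1‖, sq_nonneg ‖v1 1‖, sq_nonneg ‖v2 1‖, sq_nonneg ‖v12 1‖, sq_nonneg ‖w1 j‖,
    sq_nonneg ‖w2 j‖]

end

/-! ### Energy equality for weak solutions after a translation-invariant operator -/

/-- The field with components `v 0`, `v 1`. -/
def pr (v : Fin 2 → L2) : Pair := pair (v 0) (v 1)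

theorem continuous_pair : Continuous fun x : L2 × L2 => pair x.1 x.2 :=
  WithLp.prod_continuous_toLp 2 L2 L2

theorem inner_pr (v w : Fin 2 → L2) : ⟪pr v, pr w⟫ = ∑ j, ⟪v j, w j⟫ := by
  rw [pr, pr, inner_pair, Fin.sum_univ_two]

theorem norm_pr_sq (v : Fin 2 → L2) : ‖pr v‖ ^ 2 = ∑ j, ‖v j‖ ^ 2 := by
  rw [pr, norm_pair_sq, Fin.sum_univ_two]

theorem norm_pr_le {v : Fin 2 → L2} {c : ℝ} (h : ∀ j, ‖v j‖ ≤ c) : ‖pr v‖ ≤ 2 * c := by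
  have hc : 0 ≤ c := (norm_nonneg _).trans (h 0)
  refine abs_le_of_sq_le_sq' ?_ (by positivity) |>.2
  rw [norm_pr_sq, Fin.sum_univ_two]
  have h0 := pow_le_pow_left₀ (norm_nonneg _) (h 0) 2
  have h1 := pow_le_pow_left₀ (norm_nonneg _) (h 1) 2
  nlinarith

theorem aestronglyMeasurable_pr {μ : Measure ℝ} {f : ℝ → Fin 2 → L2}
    (h : ∀ j, AEStronglyMeasurable (fun τ => f τ j) μ) :
    AEStronglyMeasurable (fun τ => pr (f τ)) μ :=
  continuous_pair.comp_aestronglyMeasurable ((h 0).prodMk (h 1))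

/-- With Bochner integrals pulled out, the identity says that one fixed vector is orthogonal to the
test field, a condition that passes to the closed span. -/
theorem forall_divSpace_of_forall_divTests {t ν : ℝ} {G W1 : ℝ → Pair} {a : Pair}
    (ht : 0 ≤ t) (hG : IntegrableOn G (Ioc 0 t)) (hW : IntegrableOn W1 (Ioc 0 t))
    (h : ∀ y ∈ divTests, ⟪a, fieldL y⟫ =
      ∫ τ in (0 : ℝ)..t, (⟪G τ, fieldL y⟫ - ν * ⟪W1 τ, derivL y⟫))
    {y : Quad} (hy : y ∈ divSpace) : ⟪a, fieldL y⟫ =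
      ∫ τ in (0 : ℝ)..t, (⟪G τ, fieldL y⟫ - ν * ⟪W1 τ, derivL y⟫) := by
  have key : ∀ y : Quad, ∫ τ in (0 : ℝ)..t, (⟪G τ, fieldL y⟫ - ν * ⟪W1 τ, derivL y⟫) =
      ⟪∫ τ in Ioc 0 t, G τ, fieldL y⟫ - ν * ⟪∫ τ in Ioc 0 t, W1 τ, derivL y⟫ := by
    intro y
    rw [intervalIntegral.integral_of_le ht, integral_sub (hG.inner_const _)
      ((hW.inner_const _).const_mul _), integral_const_mul]
    simp only [real_inner_comm (fieldL y), real_inner_comm (derivL y)]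
    rw [integral_inner hG, integral_inner hW]
  simp only [key] at h ⊢
  set A := ∫ τ in Ioc 0 t, G τ
  set B := ∫ τ in Ioc 0 t, W1 τ
  let z : Quad := WithLp.toLp 2 (a - A, ν • B)
  have hz : ∀ y : Quad, ⟪z, y⟫ = ⟪a, fieldL y⟫ - (⟪A, fieldL y⟫ - ν * ⟪B, derivL y⟫) := by
    intro y
    have e1 : fieldL z = a - A := rfl
    have e2 : derivL z = ν • B := rfl
    rw [inner_quad, e1, e2, inner_sub_left, real_inner_smul_left]; ring
  have hle : divSpace ≤ (Submodule.span ℝ {z})ᗮ := by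
    refine divSpace_le (Submodule.isClosed_orthogonal _) fun y hy => ?_
    rw [SetLike.mem_coe, Submodule.mem_orthogonal_singleton_iff_inner_right, hz, h y hy, sub_self]
  have := hz y
  rw [Submodule.mem_orthogonal_singleton_iff_inner_right.1 (hle hy)] at this
  linarith

/-- The energy equality on the closure of the divergence-free test fields. -/
theorem energy_equality_divSpace {T M ν : ℝ} (hT : 0 < T) {w F : ℝ → Pair} {v : ℝ → divSpace} {κ : ℝ → ℝ}
    (hM : ∀ t ∈ Icc 0 T, ‖w t‖ ≤ M)
    (hv : ∀ᵐ τ ∂(volume.restrict (Ioc 0 T)), divField (v τ) = w τ)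
    (hκ : IntegrableOn κ (Ioc 0 T))
    (hF : ∀ᵐ τ ∂(volume.restrict (Ioc 0 T)), ‖F τ‖ ≤ κ τ)
    (hd : ∀ᵐ τ ∂(volume.restrict (Ioc 0 T)), ‖divDeriv (v τ)‖ ^ 2 ≤ κ τ)
    (mF : ∀ φ, AEStronglyMeasurable (fun τ => ⟪F τ, φ⟫) (volume.restrict (Ioc 0 T)))
    (md : ∀ φ, AEStronglyMeasurable (fun τ => ⟪divDeriv (v τ), φ⟫) (volume.restrict (Ioc 0 T)))
    (heq : ∀ t ∈ Icc 0 T, ∀ y : divSpace, ⟪w t, divField y⟫ = ⟪w 0, divField y⟫ +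
      ∫ τ in (0 : ℝ)..t, (⟪F τ, divField y⟫ - ν * ⟪divDeriv (v τ), divDeriv y⟫))
    (h0 : w 0 ∈ closure (range divField)) (h1 : w T ∈ closure (range divField)) :
    ‖w T‖ ^ 2 - ‖w 0‖ ^ 2 = 2 * ∫ τ in (0 : ℝ)..T, (⟪F τ, w τ⟫ - ν * ‖divDeriv (v τ)‖ ^ 2) :=
  energy_equality inner_divSpace injective_divField hT hM hv hκ hF hd mF md heq h0 h1

/-- The field with components `R (v 0)`, `R (v 1)`. -/
def prMap (R : L2 →L[ℝ] L2) (v : Fin 2 → L2) : Pair := pr fun j => R (v j)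

/-- Energy equality for a transformed weak solution. -/
theorem energy_transformed {t ν M : ℝ} (ht : 0 < t) {W W1 G : ℝ → Fin 2 → L2} {κ : ℝ → ℝ}
    (hM : ∀ τ ∈ Icc 0 t, ∀ j, ‖W τ j‖ ≤ M)
    (hdiv : ∀ τ ∈ Icc 0 t, ∃ q, LD 1 (W τ 1) q ∧ LD 0 (W τ 0) (-q))
    (hd : ∀ᵐ τ ∂(volume.restrict (Ioc 0 t)), ∀ j, LD 0 (W τ j) (W1 τ j))
    (mW1 : ∀ j, AEStronglyMeasurable (fun τ => W1 τ j) (volume.restrict (Ioc 0 t)))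
    (mG : ∀ j, AEStronglyMeasurable (fun τ => G τ j) (volume.restrict (Ioc 0 t)))
    (hκ : IntegrableOn κ (Ioc 0 t))
    (hG : ∀ᵐ τ ∂(volume.restrict (Ioc 0 t)), ∀ j, ‖G τ j‖ ≤ κ τ)
    (hW1 : ∀ᵐ τ ∂(volume.restrict (Ioc 0 t)), ∀ j, ‖W1 τ j‖ ^ 2 ≤ κ τ)
    (heq : ∀ s ∈ Icc 0 t, ∀ x ∈ divTests, ⟪pr (W s), fieldL x⟫ = ⟪pr (W 0), fieldL x⟫ +
      ∫ τ in (0 : ℝ)..s, (⟪pr (G τ), fieldL x⟫ - ν * ⟪pr (W1 τ), derivL x⟫))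
    {R R' : L2 →L[ℝ] L2} (hR : TransComm R) (hRR' : ∀ f g, ⟪R f, g⟫ = ⟪f, R' g⟫)
    (hR' : ∀ x ∈ divSpace, quad R' x ∈ divSpace) :
    (∑ j, ‖R (W t j)‖ ^ 2) - ∑ j, ‖R (W 0 j)‖ ^ 2 =
      2 * ∫ τ in (0 : ℝ)..t, ((∑ j, ⟪R (G τ j), R (W τ j)⟫) - ν * ∑ j, ‖R (W1 τ j)‖ ^ 2) := by
  classical
  set μ := volume.restrict (Ioc 0 t)
  -- The operator is moved onto the test field through its adjoint, so the untransformed weak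
  -- equation can be used.
  have hPR : ∀ v (y : Quad), ⟪prMap R v, fieldL y⟫ = ⟪pr v, fieldL (quad R' y)⟫ := by
    intro v y
    rw [quad_apply, fieldL_gen, ← pair_comp (fieldL y)]
    simp only [prMap, pr, inner_pair, hRR', comp0_pair, comp1_pair]
  have hPR' : ∀ v (y : Quad), ⟪prMap R v, derivL y⟫ = ⟪pr v, derivL (quad R' y)⟫ := by
    intro v y
    rw [quad_apply, derivL_gen, ← pair_comp (derivL y)]
    simp only [prMap, pr, inner_pair, hRR', comp0_pair, comp1_pair]
  have hmem : ∀ᵐ τ ∂μ, gen (R (W τ 0)) (R (W τ 1)) (R (W1 τ 0)) (R (W1 τ 1)) ∈ divSpace := by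
    filter_upwards [hd, ae_restrict_mem measurableSet_Ioc] with τ h1 h2
    obtain ⟨q, hq1, hq2⟩ := hdiv τ ⟨h2.1.le, h2.2⟩
    refine gen_mem_divSpace ((h1 0).map hR) ((h1 1).map hR) ?_
    have e : W1 τ 0 = -q := (h1 0).unique hq2
    rw [e, map_neg, neg_neg]
    exact hq1.map hR
  -- Membership holds only for almost every time; the value zero elsewhere is immaterial.
  obtain ⟨v, hv, hv'⟩ : ∃ v : ℝ → divSpace, (∀ᵐ τ ∂μ, divField (v τ) = prMap R (W τ)) ∧
      ∀ᵐ τ ∂μ, divDeriv (v τ) = prMap R (W1 τ) := by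
    refine ⟨fun τ =>
      if h : gen (R (W τ 0)) (R (W τ 1)) (R (W1 τ 0)) (R (W1 τ 1)) ∈ divSpace then ⟨_, h⟩ else 0,
      ?_, ?_⟩
    · filter_upwards [hmem] with τ h
      simp only [dif_pos h]; rfl
    · filter_upwards [hmem] with τ h
      simp only [dif_pos h]; rfl
  have mPR : ∀ f : ℝ → Fin 2 → L2, (∀ j, AEStronglyMeasurable (fun τ => f τ j) μ) →
      AEStronglyMeasurable (fun τ => prMap R (f τ)) μ := fun f h =>
    aestronglyMeasurable_pr fun j => R.continuous.comp_aestronglyMeasurable (h j)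
  -- A single factor dominating both the forcing, linear in `R`, and the dissipation, quadratic in
  -- `R`.
  set c : ℝ := 2 * ‖R‖ + (2 * ‖R‖) ^ 2
  have nR : ∀ f : L2, ‖R f‖ ≤ ‖R‖ * ‖f‖ := R.le_opNorm
  have iG : IntegrableOn (fun τ => pr (G τ)) (Ioc 0 t) := by
    refine Integrable.mono' (hκ.const_mul 2) (aestronglyMeasurable_pr mG) ?_
    filter_upwards [hG] with τ h using norm_pr_le h
  have iW1 : IntegrableOn (fun τ => pr (W1 τ)) (Ioc 0 t) := by
    have i1 : IntegrableOn (fun τ => 2 * (1 + κ τ)) (Ioc 0 t) :=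
      ((integrable_const (1 : ℝ)).add hκ).const_mul 2
    refine Integrable.mono' i1 (aestronglyMeasurable_pr mW1) ?_
    filter_upwards [hW1] with τ h
    refine norm_pr_le fun j => ?_
    nlinarith [h j, sq_nonneg (‖W1 τ j‖ - 1)]
  have e := energy_equality_divSpace ht (w := fun τ => prMap R (W τ)) (F := fun τ => prMap R (G τ)) (v := v)
    (ν := ν) (M := 2 * (‖R‖ * M)) (κ := fun τ => c * κ τ)
    (fun τ hτ => norm_pr_le fun j => (nR _).trans
      (mul_le_mul_of_nonneg_left (hM τ hτ j) (norm_nonneg _)))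
    hv (hκ.const_mul c) ?_ ?_ ?_ ?_ ?_ ?_ ?_
  · simp only [prMap, norm_pr_sq, inner_pr] at e
    rw [e]
    congr 1
    rw [intervalIntegral.integral_of_le ht.le, intervalIntegral.integral_of_le ht.le]
    refine integral_congr_ae ?_
    filter_upwards [hv'] with τ h
    rw [h]; simp only [prMap, norm_pr_sq]
  · filter_upwards [hG] with τ h
    have hκ0 : 0 ≤ κ τ := (norm_nonneg _).trans (h 0)
    have h1 : ‖prMap R (G τ)‖ ≤ 2 * (‖R‖ * κ τ) := norm_pr_le fun j => (nR _).trans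
      (mul_le_mul_of_nonneg_left (h j) (norm_nonneg _))
    simp only [c]
    nlinarith [mul_nonneg (sq_nonneg (2 * ‖R‖)) hκ0]
  · filter_upwards [hW1, hv'] with τ h h'
    have hκ0 : 0 ≤ κ τ := (sq_nonneg _).trans (h 0)
    rw [h', prMap, norm_pr_sq, Fin.sum_univ_two]
    have h1 : ∀ j, ‖R (W1 τ j)‖ ^ 2 ≤ ‖R‖ ^ 2 * κ τ := fun j => by
      have := pow_le_pow_left₀ (norm_nonneg _) (nR (W1 τ j)) 2
      rw [mul_pow] at this
      exact this.trans (mul_le_mul_of_nonneg_left (h j) (sq_nonneg _))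
    have h2 : 0 ≤ ‖R‖ * κ τ := mul_nonneg (norm_nonneg _) hκ0
    simp only [c]
    nlinarith [h1 0, h1 1, mul_nonneg (sq_nonneg (‖R‖)) hκ0]
  · intro φ
    exact (mPR G mG).inner aestronglyMeasurable_const
  · intro φ
    refine AEStronglyMeasurable.congr ((mPR W1 mW1).inner
      (aestronglyMeasurable_const (b := φ))) ?_
    filter_upwards [hv'] with τ h
    rw [h]
  · intro s hs y
    have hsub : Ioc 0 s ⊆ Ioc 0 t := Ioc_subset_Ioc_right hs.2
    have h1 := forall_divSpace_of_forall_divTests (a := pr (W s) - pr (W 0)) (ν := ν) hs.1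
      (iG.mono_set hsub) (iW1.mono_set hsub)
      (fun x hx => by rw [inner_sub_left, heq s hs x hx]; ring) (hR' y y.2)
    rw [inner_sub_left, sub_eq_iff_eq_add'] at h1
    have e1 : ∀ u, ⟪prMap R u, divField y⟫ = ⟪pr u, fieldL (quad R' y)⟫ := fun u => hPR u y
    have e2 : ∀ u, ⟪prMap R u, divDeriv y⟫ = ⟪pr u, derivL (quad R' y)⟫ := fun u => hPR' u y
    simp only [e1, h1]
    congr 1
    rw [intervalIntegral.integral_of_le hs.1, intervalIntegral.integral_of_le hs.1]
    refine integral_congr_ae ?_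
    filter_upwards [ae_restrict_of_ae_restrict_of_subset hsub hv'] with τ h
    rw [h, e2]
  · obtain ⟨q, h1, h2⟩ := hdiv 0 ⟨le_rfl, ht.le⟩
    exact mem_closure_range_divField (h1.map hR) (by rw [← map_neg]; exact h2.map hR)
  · obtain ⟨q, h1, h2⟩ := hdiv t ⟨ht.le, le_rfl⟩
    exact mem_closure_range_divField (h1.map hR) (by rw [← map_neg]; exact h2.map hR)

/-- Adjoint of a difference quotient. -/
def dqAdj (i : Fin 2) (h : ℝ) : L2 →L[ℝ] L2 := -dq i (-h)

theorem inner_dq_left (i : Fin 2) (h : ℝ) (f g : L2) : ⟪dq i h f, g⟫ = ⟪f, dqAdj i h g⟫ := by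
  rw [dqAdj, neg_apply, dq_apply, dq_apply, real_inner_smul_left,
    inner_sub_left, inner_tr_left, inv_neg, neg_smul, neg_neg, real_inner_smul_right,
    inner_sub_right]

theorem quad_dqAdj_mem (i : Fin 2) (h : ℝ) {x : Quad} (hx : x ∈ divSpace) :
    quad (dqAdj i h) x ∈ divSpace :=
  divSpace.neg_mem (quad_dq_mem i (-h) hx)

/-! ### Bootstrap and a priori estimates -/

section

/-- A continuity argument for a superlinear energy inequality. -/
theorem energy_le_of_superlinear {t c δ : ℝ} (ht : 0 ≤ t) (hc : 0 < c) (hδ : 0 < δ)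
    (hδc : 2 * δ ≤ (c / 512) ^ 2) {E e D : ℝ → ℝ} (he : ∀ s ∈ Icc 0 t, e s ≤ E s)
    (hE0 : ∀ s ∈ Icc 0 t, 0 ≤ E s)
    (hD0 : ∀ s, 0 ≤ D s) (hD : IntegrableOn D (Ioc 0 t))
    (hg : IntegrableOn (fun s => √(e s) * D s) (Ioc 0 t))
    (h : ∀ s ∈ Icc 0 t, E s + 2 * c * ∫ τ in (0 : ℝ)..s, D τ ≤
      δ + 256 * ∫ τ in (0 : ℝ)..s, √(e τ) * D τ) :
    E t + 2 * c * ∫ τ in (0 : ℝ)..t, D τ ≤ 2 * δ := by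
  -- The continuity argument runs on this majorant, which is continuous and nondecreasing, since `E`
  -- itself is not known to be continuous.
  set Y : ℝ → ℝ := fun s => δ + 256 * ∫ τ in (0 : ℝ)..s, √(e τ) * D τ
  have hi : ∀ a b, a ∈ Icc 0 t → b ∈ Icc 0 t →
      IntervalIntegrable (fun s => √(e s) * D s) volume a b := fun a b ha hb =>
    (((intervalIntegrable_iff_integrableOn_Ioc_of_le ht).2 hg).mono_set (by
      rw [uIcc_of_le ht]; exact uIcc_subset_Icc ha hb))
  have h0t : (0 : ℝ) ∈ Icc 0 t := ⟨le_rfl, ht⟩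
  have hYc : ContinuousOn Y (Icc 0 t) := by
    refine continuousOn_const.add (continuousOn_const.mul ?_)
    have := intervalIntegral.continuousOn_primitive_interval (μ := volume) (a := 0) (b := t)
      (f := fun s => √(e s) * D s) (by
        rw [uIcc_of_le ht, integrableOn_Icc_iff_integrableOn_Ioc]; exact hg)
    rwa [uIcc_of_le ht] at this
  have hmono : ∀ a b, a ∈ Icc 0 t → b ∈ Icc 0 t → a ≤ b → Y a ≤ Y b := by
    intro a b ha hb hab
    have e1 := intervalIntegral.integral_add_adjacent_intervals (hi 0 a h0t ha) (hi a b ha hb)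
    have e2 : 0 ≤ ∫ τ in a..b, √(e τ) * D τ := intervalIntegral.integral_nonneg hab
      fun s _ => mul_nonneg (Real.sqrt_nonneg _) (hD0 s)
    simp only [Y]; linarith
  suffices hY : Y t ≤ 2 * δ from (h t ⟨ht, le_rfl⟩).trans hY
  by_contra! hlt
  have hY0 : Y 0 = δ := by simp [Y]
  obtain ⟨s, hs, hYs⟩ := intermediate_value_Icc ht hYc
    (show 2 * δ ∈ Icc (Y 0) (Y t) from ⟨by rw [hY0]; linarith, hlt.le⟩)
  have hDs : ∀ s ∈ Icc 0 t, 0 ≤ ∫ τ in (0 : ℝ)..s, D τ := fun s hs =>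
    intervalIntegral.integral_nonneg hs.1 fun τ _ => hD0 τ
  -- At the time `s` where `Y` reaches 2δ, all earlier energies are at most 2δ. With 512 = 2·256 the
  -- nonlinear term is then at most (c/2)∫D, whereas the inequality gives (c/2)∫D ≤ δ/2; yet the
  -- term equals δ there.
  have hroot : ∀ τ ∈ Icc 0 s, √(e τ) ≤ c / 512 := by
    intro τ hτ
    have hτ' : τ ∈ Icc 0 t := ⟨hτ.1, hτ.2.trans hs.2⟩
    refine Real.sqrt_le_iff.2 ⟨by positivity, ?_⟩
    have h1 := h τ hτ'
    have h2 := hmono τ s hτ' hs hτ.2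
    have h3 := mul_nonneg (mul_nonneg zero_le_two hc.le) (hDs τ hτ')
    have h4 := he τ hτ'
    simp only [Y] at h2 hYs
    linarith
  have hle : ∫ τ in (0 : ℝ)..s, √(e τ) * D τ ≤ ∫ τ in (0 : ℝ)..s, c / 512 * D τ := by
    refine intervalIntegral.integral_mono_on hs.1 (hi 0 s h0t hs) ?_ fun τ hτ =>
      mul_le_mul_of_nonneg_right (hroot τ hτ) (hD0 τ)
    exact (((intervalIntegrable_iff_integrableOn_Ioc_of_le ht).2 hD).mono_set (by
      rw [uIcc_of_le ht]; exact uIcc_subset_Icc h0t hs)).const_mul _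
  rw [intervalIntegral.integral_const_mul] at hle
  have h1 := h s hs
  have h2 := hE0 s hs
  simp only [Y] at hYs
  nlinarith

/-- Weak solutions on `[0, t]`, in terms of square-integrable components. -/
structure Flow (ν η t : ℝ) (u u1 u2 u12 b b1 b2 b12 : ℝ → Fin 2 → L2) : Prop where
  good_u : ∀ᵐ τ ∂(volume.restrict (Ioc 0 t)), VGood (u τ) (u1 τ) (u2 τ) (u12 τ)
  good_b : ∀ᵐ τ ∂(volume.restrict (Ioc 0 t)), VGood (b τ) (b1 τ) (b2 τ) (b12 τ)
  d2_u : ∀ τ ∈ Icc 0 t, ∀ j, LD 1 (u τ j) (u2 τ j)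
  d2_b : ∀ τ ∈ Icc 0 t, ∀ j, LD 1 (b τ j) (b2 τ j)
  div_u : ∀ τ ∈ Icc 0 t, LD 0 (u τ 0) (-(u2 τ 1))
  div_b : ∀ τ ∈ Icc 0 t, LD 0 (b τ 0) (-(b2 τ 1))
  bdd : ∃ M, ∀ τ ∈ Icc 0 t, ∀ j, ‖u τ j‖ ≤ M ∧ ‖b τ j‖ ≤ M ∧ ‖u2 τ j‖ ≤ M ∧ ‖b2 τ j‖ ≤ M
  meas : ∀ j, ∀ f ∈ ({u, u1, u2, u12, b, b1, b2, b12} : Set (ℝ → Fin 2 → L2)),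
    AEStronglyMeasurable (fun τ => f τ j) (volume.restrict (Ioc 0 t))
  meas_force_u : ∀ j, AEStronglyMeasurable (fun τ => conv (b τ) (b1 τ) (b2 τ) j -
    conv (u τ) (u1 τ) (u2 τ) j) (volume.restrict (Ioc 0 t))
  meas_force_b : ∀ j, AEStronglyMeasurable (fun τ => conv (b τ) (u1 τ) (u2 τ) j -
    conv (u τ) (b1 τ) (b2 τ) j) (volume.restrict (Ioc 0 t))
  int_u : IntegrableOn (fun τ => sq4 (u τ) (u1 τ) (u2 τ) (u12 τ)) (Ioc 0 t)
  int_b : IntegrableOn (fun τ => sq4 (b τ) (b1 τ) (b2 τ) (b12 τ)) (Ioc 0 t)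
  eq_u : ∀ s ∈ Icc 0 t, ∀ x ∈ divTests, ⟪pr (u s), fieldL x⟫ = ⟪pr (u 0), fieldL x⟫ +
    ∫ τ in (0 : ℝ)..s, (⟪pr fun j => conv (b τ) (b1 τ) (b2 τ) j - conv (u τ) (u1 τ) (u2 τ) j,
      fieldL x⟫ - ν * ⟪pr (u1 τ), derivL x⟫)
  eq_b : ∀ s ∈ Icc 0 t, ∀ x ∈ divTests, ⟪pr (b s), fieldL x⟫ = ⟪pr (b 0), fieldL x⟫ +
    ∫ τ in (0 : ℝ)..s, (⟪pr fun j => conv (b τ) (u1 τ) (u2 τ) j - conv (u τ) (b1 τ) (b2 τ) j,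
      fieldL x⟫ - η * ⟪pr (b1 τ), derivL x⟫)

theorem Flow.mono {ν η t s : ℝ} {u u1 u2 u12 b b1 b2 b12 : ℝ → Fin 2 → L2}
    (h : Flow ν η t u u1 u2 u12 b b1 b2 b12) (hs : s ≤ t) :
    Flow ν η s u u1 u2 u12 b b1 b2 b12 := by
  have h1 : Ioc 0 s ⊆ Ioc 0 t := Ioc_subset_Ioc_right hs
  have h2 : Icc 0 s ⊆ Icc 0 t := Icc_subset_Icc_right hs
  have hμ := Measure.restrict_mono_set volume h1
  obtain ⟨M, hM⟩ := h.bdd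
  exact
  { good_u := ae_restrict_of_ae_restrict_of_subset h1 h.good_u
    good_b := ae_restrict_of_ae_restrict_of_subset h1 h.good_b
    d2_u := fun τ hτ => h.d2_u τ (h2 hτ)
    d2_b := fun τ hτ => h.d2_b τ (h2 hτ)
    div_u := fun τ hτ => h.div_u τ (h2 hτ)
    div_b := fun τ hτ => h.div_b τ (h2 hτ)
    bdd := ⟨M, fun τ hτ => hM τ (h2 hτ)⟩
    meas := fun j f hf => (h.meas j f hf).mono_measure hμ
    meas_force_u := fun j => (h.meas_force_u j).mono_measure hμ
    meas_force_b := fun j => (h.meas_force_b j).mono_measure hμ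
    int_u := h.int_u.mono_set h1
    int_b := h.int_b.mono_set h1
    eq_u := fun τ hτ => h.eq_u τ (h2 hτ)
    eq_b := fun τ hτ => h.eq_b τ (h2 hτ) }

/-- Sum of the squared norms of the components of two fields. -/
def nsq (v w : Fin 2 → L2) : ℝ := ∑ j, (‖v j‖ ^ 2 + ‖w j‖ ^ 2)

theorem nsq_nonneg (v w : Fin 2 → L2) : 0 ≤ nsq v w := Finset.sum_nonneg fun _ _ => by positivity

theorem le_nsq_left (v w : Fin 2 → L2) (j : Fin 2) : ‖v j‖ ^ 2 ≤ nsq v w := by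
  refine le_trans ?_ (Finset.single_le_sum (fun k _ => by positivity) (Finset.mem_univ j))
  nlinarith [sq_nonneg ‖w j‖]

theorem le_nsq_right (v w : Fin 2 → L2) (j : Fin 2) : ‖w j‖ ^ 2 ≤ nsq v w := by
  refine le_trans ?_ (Finset.single_le_sum (fun k _ => by positivity) (Finset.mem_univ j))
  nlinarith [sq_nonneg ‖v j‖]

theorem sq4_add_sq4 (u u1 u2 u12 b b1 b2 b12 : Fin 2 → L2) :
    sq4 u u1 u2 u12 + sq4 b b1 b2 b12 = nsq u b + nsq u1 b1 + nsq u2 b2 + nsq u12 b12 := by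
  simp only [sq4, nsq, Fin.sum_univ_two]; ring

/-- The work of the nonlinearities after applying an operator. -/
def work (R : L2 →L[ℝ] L2) (u u1 u2 b b1 b2 : Fin 2 → L2) : ℝ :=
  ∑ j, (⟪R (conv b b1 b2 j - conv u u1 u2 j), R (u j)⟫ +
    ⟪R (conv b u1 u2 j - conv u b1 b2 j), R (b j)⟫)

/-- The dissipation after applying an operator. -/
def diss (ν η : ℝ) (R : L2 →L[ℝ] L2) (u1 b1 : Fin 2 → L2) : ℝ :=
  ν * (∑ j, ‖R (u1 j)‖ ^ 2) + η * ∑ j, ‖R (b1 j)‖ ^ 2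

theorem norm_diss_le (ν η : ℝ) (R : L2 →L[ℝ] L2) (u1 b1 : Fin 2 → L2) : ‖diss ν η R u1 b1‖ ≤
    |ν| * (∑ j, ‖R (u1 j)‖ ^ 2) + |η| * ∑ j, ‖R (b1 j)‖ ^ 2 := by
  have n : ∀ f : Fin 2 → L2, 0 ≤ ∑ j, ‖R (f j)‖ ^ 2 := fun f =>
    Finset.sum_nonneg fun _ _ => sq_nonneg _
  refine (norm_add_le _ _).trans_eq ?_
  rw [norm_mul, norm_mul, Real.norm_of_nonneg (n u1), Real.norm_of_nonneg (n b1),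
    Real.norm_eq_abs, Real.norm_eq_abs]

namespace Flow

variable {ν η t : ℝ} {u u1 u2 u12 b b1 b2 b12 : ℝ → Fin 2 → L2}

theorem integrable_of_le (h : Flow ν η t u u1 u2 u12 b b1 b2 b12) {f : ℝ → ℝ} {C : ℝ}
    (hm : AEStronglyMeasurable f (volume.restrict (Ioc 0 t)))
    (hf : ∀ᵐ τ ∂(volume.restrict (Ioc 0 t)),
      |f τ| ≤ C * (nsq (u τ) (b τ) + nsq (u1 τ) (b1 τ) + nsq (u2 τ) (b2 τ) + nsq (u12 τ) (b12 τ))) :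
    IntegrableOn f (Ioc 0 t) := by
  refine Integrable.mono' ((h.int_u.add h.int_b).const_mul C) hm ?_
  filter_upwards [hf] with τ hτ
  rw [Pi.add_apply, sq4_add_sq4]
  exact hτ

theorem aesm_nsq (h : Flow ν η t u u1 u2 u12 b b1 b2 b12) {f g : ℝ → Fin 2 → L2}
    (hf : f ∈ ({u, u1, u2, u12, b, b1, b2, b12} : Set (ℝ → Fin 2 → L2)))
    (hg : g ∈ ({u, u1, u2, u12, b, b1, b2, b12} : Set (ℝ → Fin 2 → L2))) :
    AEStronglyMeasurable (fun τ => nsq (f τ) (g τ)) (volume.restrict (Ioc 0 t)) :=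
  Finset.aestronglyMeasurable_fun_sum _ fun j _ =>
    ((h.meas j f hf).norm.pow 2).add ((h.meas j g hg).norm.pow 2)

theorem integrable_nsq1 (h : Flow ν η t u u1 u2 u12 b b1 b2 b12) :
    IntegrableOn (fun τ => nsq (u1 τ) (b1 τ)) (Ioc 0 t) := by
  refine h.integrable_of_le (C := 1) (h.aesm_nsq (by simp) (by simp))
    (Eventually.of_forall fun τ => ?_)
  rw [abs_of_nonneg (nsq_nonneg _ _)]
  linarith [nsq_nonneg (u τ) (b τ), nsq_nonneg (u2 τ) (b2 τ), nsq_nonneg (u12 τ) (b12 τ)]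

theorem integrable_nsq12 (h : Flow ν η t u u1 u2 u12 b b1 b2 b12) :
    IntegrableOn (fun τ => nsq (u12 τ) (b12 τ)) (Ioc 0 t) := by
  refine h.integrable_of_le (C := 1) (h.aesm_nsq (by simp) (by simp))
    (Eventually.of_forall fun τ => ?_)
  rw [abs_of_nonneg (nsq_nonneg _ _)]
  linarith [nsq_nonneg (u τ) (b τ), nsq_nonneg (u2 τ) (b2 τ), nsq_nonneg (u1 τ) (b1 τ)]

theorem norm_force_le (h : Flow ν η t u u1 u2 u12 b b1 b2 b12) :
    ∀ᵐ τ ∂(volume.restrict (Ioc 0 t)), ∀ j,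
      ‖conv (b τ) (b1 τ) (b2 τ) j - conv (u τ) (u1 τ) (u2 τ) j‖ ≤
        4 * (sq4 (u τ) (u1 τ) (u2 τ) (u12 τ) + sq4 (b τ) (b1 τ) (b2 τ) (b12 τ)) ∧
      ‖conv (b τ) (u1 τ) (u2 τ) j - conv (u τ) (b1 τ) (b2 τ) j‖ ≤
        4 * (sq4 (u τ) (u1 τ) (u2 τ) (u12 τ) + sq4 (b τ) (b1 τ) (b2 τ) (b12 τ)) := by
  filter_upwards [h.good_u, h.good_b] with τ hu hb j
  have k1 := norm_conv_le hb (w1 := b1 τ) (w2 := b2 τ) (b τ) (b12 τ) j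
  have k2 := norm_conv_le hu (w1 := u1 τ) (w2 := u2 τ) (u τ) (u12 τ) j
  have k3 := norm_conv_le hb (w1 := u1 τ) (w2 := u2 τ) (u τ) (u12 τ) j
  have k4 := norm_conv_le hu (w1 := b1 τ) (w2 := b2 τ) (b τ) (b12 τ) j
  exact ⟨(norm_sub_le _ _).trans (by linarith), (norm_sub_le _ _).trans (by linarith)⟩

/-- Add the energy equalities of the two equations. The operator `R` will be the identity or a
vertical difference quotient. -/
theorem energy (h : Flow ν η t u u1 u2 u12 b b1 b2 b12) (ht : 0 < t) {R R' : L2 →L[ℝ] L2}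
    (hR : TransComm R) (hRR' : ∀ f g, ⟪R f, g⟫ = ⟪f, R' g⟫)
    (hR' : ∀ x ∈ divSpace, quad R' x ∈ divSpace) :
    IntegrableOn (fun τ => work R (u τ) (u1 τ) (u2 τ) (b τ) (b1 τ) (b2 τ)) (Ioc 0 t) ∧
    IntegrableOn (fun τ => diss ν η R (u1 τ) (b1 τ)) (Ioc 0 t) ∧
    nsq (fun j => R (u t j)) (fun j => R (b t j)) + 2 * ∫ τ in (0 : ℝ)..t,
        diss ν η R (u1 τ) (b1 τ) =
      nsq (fun j => R (u 0 j)) (fun j => R (b 0 j)) + 2 * ∫ τ in (0 : ℝ)..t,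
        work R (u τ) (u1 τ) (u2 τ) (b τ) (b1 τ) (b2 τ) := by
  obtain ⟨M, hM⟩ := h.bdd
  set μ := volume.restrict (Ioc 0 t)
  set Q : ℝ → ℝ := fun τ =>
    sq4 (u τ) (u1 τ) (u2 τ) (u12 τ) + sq4 (b τ) (b1 τ) (b2 τ) (b12 τ)
  have hQ : Integrable Q μ := h.int_u.add h.int_b
  have hQ4 : Integrable (fun τ => 4 * Q τ) μ := hQ.const_mul 4
  have hQe : ∀ τ, Q τ = nsq (u τ) (b τ) + nsq (u1 τ) (b1 τ) + nsq (u2 τ) (b2 τ) +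
    nsq (u12 τ) (b12 τ) := fun τ => sq4_add_sq4 _ _ _ _ _ _ _ _
  have hQ1 : ∀ τ, nsq (u1 τ) (b1 τ) ≤ 4 * Q τ := fun τ => by
    rw [hQe]
    linarith [nsq_nonneg (u τ) (b τ), nsq_nonneg (u2 τ) (b2 τ), nsq_nonneg (u1 τ) (b1 τ),
      nsq_nonneg (u12 τ) (b12 τ)]
  have hF := h.norm_force_le
  have nR : ∀ f : L2, ‖R f‖ ≤ ‖R‖ * ‖f‖ := R.le_opNorm
  have hM0 : 0 ≤ M := (norm_nonneg _).trans (hM 0 ⟨le_rfl, ht.le⟩ 0).1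
  have mR : ∀ f : ℝ → L2, AEStronglyMeasurable f μ → AEStronglyMeasurable (fun τ => R (f τ)) μ :=
    fun f hf => R.continuous.comp_aestronglyMeasurable hf
  have iw : ∀ F w : ℝ → L2, AEStronglyMeasurable F μ → AEStronglyMeasurable w μ →
      (∀ᵐ τ ∂μ, ‖F τ‖ ≤ 4 * Q τ) → (∀ τ ∈ Icc 0 t, ‖w τ‖ ≤ M) →
      Integrable (fun τ => ⟪R (F τ), R (w τ)⟫) μ := by
    intro F w mF mw bF bw
    refine Integrable.mono' (hQ4.const_mul (‖R‖ * (‖R‖ * M))) ((mR F mF).inner (mR w mw)) ?_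
    filter_upwards [bF, ae_restrict_mem measurableSet_Ioc] with τ h1 h2
    have h3 := bw τ ⟨h2.1.le, h2.2⟩
    calc ‖⟪R (F τ), R (w τ)⟫‖ ≤ ‖R (F τ)‖ * ‖R (w τ)‖ := norm_inner_le_norm _ _
      _ ≤ (‖R‖ * (4 * Q τ)) * (‖R‖ * M) := by
        have g1 := (nR (F τ)).trans (mul_le_mul_of_nonneg_left h1 (norm_nonneg R))
        have g2 := (nR (w τ)).trans (mul_le_mul_of_nonneg_left h3 (norm_nonneg R))
        exact mul_le_mul g1 g2 (norm_nonneg _) ((norm_nonneg _).trans g1)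
      _ = _ := by ring
  have is : ∀ f : ℝ → L2, AEStronglyMeasurable f μ → (∀ τ, ‖f τ‖ ^ 2 ≤ 4 * Q τ) →
      Integrable (fun τ => ‖R (f τ)‖ ^ 2) μ := by
    intro f mf bf
    refine Integrable.mono' (hQ4.const_mul (‖R‖ ^ 2)) ((mR f mf).norm.pow 2)
      (Eventually.of_forall fun τ => ?_)
    rw [Real.norm_of_nonneg (sq_nonneg _)]
    calc ‖R (f τ)‖ ^ 2 ≤ (‖R‖ * ‖f τ‖) ^ 2 := by gcongr; exact nR _
      _ = ‖R‖ ^ 2 * ‖f τ‖ ^ 2 := by ring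
      _ ≤ _ := mul_le_mul_of_nonneg_left (bf τ) (sq_nonneg _)
  have iwu : Integrable (fun τ => ∑ j, ⟪R (conv (b τ) (b1 τ) (b2 τ) j -
      conv (u τ) (u1 τ) (u2 τ) j), R (u τ j)⟫) μ := integrable_finsetSum _ fun j _ =>
    iw _ _ (h.meas_force_u j) (h.meas j u (by simp)) (hF.mono fun τ g => (g j).1)
      fun τ hτ => (hM τ hτ j).1
  have iwb : Integrable (fun τ => ∑ j, ⟪R (conv (b τ) (u1 τ) (u2 τ) j -
      conv (u τ) (b1 τ) (b2 τ) j), R (b τ j)⟫) μ := integrable_finsetSum _ fun j _ =>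
    iw _ _ (h.meas_force_b j) (h.meas j b (by simp)) (hF.mono fun τ g => (g j).2)
      fun τ hτ => (hM τ hτ j).2.1
  have isu : Integrable (fun τ => ν * ∑ j, ‖R (u1 τ j)‖ ^ 2) μ :=
    (integrable_finsetSum _ fun j _ => is _ (h.meas j u1 (by simp)) fun τ =>
      (le_nsq_left _ _ j).trans (hQ1 τ)).const_mul _
  have isb : Integrable (fun τ => η * ∑ j, ‖R (b1 τ j)‖ ^ 2) μ :=
    (integrable_finsetSum _ fun j _ => is _ (h.meas j b1 (by simp)) fun τ =>
      (le_nsq_right _ _ j).trans (hQ1 τ)).const_mul _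
  have eu := energy_transformed ht (ν := ν) (M := M) (W := u) (W1 := u1)
    (G := fun τ j => conv (b τ) (b1 τ) (b2 τ) j - conv (u τ) (u1 τ) (u2 τ) j)
    (κ := fun τ => 4 * Q τ) (fun τ hτ j => (hM τ hτ j).1)
    (fun τ hτ => ⟨_, h.d2_u τ hτ 1, h.div_u τ hτ⟩)
    (h.good_u.mono fun τ g j => (g.good j).d1) (fun j => h.meas j u1 (by simp))
    h.meas_force_u hQ4 (hF.mono fun τ g j => (g j).1)
    (Eventually.of_forall fun τ j => (le_nsq_left _ _ j).trans (hQ1 τ)) h.eq_u hR hRR' hR'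
  have eb := energy_transformed ht (ν := η) (M := M) (W := b) (W1 := b1)
    (G := fun τ j => conv (b τ) (u1 τ) (u2 τ) j - conv (u τ) (b1 τ) (b2 τ) j)
    (κ := fun τ => 4 * Q τ) (fun τ hτ j => (hM τ hτ j).2.1)
    (fun τ hτ => ⟨_, h.d2_b τ hτ 1, h.div_b τ hτ⟩)
    (h.good_b.mono fun τ g j => (g.good j).d1) (fun j => h.meas j b1 (by simp))
    h.meas_force_b hQ4 (hF.mono fun τ g j => (g j).2)
    (Eventually.of_forall fun τ j => (le_nsq_right _ _ j).trans (hQ1 τ)) h.eq_b hR hRR' hR'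
  have ii : ∀ {f : ℝ → ℝ}, Integrable f μ → IntervalIntegrable f volume 0 t := fun hf =>
    (intervalIntegrable_iff_integrableOn_Ioc_of_le ht.le).2 hf
  rw [intervalIntegral.integral_sub (ii iwu) (ii isu)] at eu
  rw [intervalIntegral.integral_sub (ii iwb) (ii isb)] at eb
  have ew : (fun τ => work R (u τ) (u1 τ) (u2 τ) (b τ) (b1 τ) (b2 τ)) = fun τ =>
      (∑ j, ⟪R (conv (b τ) (b1 τ) (b2 τ) j - conv (u τ) (u1 τ) (u2 τ) j), R (u τ j)⟫) +
      ∑ j, ⟪R (conv (b τ) (u1 τ) (u2 τ) j - conv (u τ) (b1 τ) (b2 τ) j), R (b τ j)⟫ := by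
    ext1 τ; rw [work, Finset.sum_add_distrib]
  refine ⟨by rw [ew]; exact iwu.add iwb, isu.add isb, ?_⟩
  rw [ew, intervalIntegral.integral_add (ii iwu) (ii iwb)]
  simp only [diss]
  rw [intervalIntegral.integral_add (ii isu) (ii isb)]
  simp only [nsq, Finset.sum_add_distrib]
  linarith

/-- With the identity as operator the total work vanishes at almost every time. -/
theorem energy_zero (h : Flow ν η t u u1 u2 u12 b b1 b2 b12) (ht : 0 < t) :
    nsq (u t) (b t) + 2 * min ν η * ∫ τ in (0 : ℝ)..t, nsq (u1 τ) (b1 τ) ≤ nsq (u 0) (b 0) := by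
  obtain ⟨-, i2, e⟩ := h.energy ht (R := .id ℝ L2) (R' := .id ℝ L2) transComm_id (fun _ _ => rfl)
    fun x hx => hx
  have hw : ∫ τ in (0 : ℝ)..t, work (.id ℝ L2) (u τ) (u1 τ) (u2 τ) (b τ) (b1 τ) (b2 τ) = 0 := by
    rw [intervalIntegral.integral_of_le ht.le]
    refine integral_eq_zero_of_ae ?_
    filter_upwards [h.good_u, h.good_b] with τ hu hb
    exact Finset.sum_eq_zero fun j _ => inner_force_add hu hb j
  rw [hw, mul_zero, add_zero] at e
  have hle : min ν η * ∫ τ in (0 : ℝ)..t, nsq (u1 τ) (b1 τ) ≤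
      ∫ τ in (0 : ℝ)..t, diss ν η (.id ℝ L2) (u1 τ) (b1 τ) := by
    rw [← intervalIntegral.integral_const_mul]
    refine intervalIntegral.integral_mono ht.le
      (((intervalIntegrable_iff_integrableOn_Ioc_of_le ht.le).2 h.integrable_nsq1).const_mul _)
      ((intervalIntegrable_iff_integrableOn_Ioc_of_le ht.le).2 i2) fun τ => ?_
    simp only [nsq, diss, Finset.sum_add_distrib, mul_add, ContinuousLinearMap.id_apply]
    exact add_le_add
      (mul_le_mul_of_nonneg_right (min_le_left _ _) (Finset.sum_nonneg fun _ _ => sq_nonneg _))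
      (mul_le_mul_of_nonneg_right (min_le_right _ _) (Finset.sum_nonneg fun _ _ => sq_nonneg _))
  simp only [ContinuousLinearMap.id_apply] at e
  linarith

theorem integrable_rate (h : Flow ν η t u u1 u2 u12 b b1 b2 b12) :
    IntegrableOn (fun τ => √(nsq (u2 τ) (b2 τ)) * (nsq (u1 τ) (b1 τ) + nsq (u12 τ) (b12 τ)))
      (Ioc 0 t) := by
  obtain ⟨M, hM⟩ := h.bdd
  refine Integrable.mono' ((h.integrable_nsq1.add h.integrable_nsq12).const_mul (√(4 * M ^ 2)))
    ((h.aesm_nsq (by simp) (by simp)).aemeasurable.sqrt.aestronglyMeasurable.mul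
      ((h.aesm_nsq (by simp) (by simp)).add (h.aesm_nsq (by simp) (by simp)))) ?_
  filter_upwards [ae_restrict_mem measurableSet_Ioc] with τ hτ
  have hn := add_nonneg (nsq_nonneg (u1 τ) (b1 τ)) (nsq_nonneg (u12 τ) (b12 τ))
  rw [Real.norm_of_nonneg (mul_nonneg (Real.sqrt_nonneg _) hn), Pi.add_apply]
  refine mul_le_mul_of_nonneg_right (Real.sqrt_le_sqrt ?_) hn
  have h1 := hM τ ⟨hτ.1.le, hτ.2⟩
  have g1 := pow_le_pow_left₀ (norm_nonneg _) (h1 0).2.2.1 2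
  have g2 := pow_le_pow_left₀ (norm_nonneg _) (h1 1).2.2.1 2
  have g3 := pow_le_pow_left₀ (norm_nonneg _) (h1 0).2.2.2 2
  have g4 := pow_le_pow_left₀ (norm_nonneg _) (h1 1).2.2.2 2
  rw [nsq, Fin.sum_univ_two]
  linarith

/-- The commutator bound with R² the total dissipation and S² the squared vertical derivative; 64
for each of the two components. -/
theorem work_dq_le (h : Flow ν η t u u1 u2 u12 b b1 b2 b12) {r : ℝ} (hr : 0 < r) :
    ∀ᵐ τ ∂(volume.restrict (Ioc 0 t)), work (dq 1 r) (u τ) (u1 τ) (u2 τ) (b τ) (b1 τ) (b2 τ) ≤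
      128 * (√(nsq (u2 τ) (b2 τ)) * (nsq (u1 τ) (b1 τ) + nsq (u12 τ) (b12 τ))) := by
  filter_upwards [h.good_u, h.good_b] with τ hu hb
  set D := nsq (u1 τ) (b1 τ) + nsq (u12 τ) (b12 τ)
  have n1 := nsq_nonneg (u1 τ) (b1 τ)
  have n2 := nsq_nonneg (u12 τ) (b12 τ)
  have bu : NormBd (u1 τ) (u2 τ) (u12 τ) (√D) (√(nsq (u2 τ) (b2 τ))) :=
    ⟨fun j => Real.le_sqrt_of_sq_le (by linarith [le_nsq_left (u1 τ) (b1 τ) j]),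
      fun j => Real.le_sqrt_of_sq_le (le_nsq_left _ _ j),
      fun j => Real.le_sqrt_of_sq_le (by linarith [le_nsq_left (u12 τ) (b12 τ) j])⟩
  have bb : NormBd (b1 τ) (b2 τ) (b12 τ) (√D) (√(nsq (u2 τ) (b2 τ))) :=
    ⟨fun j => Real.le_sqrt_of_sq_le (by linarith [le_nsq_right (u1 τ) (b1 τ) j]),
      fun j => Real.le_sqrt_of_sq_le (le_nsq_right _ _ j),
      fun j => Real.le_sqrt_of_sq_le (by linarith [le_nsq_right (u12 τ) (b12 τ) j])⟩
  have k := fun j => (le_abs_self _).trans (abs_inner_dq_force_add_le hu hb hr bu bb j)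
  rw [Real.sq_sqrt (by linarith : 0 ≤ D)] at k
  rw [work, Fin.sum_univ_two]
  linarith [k 0, k 1]

/-- The energy equality for the vertical difference quotient with step `r`, whose work is bounded
uniformly in `r`; then `r` tends to zero. -/
theorem energy_two (h : Flow ν η t u u1 u2 u12 b b1 b2 b12) (ht : 0 < t) :
    nsq (u2 t) (b2 t) + 2 * min ν η * ∫ τ in (0 : ℝ)..t, nsq (u12 τ) (b12 τ) ≤
      nsq (u2 0) (b2 0) + 256 * ∫ τ in (0 : ℝ)..t,
        √(nsq (u2 τ) (b2 τ)) * (nsq (u1 τ) (b1 τ) + nsq (u12 τ) (b12 τ)) := by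
  have ii : ∀ {f : ℝ → ℝ}, IntegrableOn f (Ioc 0 t) → IntervalIntegrable f volume 0 t := fun hf =>
    (intervalIntegrable_iff_integrableOn_Ioc_of_le ht.le).2 hf
  set A := ∫ τ in (0 : ℝ)..t, √(nsq (u2 τ) (b2 τ)) * (nsq (u1 τ) (b1 τ) + nsq (u12 τ) (b12 τ))
  have key : ∀ r, 0 < r → nsq (fun j => dq 1 r (u t j)) (fun j => dq 1 r (b t j)) +
      2 * ∫ τ in (0 : ℝ)..t, diss ν η (dq 1 r) (u1 τ) (b1 τ) ≤
      nsq (fun j => dq 1 r (u 0 j)) (fun j => dq 1 r (b 0 j)) + 256 * A := by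
    intro r hr
    obtain ⟨i1, -, e⟩ := h.energy ht (transComm_dq 1 r) (inner_dq_left 1 r)
      fun x hx => quad_dqAdj_mem 1 r hx
    have := intervalIntegral.integral_mono_ae_restrict ht.le (ii i1)
      ((ii h.integrable_rate).const_mul 128) (by
        rw [← restrict_Ioc_eq_restrict_Icc]; exact h.work_dq_le hr)
    rw [intervalIntegral.integral_const_mul] at this
    linarith
  have lim : ∀ τ ∈ Icc 0 t, Tendsto (fun r => nsq (fun j => dq 1 r (u τ j))
      fun j => dq 1 r (b τ j)) (𝓝[>] 0) (𝓝 (nsq (u2 τ) (b2 τ))) := fun τ hτ =>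
    tendsto_finsetSum _ fun j _ => ((h.d2_u τ hτ j).tendsto_dq.norm.pow 2).add
      ((h.d2_b τ hτ j).tendsto_dq.norm.pow 2)
  -- Difference quotients of `u1` and `b1` are dominated by `u12` and `b12`, which are square
  -- integrable in time.
  have limD : Tendsto (fun r => ∫ τ in (0 : ℝ)..t, diss ν η (dq 1 r) (u1 τ) (b1 τ)) (𝓝[>] 0)
      (𝓝 (∫ τ in (0 : ℝ)..t, diss ν η (.id ℝ L2) (u12 τ) (b12 τ))) := by
    refine intervalIntegral.tendsto_integral_filter_of_dominated_convergence
      (fun τ => 2 * (|ν| + |η|) * nsq (u12 τ) (b12 τ)) ?_ ?_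
      ((ii h.integrable_nsq12).const_mul _) ?_
    · refine Eventually.of_forall fun r => ?_
      rw [uIoc_of_le ht.le]
      have m : ∀ j, ∀ f ∈ ({u, u1, u2, u12, b, b1, b2, b12} : Set (ℝ → Fin 2 → L2)),
          AEStronglyMeasurable (fun τ => ‖dq 1 r (f τ j)‖ ^ 2) (volume.restrict (Ioc 0 t)) :=
        fun j f hf => ((dq 1 r).continuous.comp_aestronglyMeasurable (h.meas j f hf)).norm.pow 2
      exact ((Finset.aestronglyMeasurable_fun_sum _ fun j _ => m j u1 (by simp)).const_mul ν).add
        ((Finset.aestronglyMeasurable_fun_sum _ fun j _ => m j b1 (by simp)).const_mul η)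
    · filter_upwards [self_mem_nhdsWithin] with r hr
      rw [uIoc_of_le ht.le, ← ae_restrict_iff' measurableSet_Ioc]
      filter_upwards [h.good_u, h.good_b] with τ hu hb
      have n1 : ∀ j, ‖dq 1 r (u1 τ j)‖ ^ 2 ≤ nsq (u12 τ) (b12 τ) := fun j =>
        (pow_le_pow_left₀ (norm_nonneg _) ((hu.good j).d21.norm_dq_le hr) 2).trans
          (le_nsq_left _ _ j)
      have n2 : ∀ j, ‖dq 1 r (b1 τ j)‖ ^ 2 ≤ nsq (u12 τ) (b12 τ) := fun j =>
        (pow_le_pow_left₀ (norm_nonneg _) ((hb.good j).d21.norm_dq_le hr) 2).trans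
          (le_nsq_right _ _ j)
      have s1 : ∑ j, ‖dq 1 r (u1 τ j)‖ ^ 2 ≤ 2 * nsq (u12 τ) (b12 τ) := by
        rw [Fin.sum_univ_two]; linarith [n1 0, n1 1]
      have s2 : ∑ j, ‖dq 1 r (b1 τ j)‖ ^ 2 ≤ 2 * nsq (u12 τ) (b12 τ) := by
        rw [Fin.sum_univ_two]; linarith [n2 0, n2 1]
      refine (norm_diss_le _ _ _ _ _).trans ?_
      nlinarith [mul_le_mul_of_nonneg_left s1 (abs_nonneg ν),
        mul_le_mul_of_nonneg_left s2 (abs_nonneg η)]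
    · rw [uIoc_of_le ht.le, ← ae_restrict_iff' measurableSet_Ioc]
      filter_upwards [h.good_u, h.good_b] with τ hu hb
      exact ((tendsto_finsetSum _ fun j _ =>
        (hu.good j).d21.tendsto_dq.norm.pow 2).const_mul ν).add
        ((tendsto_finsetSum _ fun j _ => (hb.good j).d21.tendsto_dq.norm.pow 2).const_mul η)
  have fin := le_of_tendsto_of_tendsto ((lim t ⟨ht.le, le_rfl⟩).add (limD.const_mul 2))
    ((lim 0 ⟨le_rfl, ht.le⟩).add_const (256 * A)) (by
      filter_upwards [self_mem_nhdsWithin] with r hr using key r hr)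
  have hle : min ν η * ∫ τ in (0 : ℝ)..t, nsq (u12 τ) (b12 τ) ≤
      ∫ τ in (0 : ℝ)..t, diss ν η (.id ℝ L2) (u12 τ) (b12 τ) := by
    rw [← intervalIntegral.integral_const_mul]
    have i2 : IntegrableOn (fun τ => diss ν η (.id ℝ L2) (u12 τ) (b12 τ)) (Ioc 0 t) := by
      refine Integrable.mono' (h.integrable_nsq12.const_mul (|ν| + |η|))
        (((Finset.aestronglyMeasurable_fun_sum _ fun j _ =>
          (h.meas j u12 (by simp)).norm.pow 2).const_mul ν).add
        ((Finset.aestronglyMeasurable_fun_sum _ fun j _ =>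
          (h.meas j b12 (by simp)).norm.pow 2).const_mul η)) (Eventually.of_forall fun τ => ?_)
      have s1 : ∑ j, ‖u12 τ j‖ ^ 2 ≤ nsq (u12 τ) (b12 τ) :=
        Finset.sum_le_sum fun j _ => by linarith [sq_nonneg ‖b12 τ j‖]
      have s2 : ∑ j, ‖b12 τ j‖ ^ 2 ≤ nsq (u12 τ) (b12 τ) :=
        Finset.sum_le_sum fun j _ => by linarith [sq_nonneg ‖u12 τ j‖]
      refine (norm_diss_le _ _ _ _ _).trans ?_
      simp only [ContinuousLinearMap.id_apply]
      nlinarith [mul_le_mul_of_nonneg_left s1 (abs_nonneg ν),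
        mul_le_mul_of_nonneg_left s2 (abs_nonneg η)]
    refine intervalIntegral.integral_mono ht.le ((ii h.integrable_nsq12).const_mul _) (ii i2)
      fun τ => ?_
    simp only [nsq, diss, Finset.sum_add_distrib, mul_add, ContinuousLinearMap.id_apply]
    exact add_le_add
      (mul_le_mul_of_nonneg_right (min_le_left _ _) (Finset.sum_nonneg fun _ _ => sq_nonneg _))
      (mul_le_mul_of_nonneg_right (min_le_right _ _) (Finset.sum_nonneg fun _ _ => sq_nonneg _))
  linarith

theorem energy_le (h : Flow ν η t u u1 u2 u12 b b1 b2 b12) (ht : 0 < t) (hν : 0 < ν) (hη : 0 < η)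
    {δ : ℝ} (hδ : 0 < δ) (hδc : 2 * δ ≤ (min ν η / 512) ^ 2)
    (h0 : nsq (u 0) (b 0) + nsq (u2 0) (b2 0) ≤ δ) :
    nsq (u t) (b t) + nsq (u2 t) (b2 t) + 2 * min ν η * ∫ τ in (0 : ℝ)..t,
      (nsq (u1 τ) (b1 τ) + nsq (u12 τ) (b12 τ)) ≤ 2 * δ := by
  refine energy_le_of_superlinear ht.le (lt_min hν hη) hδ hδc
    (E := fun s => nsq (u s) (b s) + nsq (u2 s) (b2 s)) (e := fun s => nsq (u2 s) (b2 s))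
    (D := fun τ => nsq (u1 τ) (b1 τ) + nsq (u12 τ) (b12 τ))
    (fun s _ => by linarith [nsq_nonneg (u s) (b s)])
    (fun s _ => add_nonneg (nsq_nonneg _ _) (nsq_nonneg _ _))
    (fun s => add_nonneg (nsq_nonneg _ _) (nsq_nonneg _ _))
    (h.integrable_nsq1.add h.integrable_nsq12) h.integrable_rate fun s hs => ?_
  rcases hs.1.eq_or_lt with rfl | hs0
  · simpa using h0
  have hf := h.mono hs.2
  have e0 := hf.energy_zero hs0
  have e2 := hf.energy_two hs0
  rw [intervalIntegral.integral_add
    ((intervalIntegrable_iff_integrableOn_Ioc_of_le hs0.le).2 hf.integrable_nsq1)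
    ((intervalIntegrable_iff_integrableOn_Ioc_of_le hs0.le).2 hf.integrable_nsq12)]
  linarith

end Flow

end

/-! ### Vector-valued measurability and components of planar fields -/

section

instance : SecondCountableTopology L2 :=
  have : Fact ((2 : ℝ≥0∞) ≠ (⊤ : ℝ≥0∞)) := ⟨by simp⟩
  Lp.SecondCountableTopology

/-- Weak measurability in a separable Hilbert space implies strong measurability. -/
theorem aestronglyMeasurable_of_inner {α H : Type*} [MeasurableSpace α] {μ : Measure α}
    [NormedAddCommGroup H] [InnerProductSpace ℝ H] [SecondCountableTopology H] {f : α → H}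
    (h : ∀ y, AEStronglyMeasurable (fun x => ⟪y, f x⟫) μ) : AEStronglyMeasurable f μ := by
  -- Projections onto spans of initial segments of a dense sequence are finite sums of measurable
  -- scalar coefficients, and they converge pointwise to the identity.
  let U : ℕ → Submodule ℝ H := fun n =>
    Submodule.span ℝ (TopologicalSpace.denseSeq H '' Iio n)
  have hfin : ∀ n, FiniteDimensional ℝ (U n) := fun n =>
    FiniteDimensional.span_of_finite ℝ ((finite_Iio n).image _)
  have hU : Monotone U := fun m n hmn =>
    Submodule.span_mono (image_mono (Iio_subset_Iio hmn))
  have hd : ⊤ ≤ (⨆ n, U n).topologicalClosure := by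
    intro x _
    refine closure_mono ?_ (TopologicalSpace.denseRange_denseSeq H x)
    rintro _ ⟨n, rfl⟩
    exact (le_iSup U (n + 1)) (Submodule.subset_span ⟨n, Nat.lt_succ_self n, rfl⟩)
  refine aestronglyMeasurable_of_tendsto_ae atTop
    (f := fun n x => (U n).starProjection (f x)) (fun n => ?_)
    (Eventually.of_forall fun x => Submodule.starProjection_tendsto_self U hU (f x) hd)
  have e : (fun x => (U n).starProjection (f x)) = fun x =>
      ∑ i, ⟪((stdOrthonormalBasis ℝ (U n) i : U n) : H), f x⟫ •
        ((stdOrthonormalBasis ℝ (U n) i : U n) : H) := by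
    ext1 x
    rw [(stdOrthonormalBasis ℝ (U n)).starProjection_eq_sum_rankOne]
    simp
  rw [e]
  exact Finset.aestronglyMeasurable_fun_sum _ fun i _ => (h _).smul_const _

/-- A jointly measurable function, square integrable in space, is measurable with values in
`L²`. -/
theorem aestronglyMeasurable_hat {μ : Measure ℝ} [SFinite μ] {f : ℝ → Strip → ℝ}
    (hf : AEStronglyMeasurable (fun q : ℝ × Strip => f q.1 q.2) (μ.prod volume))
    (hm : ∀ᵐ τ ∂μ, MemLp (f τ) 2 volume) : AEStronglyMeasurable (fun τ => hat (f τ)) μ := by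
  refine aestronglyMeasurable_of_inner fun y => ?_
  have h1 : AEStronglyMeasurable (fun q : ℝ × Strip => y q.2 * f q.1 q.2) (μ.prod volume) :=
    (Lp.aestronglyMeasurable y).comp_snd.mul hf
  refine h1.integral_prod_right'.congr ?_
  filter_upwards [hm] with τ h
  rw [inner_hat h]

/-- A component of a field, as an element of `L²`. -/
def hc (f : Strip → Vec) (j : Fin 2) : L2 := hat fun z => f z j

theorem coeFn_hc {f : Strip → Vec} (hf : MemLp f 2 volume) (j : Fin 2) :
    hc f j =ᵐ[volume] fun z => f z j := coeFn_hat (hf.eval_piLp j)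

theorem norm_hat_sq {f : Strip → ℝ} (hf : MemLp f 2 volume) : ‖hat f‖ ^ 2 = ∫ z, f z ^ 2 := by
  rw [← real_inner_self_eq_norm_sq, inner_hat hf]
  refine integral_congr_ae ?_
  filter_upwards [coeFn_hat hf] with z h
  rw [h, sq]

theorem normSq_eq {f : Strip → Vec} (hf : MemLp f 2 volume) : normSq f = ∑ j, ‖hc f j‖ ^ 2 := by
  simp only [normSq, EuclideanSpace.real_norm_sq_eq]
  rw [integral_finsetSum _ fun j _ => (hf.eval_piLp j).integrable_sq]
  exact Finset.sum_congr rfl fun j _ => (norm_hat_sq (hf.eval_piLp j)).symm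

theorem inner_hc_hat {f : Strip → Vec} (hf : MemLp f 2 volume) {ψ : Strip → ℝ}
    (hψ : MemLp ψ 2 volume) (j : Fin 2) : ⟪hc f j, hat ψ⟫ = ∫ z, f z j * ψ z := by
  rw [inner_hat hψ]
  refine integral_congr_ae ?_
  filter_upwards [coeFn_hc hf j] with z h
  rw [h]

theorem integral_inner_eq {f φ : Strip → Vec} (hf : MemLp f 2 volume) (hφ : MemLp φ 2 volume) :
    ∫ z, inner ℝ (f z) (φ z) = ⟪pr (hc f), pr (hc φ)⟫ := by
  rw [inner_pr]
  simp only [PiLp.inner_apply]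
  have hi : ∀ j ∈ Finset.univ, Integrable (fun z => inner ℝ (f z j) (φ z j)) volume := fun j _ =>
    ((hφ.eval_piLp j).integrable_mul (hf.eval_piLp j)).congr (Eventually.of_forall fun z => rfl)
  rw [integral_finsetSum _ hi]
  refine Finset.sum_congr rfl fun j _ => ?_
  refine Eq.trans ?_ (inner_hc_hat hf (hφ.eval_piLp j) j).symm
  congr 1; ext1 z; simp [mul_comm]

theorem HasWeakDeriv.LD {i : Fin 2} {f g : Strip → Vec} (h : HasWeakDeriv i f g)
    (hf : MemLp f 2 volume) (hg : MemLp g 2 volume) (j : Fin 2) : LD i (hc f j) (hc g j) := by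
  refine LD.of_weak fun ψ hψ => ?_
  rw [inner_hc_hat hf ((hψ.pderiv i).memLp 2), inner_hc_hat hg (hψ.memLp 2)]
  have h1 := h.locInt.integrable_smul_left_of_hasCompactSupport (hψ.pderiv i).continuous
    (hψ.pderiv i).compact
  have h2 := h.locInt_deriv.integrable_smul_left_of_hasCompactSupport hψ.continuous hψ.compact
  let P : Vec →L[ℝ] ℝ := EuclideanSpace.proj j
  have e1 := P.integral_comp_comm h1
  have e2 := P.integral_comp_comm h2
  have e3 := congrArg P (h.byParts ψ hψ)
  rw [map_neg, ← e1, ← e2] at e3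
  simpa [P, mul_comm] using e3

/-- Integrating the vertical part by parts shows that `-q` is the weak horizontal derivative of the
first component. This gives a horizontal derivative at every time, not merely almost every time. -/
theorem IsDivFree.LD {v : Strip → Vec} (h : IsDivFree v) (hv : MemLp v 2 volume) {q : L2}
    (hq : LD 1 (hc v 1) q) : LD 0 (hc v 0) (-q) := by
  refine LD.of_weak fun ψ hψ => ?_
  have h1 := hq.inner_eq (hψ.LD 1)
  have h2 := h.2 ψ hψ
  have i0 : ∀ j, Integrable (fun z => v z j * pderiv j ψ z) volume := fun j =>
    (hv.eval_piLp j).integrable_mul ((hψ.pderiv j).memLp 2)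
  rw [integral_add (i0 0) (i0 1), ← inner_hc_hat hv ((hψ.pderiv 0).memLp 2), ← inner_hc_hat hv ((hψ.pderiv 1).memLp 2)] at h2
  rw [inner_neg_left]
  linarith

/-- The field with given component functions. -/
def vec (φ₀ φ₁ : Strip → ℝ) (z : Strip) : Vec := !₂[φ₀ z, φ₁ z]

theorem vec_zero (φ₀ φ₁ : Strip → ℝ) (z : Strip) : vec φ₀ φ₁ z 0 = φ₀ z := rfl

theorem vec_one (φ₀ φ₁ : Strip → ℝ) (z : Strip) : vec φ₀ φ₁ z 1 = φ₁ z := rfl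

theorem pr_hc_vec (φ₀ φ₁ : Strip → ℝ) : pr (hc (vec φ₀ φ₁)) = pair (hat φ₀) (hat φ₁) := rfl

section

variable {φ₀ φ₁ : Strip → ℝ}

theorem isTest_vec (h0 : IsTest φ₀) (h1 : IsTest φ₁) : IsTest (vec φ₀ φ₁) where
  smooth := by
    rw [contDiff_euclidean]
    intro j
    fin_cases j
    exacts [h0.smooth, h1.smooth]
  compact := by
    refine HasCompactSupport.intro (h0.compact.isCompact.union h1.compact.isCompact) fun z hz => ?_
    rw [mem_union, not_or] at hz
    ext j
    have k0 : φ₀ z = 0 := image_eq_zero_of_notMem_tsupport hz.1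
    have k1 : φ₁ z = 0 := image_eq_zero_of_notMem_tsupport hz.2
    fin_cases j
    exacts [k0, k1]

theorem memLp_vec (h0 : IsTest φ₀) (h1 : IsTest φ₁) : MemLp (vec φ₀ φ₁) 2 volume := by
  refine MemLp.of_eval_piLp fun j => ?_
  fin_cases j
  exacts [h0.memLp 2, h1.memLp 2]

theorem pderiv_vec (h0 : IsTest φ₀) (h1 : IsTest φ₁) (i : Fin 2) :
    pderiv i (vec φ₀ φ₁) = vec (pderiv i φ₀) (pderiv i φ₁) := by
  ext1 z
  refine HasDerivAt.deriv ?_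
  have k0 := h0.hasDerivAt i z 0
  have k1 := h1.hasDerivAt i z 0
  rw [shift_zero, add_zero] at k0 k1
  have k : HasDerivAt (fun s => ![φ₀ (z + shift i s), φ₁ (z + shift i s)])
      ![pderiv i φ₀ z, pderiv i φ₁ z] 0 := by
    rw [hasDerivAt_pi]
    intro j
    fin_cases j
    exacts [k0, k1]
  exact ((PiLp.continuousLinearEquiv 2 ℝ fun _ : Fin 2 => ℝ).symm :
    (Fin 2 → ℝ) →L[ℝ] Vec).hasFDerivAt.comp_hasDerivAt 0 k

theorem divergence_vec (h0 : IsTest φ₀) (h1 : IsTest φ₁) (z : Strip) :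
    divergence (vec φ₀ φ₁) z = pderiv 0 φ₀ z + pderiv 1 φ₁ z := by
  rw [divergence, pderiv_vec h0 h1, pderiv_vec h0 h1, vec_zero, vec_one]

end

end

/-! ### From weak solutions to flows of L² components -/

theorem Icc_subset_timeInterval {T : EReal} {t : ℝ} (ht : t ∈ timeInterval T) :
    Icc 0 t ⊆ timeInterval T := fun _ hs =>
  ⟨hs.1, (EReal.coe_le_coe_iff.2 hs.2).trans_lt ht.2⟩

theorem Ioc_subset_timeInterval {T : EReal} {t : ℝ} (ht : t ∈ timeInterval T) :
    Ioc 0 t ⊆ timeInterval T := Ioc_subset_Icc_self.trans (Icc_subset_timeInterval ht)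

namespace LocL2

variable {T : EReal} {f : ℝ → Strip → Vec} {t : ℝ}

theorem integrable_sq (h : LocL2 T f) (ht : t ∈ timeInterval T) :
    Integrable (fun q : ℝ × Strip => ‖f q.1 q.2‖ ^ 2)
      ((volume.restrict (Ioc 0 t)).prod volume) :=
  (memLp_two_iff_integrable_sq_norm (h t ht).1).1 (h t ht)

theorem ae_memLp (h : LocL2 T f) (ht : t ∈ timeInterval T) :
    ∀ᵐ τ ∂(volume.restrict (Ioc 0 t)), MemLp (f τ) 2 volume := by
  filter_upwards [(h t ht).1.prodMk_left, (h.integrable_sq ht).prod_right_ae] with τ h1 h2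
  exact (memLp_two_iff_integrable_sq_norm h1).2 h2

theorem integrable_normSq (h : LocL2 T f) (ht : t ∈ timeInterval T) :
    IntegrableOn (fun τ => normSq (f τ)) (Ioc 0 t) := (h.integrable_sq ht).integral_prod_left

theorem aesm_comp (h : LocL2 T f) (ht : t ∈ timeInterval T) (j : Fin 2) :
    AEStronglyMeasurable (fun q : ℝ × Strip => f q.1 q.2 j)
      ((volume.restrict (Ioc 0 t)).prod volume) := ((h t ht).eval_piLp j).1

theorem aesm_hc (h : LocL2 T f) (ht : t ∈ timeInterval T) (j : Fin 2) :
    AEStronglyMeasurable (fun τ => hc (f τ) j) (volume.restrict (Ioc 0 t)) :=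
  aestronglyMeasurable_hat (f := fun τ z => f τ z j) (h.aesm_comp ht j)
    ((h.ae_memLp ht).mono fun _ hτ => hτ.eval_piLp j)

end LocL2

theorem hat_add {f g : Strip → ℝ} (hf : MemLp f 2 volume) (hg : MemLp g 2 volume) :
    hat (fun z => f z + g z) = hat f + hat g := by
  rw [hat_eq hf, hat_eq hg, hat_eq (show MemLp (fun z => f z + g z) 2 volume from hf.add hg)]; rfl

theorem hc_sub {f g : Strip → Vec} (hf : MemLp f 2 volume) (hg : MemLp g 2 volume) (j : Fin 2) :
    hc (fun z => f z - g z) j = hc f j - hc g j := by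
  have h1 := hf.eval_piLp j
  have h2 := hg.eval_piLp j
  rw [hc, hc, hc, hat_eq h1, hat_eq h2,
    hat_eq (show MemLp (fun z => (f z - g z) j) 2 volume from h1.sub h2)]
  rfl

/-- The embedding bounds the transporting field, so the pointwise convection term is square
integrable and agrees with the abstract product. -/
theorem memLp_convect {v w1 w2 : Strip → Vec} {v1 v2 v12 : Fin 2 → L2}
    (hg : VGood (hc v) v1 v2 v12) (hv : MemLp v 2 volume) (h1 : MemLp w1 2 volume)
    (h2 : MemLp w2 2 volume) : MemLp (convect v w1 w2) 2 volume ∧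
      ∀ j, hc (convect v w1 w2) j = conv (hc v) (hc w1) (hc w2) j := by
  have hae : ∀ i {w : Strip → Vec}, MemLp w 2 volume → ∀ j,
      (fun z => hc v i z * hc w j z) =ᵐ[volume] fun z => v z i * w z j := by
    intro i w hw j
    filter_upwards [coeFn_hc hv i, coeFn_hc hw j] with z a b
    rw [a, b]
  have hm : ∀ i {w : Strip → Vec}, MemLp w 2 volume → ∀ j,
      MemLp (fun z => v z i * w z j) 2 volume := fun i w hw j =>
    (memLp_congr_ae (hae i hw j)).1 ((hg.good i).bd.memLp _)
  refine ⟨MemLp.of_eval_piLp fun j => (hm 0 h1 j).add (hm 1 h2 j), fun j => ?_⟩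
  rw [conv, bmul, bmul, hat_congr (hae 0 h1 j), hat_congr (hae 1 h2 j),
    ← hat_add (hm 0 h1 j) (hm 1 h2 j)]
  rfl

theorem integral_force_eq {v w1 w2 u y1 y2 d φ ψ : Strip → Vec} {v1 v2 v12 u1 u2 u12 : Fin 2 → L2}
    (hg : VGood (hc v) v1 v2 v12) (hg' : VGood (hc u) u1 u2 u12)
    (hv : MemLp v 2 volume) (hw1 : MemLp w1 2 volume) (hw2 : MemLp w2 2 volume)
    (hu : MemLp u 2 volume) (hy1 : MemLp y1 2 volume) (hy2 : MemLp y2 2 volume)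
    (hd : MemLp d 2 volume) (hφ : MemLp φ 2 volume) (hψ : MemLp ψ 2 volume) (ν : ℝ) :
    ∫ z, (inner ℝ (convect v w1 w2 z - convect u y1 y2 z) (φ z) - ν * inner ℝ (d z) (ψ z)) =
      ⟪pr fun j => conv (hc v) (hc w1) (hc w2) j - conv (hc u) (hc y1) (hc y2) j, pr (hc φ)⟫ -
        ν * ⟪pr (hc d), pr (hc ψ)⟫ := by
  obtain ⟨m1, e1⟩ := memLp_convect hg hv hw1 hw2
  obtain ⟨m2, e2⟩ := memLp_convect hg' hu hy1 hy2
  have m : MemLp (fun z => convect v w1 w2 z - convect u y1 y2 z) 2 volume := m1.sub m2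
  have hi : ∀ {f g : Strip → Vec}, MemLp f 2 volume → MemLp g 2 volume →
      Integrable (fun z => inner ℝ (f z) (g z)) volume := fun hf hg => by
    simp only [PiLp.inner_apply]
    exact integrable_finsetSum _ fun j _ =>
      ((hg.eval_piLp j).integrable_mul (hf.eval_piLp j)).congr (Eventually.of_forall fun z => rfl)
  rw [integral_sub (hi m hφ) ((hi hd hψ).const_mul ν), integral_const_mul,
    integral_inner_eq m hφ, integral_inner_eq hd hψ]
  congr 3
  ext1 j
  rw [hc_sub m1 m2, e1, e2]

namespace InEnergyClass

variable {T : EReal} {u d1 d2 d12 : ℝ → Strip → Vec} {t : ℝ}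

theorem LD_one (h : InEnergyClass T u d1 d2 d12) (ht : t ∈ timeInterval T) (j : Fin 2) :
    LD 1 (hc (u t) j) (hc (d2 t) j) := (h.deriv_d2 t ht).LD (h.memLp t ht) (h.memLp_d2 t ht) j

theorem LD_zero (h : InEnergyClass T u d1 d2 d12) (ht : t ∈ timeInterval T)
    (hd : IsDivFree (u t)) : LD 0 (hc (u t) 0) (-(hc (d2 t) 1)) :=
  hd.LD (h.memLp t ht) (h.LD_one ht 1)

theorem ae_good (h : InEnergyClass T u d1 d2 d12) (ht : t ∈ timeInterval T)
    (hd : ∀ t ∈ timeInterval T, IsDivFree (u t)) : ∀ᵐ τ ∂(volume.restrict (Ioc 0 t)),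
      VGood (hc (u τ)) (hc (d1 τ)) (hc (d2 τ)) (hc (d12 τ)) := by
  have hs := Ioc_subset_timeInterval ht
  filter_upwards [h.locL2_d1.ae_memLp ht, h.locL2_d12.ae_memLp ht,
    ae_restrict_of_ae_restrict_of_subset hs h.deriv_d1,
    ae_restrict_of_ae_restrict_of_subset hs h.deriv_d12, ae_restrict_mem measurableSet_Ioc]
    with τ m1 m12 e1 e12 hτ
  have hτ' := hs hτ
  have k1 := e1.LD (h.memLp τ hτ') m1
  refine ⟨fun j => ⟨k1 j, h.LD_one hτ' j, e12.LD (h.memLp_d2 τ hτ') m12 j⟩, ?_⟩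
  rw [(k1 0).unique (h.LD_zero hτ' (hd τ hτ')), neg_add_cancel]

theorem integrable_sq4 (h : InEnergyClass T u d1 d2 d12) (ht : t ∈ timeInterval T) :
    IntegrableOn (fun τ => sq4 (hc (u τ)) (hc (d1 τ)) (hc (d2 τ)) (hc (d12 τ))) (Ioc 0 t) := by
  refine ((((h.locL2.integrable_normSq ht).add (h.locL2_d1.integrable_normSq ht)).add
    (h.locL2_d2.integrable_normSq ht)).add (h.locL2_d12.integrable_normSq ht)).congr ?_
  filter_upwards [h.locL2.ae_memLp ht, h.locL2_d1.ae_memLp ht, h.locL2_d2.ae_memLp ht,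
    h.locL2_d12.ae_memLp ht] with τ h0 h1 h2 h12
  simp only [Pi.add_apply, normSq_eq h0, normSq_eq h1, normSq_eq h2, normSq_eq h12, sq4,
    Finset.sum_add_distrib]

theorem exists_bound (h : InEnergyClass T u d1 d2 d12) (ht : t ∈ timeInterval T) :
    ∃ M, ∀ τ ∈ Icc 0 t, ∀ j, ‖hc (u τ) j‖ ≤ M ∧ ‖hc (d2 τ) j‖ ≤ M := by
  obtain ⟨M, hM⟩ := h.bounded t ht
  refine ⟨√M, fun τ hτ j => ?_⟩
  have hτ' := Icc_subset_timeInterval ht hτ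
  have h1 := hM τ hτ
  rw [normSq_eq (h.memLp τ hτ'), normSq_eq (h.memLp_d2 τ hτ')] at h1
  have n1 := Finset.single_le_sum (f := fun j => ‖hc (u τ) j‖ ^ 2) (fun k _ => sq_nonneg _)
    (Finset.mem_univ j)
  have n2 := Finset.single_le_sum (f := fun j => ‖hc (d2 τ) j‖ ^ 2) (fun k _ => sq_nonneg _)
    (Finset.mem_univ j)
  have p1 : 0 ≤ ∑ j, ‖hc (u τ) j‖ ^ 2 := Finset.sum_nonneg fun _ _ => sq_nonneg _
  have p2 : 0 ≤ ∑ j, ‖hc (d2 τ) j‖ ^ 2 := Finset.sum_nonneg fun _ _ => sq_nonneg _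
  exact ⟨Real.le_sqrt_of_sq_le (by linarith), Real.le_sqrt_of_sq_le (by linarith)⟩

theorem aesm_conv (h : InEnergyClass T u d1 d2 d12) (ht : t ∈ timeInterval T)
    (hd : ∀ t ∈ timeInterval T, IsDivFree (u t)) {w1 w2 : ℝ → Strip → Vec} (h1 : LocL2 T w1)
    (h2 : LocL2 T w2) (j : Fin 2) :
    AEStronglyMeasurable (fun τ => conv (hc (u τ)) (hc (w1 τ)) (hc (w2 τ)) j)
      (volume.restrict (Ioc 0 t)) := by
  have key : ∀ᵐ τ ∂(volume.restrict (Ioc 0 t)), MemLp (convect (u τ) (w1 τ) (w2 τ)) 2 volume ∧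
      ∀ j, hc (convect (u τ) (w1 τ) (w2 τ)) j = conv (hc (u τ)) (hc (w1 τ)) (hc (w2 τ)) j := by
    filter_upwards [h.ae_good ht hd, h.locL2.ae_memLp ht, h1.ae_memLp ht, h2.ae_memLp ht]
      with τ g m0 m1 m2
    exact memLp_convect g m0 m1 m2
  refine (aestronglyMeasurable_hat (f := fun τ z => convect (u τ) (w1 τ) (w2 τ) z j)
    (((h.locL2.aesm_comp ht 0).mul (h1.aesm_comp ht j)).add
      ((h.locL2.aesm_comp ht 1).mul (h2.aesm_comp ht j)))
    (key.mono fun τ g => g.1.eval_piLp j)).congr ?_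
  filter_upwards [key] with τ g using g.2 j

end InEnergyClass

namespace IsSolution

variable {ν η : ℝ} {T : EReal} {u₀ b₀ : Strip → Vec} {u u1 u2 u12 b b1 b2 b12 : ℝ → Strip → Vec}
  {p : ℝ → Strip → ℝ} {t : ℝ}

theorem flow (h : IsSolution ν η T u₀ b₀ u u1 u2 u12 b b1 b2 b12 p) (ht : t ∈ timeInterval T) :
    Flow ν η t (fun τ => hc (u τ)) (fun τ => hc (u1 τ)) (fun τ => hc (u2 τ)) (fun τ => hc (u12 τ))
      (fun τ => hc (b τ)) (fun τ => hc (b1 τ)) (fun τ => hc (b2 τ)) (fun τ => hc (b12 τ)) := by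
  have hI := Icc_subset_timeInterval ht
  have gu := h.class_u.ae_good ht h.div_u
  have gb := h.class_b.ae_good ht h.div_b
  have h00 : (0 : ℝ) ∈ Icc 0 t := ⟨le_rfl, ht.1⟩
  obtain ⟨M, hM⟩ := h.class_u.exists_bound ht
  obtain ⟨N, hN⟩ := h.class_b.exists_bound ht
  refine
  { good_u := gu
    good_b := gb
    d2_u := fun τ hτ => h.class_u.LD_one (hI hτ)
    d2_b := fun τ hτ => h.class_b.LD_one (hI hτ)
    div_u := fun τ hτ => h.class_u.LD_zero (hI hτ) (h.div_u τ (hI hτ))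
    div_b := fun τ hτ => h.class_b.LD_zero (hI hτ) (h.div_b τ (hI hτ))
    bdd := ⟨max M N, fun τ hτ j => ⟨(hM τ hτ j).1.trans (le_max_left _ _),
      (hN τ hτ j).1.trans (le_max_right _ _), (hM τ hτ j).2.trans (le_max_left _ _),
      (hN τ hτ j).2.trans (le_max_right _ _)⟩⟩
    meas := ?_
    meas_force_u := fun j =>
      (h.class_b.aesm_conv ht h.div_b h.class_b.locL2_d1 h.class_b.locL2_d2 j).sub
        (h.class_u.aesm_conv ht h.div_u h.class_u.locL2_d1 h.class_u.locL2_d2 j)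
    meas_force_b := fun j =>
      (h.class_b.aesm_conv ht h.div_b h.class_u.locL2_d1 h.class_u.locL2_d2 j).sub
        (h.class_u.aesm_conv ht h.div_u h.class_b.locL2_d1 h.class_b.locL2_d2 j)
    int_u := h.class_u.integrable_sq4 ht
    int_b := h.class_b.integrable_sq4 ht
    eq_u := ?_
    eq_b := ?_ }
  · intro j f hf
    simp only [mem_insert_iff, mem_singleton_iff] at hf
    rcases hf with rfl | rfl | rfl | rfl | rfl | rfl | rfl | rfl
    exacts [h.class_u.locL2.aesm_hc ht j, h.class_u.locL2_d1.aesm_hc ht j,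
      h.class_u.locL2_d2.aesm_hc ht j, h.class_u.locL2_d12.aesm_hc ht j,
      h.class_b.locL2.aesm_hc ht j, h.class_b.locL2_d1.aesm_hc ht j,
      h.class_b.locL2_d2.aesm_hc ht j, h.class_b.locL2_d12.aesm_hc ht j]
  · rintro s hs _ ⟨φ₀, φ₁, h0, h1, hdiv, rfl⟩
    have hφ := isTest_vec h0 h1
    have mφ := memLp_vec h0 h1
    have mψ := memLp_vec (h0.pderiv 0) (h1.pderiv 0)
    have a1 := h.momentum s (hI hs) _ hφ
    -- The equation at time zero replaces the initial datum by the value of the solution there.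
    have a0 := h.momentum 0 (hI h00) _ hφ
    rw [intervalIntegral.integral_same, add_zero] at a0
    rw [← a0, integral_inner_eq (h.class_u.memLp s (hI hs)) mφ,
      integral_inner_eq (h.class_u.memLp 0 (hI h00)) mφ] at a1
    rw [fieldL_gen, derivL_gen, ← pr_hc_vec, ← pr_hc_vec, a1]
    congr 1
    rw [intervalIntegral.integral_of_le hs.1, intervalIntegral.integral_of_le hs.1]
    refine integral_congr_ae (ae_restrict_of_ae_restrict_of_subset
      (Ioc_subset_Ioc_right hs.2) ?_)
    filter_upwards [gu, gb, h.class_u.locL2.ae_memLp ht, h.class_u.locL2_d1.ae_memLp ht,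
      h.class_u.locL2_d2.ae_memLp ht, h.class_b.locL2.ae_memLp ht,
      h.class_b.locL2_d1.ae_memLp ht, h.class_b.locL2_d2.ae_memLp ht]
      with τ g g' m0 m1 m2 n0 n1 n2
    rw [pderiv_vec h0 h1]
    -- The pressure drops out because the test field is divergence free.
    simp only [divergence_vec h0 h1, hdiv, mul_zero, add_zero]
    exact integral_force_eq g' g n0 n1 n2 m0 m1 m2 m1 mφ mψ ν
  · rintro s hs _ ⟨φ₀, φ₁, h0, h1, hdiv, rfl⟩
    have hφ := isTest_vec h0 h1
    have mφ := memLp_vec h0 h1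
    have mψ := memLp_vec (h0.pderiv 0) (h1.pderiv 0)
    have a1 := h.magnetic s (hI hs) _ hφ
    have a0 := h.magnetic 0 (hI h00) _ hφ
    rw [intervalIntegral.integral_same, add_zero] at a0
    rw [← a0, integral_inner_eq (h.class_b.memLp s (hI hs)) mφ,
      integral_inner_eq (h.class_b.memLp 0 (hI h00)) mφ] at a1
    rw [fieldL_gen, derivL_gen, ← pr_hc_vec, ← pr_hc_vec, a1]
    congr 1
    rw [intervalIntegral.integral_of_le hs.1, intervalIntegral.integral_of_le hs.1]
    refine integral_congr_ae (ae_restrict_of_ae_restrict_of_subset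
      (Ioc_subset_Ioc_right hs.2) ?_)
    filter_upwards [gu, gb, h.class_u.locL2.ae_memLp ht, h.class_u.locL2_d1.ae_memLp ht,
      h.class_u.locL2_d2.ae_memLp ht, h.class_b.locL2.ae_memLp ht,
      h.class_b.locL2_d1.ae_memLp ht, h.class_b.locL2_d2.ae_memLp ht]
      with τ g g' m0 m1 m2 n0 n1 n2
    rw [pderiv_vec h0 h1]
    exact integral_force_eq g' g n0 m1 m2 m0 n1 n2 n1 mφ mψ η

end IsSolution

theorem hc_eq_of_forall_test {f g : Strip → Vec} (hf : MemLp f 2 volume) (hg : MemLp g 2 volume)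
    (h : ∀ φ : Strip → Vec, IsTest φ → ∫ z, inner ℝ (f z) (φ z) = ∫ z, inner ℝ (g z) (φ z)) :
    hc f = hc g := by
  have key : ∀ φ₀ φ₁, IsTest φ₀ → IsTest φ₁ → ⟪hc f 0, hat φ₀⟫ + ⟪hc f 1, hat φ₁⟫ =
      ⟪hc g 0, hat φ₀⟫ + ⟪hc g 1, hat φ₁⟫ := by
    intro φ₀ φ₁ h0 h1
    have := h _ (isTest_vec h0 h1)
    rw [integral_inner_eq hf (memLp_vec h0 h1), integral_inner_eq hg (memLp_vec h0 h1),
      pr_hc_vec, pr, pr, inner_pair, inner_pair] at this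
    exact this
  have e : ∀ ψ, IsTest ψ → ⟪hc f 0, hat ψ⟫ = ⟪hc g 0, hat ψ⟫ ∧ ⟪hc f 1, hat ψ⟫ = ⟪hc g 1, hat ψ⟫ := by
    intro ψ hψ
    have k1 := key ψ ψ hψ hψ
    have k2 := key ψ _ hψ hψ.neg
    rw [hat_neg (hψ.memLp 2), inner_neg_right, inner_neg_right] at k2
    constructor <;> linarith
  ext1 j
  rw [← sub_eq_zero]
  refine eq_zero_of_inner_test fun ψ hψ => ?_
  rw [inner_sub_left, sub_eq_zero]
  fin_cases j
  exacts [(e ψ hψ).1, (e ψ hψ).2]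

theorem normSq_add_eq {f g : Strip → Vec} (hf : MemLp f 2 volume) (hg : MemLp g 2 volume) :
    normSq f + normSq g = nsq (hc f) (hc g) := by
  rw [normSq_eq hf, normSq_eq hg, nsq, Finset.sum_add_distrib]

theorem IsSolution.energy_le {ν η : ℝ} {T : EReal} {u₀ d2u₀ b₀ d2b₀ : Strip → Vec}
    {u u1 u2 u12 b b1 b2 b12 : ℝ → Strip → Vec} {p : ℝ → Strip → ℝ}
    (h : IsSolution ν η T u₀ b₀ u u1 u2 u12 b b1 b2 b12 p) (hν : 0 < ν) (hη : 0 < η) {δ : ℝ}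
    (hδ : 0 < δ) (hδc : 2 * δ ≤ (min ν η / 512) ^ 2) (hu₀ : MemLp u₀ 2 volume)
    (hb₀ : MemLp b₀ 2 volume) (hu : HasWeakDeriv 1 u₀ d2u₀) (hb : HasWeakDeriv 1 b₀ d2b₀)
    (hdu₀ : MemLp d2u₀ 2 volume) (hdb₀ : MemLp d2b₀ 2 volume)
    (h0 : (normSq u₀ + normSq b₀) + (normSq d2u₀ + normSq d2b₀) ≤ δ) {t : ℝ} (ht : 0 < t)
    (htT : (t : EReal) < T) :
    (normSq (u t) + normSq (b t)) + (normSq (u2 t) + normSq (b2 t))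
      + min ν η * (∫ τ in (0 : ℝ)..t, (normSq (u1 τ) + normSq (b1 τ)))
      + min ν η * (∫ τ in (0 : ℝ)..t, (normSq (u12 τ) + normSq (b12 τ))) ≤ 2 * δ := by
  have htI : t ∈ timeInterval T := ⟨ht.le, htT⟩
  have h0I := Icc_subset_timeInterval htI ⟨le_rfl, ht.le⟩
  have cu := h.class_u
  have cb := h.class_b
  -- At time zero the weak equations identify the solution with the data; uniqueness of strong
  -- derivatives then identifies the vertical derivatives, so the smallness assumption transfers.
  have eu : hc (u 0) = hc u₀ := hc_eq_of_forall_test (cu.memLp 0 h0I) hu₀ fun φ hφ => by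
    simpa using h.momentum 0 h0I φ hφ
  have eb : hc (b 0) = hc b₀ := hc_eq_of_forall_test (cb.memLp 0 h0I) hb₀ fun φ hφ => by
    simpa using h.magnetic 0 h0I φ hφ
  have eu2 : hc (u2 0) = hc d2u₀ := by
    ext1 j
    refine (cu.LD_one h0I j).unique ?_
    rw [eu]; exact hu.LD hu₀ hdu₀ j
  have eb2 : hc (b2 0) = hc d2b₀ := by
    ext1 j
    refine (cb.LD_one h0I j).unique ?_
    rw [eb]; exact hb.LD hb₀ hdb₀ j
  rw [normSq_add_eq hu₀ hb₀, normSq_add_eq hdu₀ hdb₀, ← eu, ← eb, ← eu2, ← eb2] at h0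
  have fl := h.flow htI
  have main := fl.energy_le ht hν hη hδ hδc h0
  have ii : ∀ {f : ℝ → ℝ}, IntegrableOn f (Ioc 0 t) → IntervalIntegrable f volume 0 t := fun hf =>
    (intervalIntegrable_iff_integrableOn_Ioc_of_le ht.le).2 hf
  rw [intervalIntegral.integral_add (ii fl.integrable_nsq1) (ii fl.integrable_nsq12)] at main
  have conv_int : ∀ {f g : ℝ → Strip → Vec}, LocL2 T f → LocL2 T g →
      ∫ τ in (0 : ℝ)..t, (normSq (f τ) + normSq (g τ)) =
        ∫ τ in (0 : ℝ)..t, nsq (hc (f τ)) (hc (g τ)) := by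
    intro f g hf hg
    rw [intervalIntegral.integral_of_le ht.le, intervalIntegral.integral_of_le ht.le]
    refine integral_congr_ae ?_
    filter_upwards [hf.ae_memLp htI, hg.ae_memLp htI] with τ k1 k2
    exact normSq_add_eq k1 k2
  rw [conv_int cu.locL2_d1 cb.locL2_d1, conv_int cu.locL2_d12 cb.locL2_d12,
    normSq_add_eq (cu.memLp t htI) (cb.memLp t htI),
    normSq_add_eq (cu.memLp_d2 t htI) (cb.memLp_d2 t htI)]
  have p1 : 0 ≤ ∫ τ in (0 : ℝ)..t, nsq (hc (u1 τ)) (hc (b1 τ)) :=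
    intervalIntegral.integral_nonneg ht.le fun τ _ => nsq_nonneg _ _
  have p2 : 0 ≤ ∫ τ in (0 : ℝ)..t, nsq (hc (u12 τ)) (hc (b12 τ)) :=
    intervalIntegral.integral_nonneg ht.le fun τ _ => nsq_nonneg _ _
  have hc0 : 0 < min ν η := lt_min hν hη
  nlinarith [mul_nonneg hc0.le p1, mul_nonneg hc0.le p2]

end MHD

end

theorem proposition3p1 :
    ∃ C₀ : ℝ, 0 < C₀ ∧ ∀ ν η : ℝ, 0 < ν → 0 < η →
      ∃ δ₀ : ℝ, 0 < δ₀ ∧ ∀ δ : ℝ, 0 < δ → δ ≤ δ₀ →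
        ∀ u₀ d2u₀ b₀ d2b₀ : MHD.Strip → MHD.Vec,
          MeasureTheory.MemLp u₀ 2 → MeasureTheory.MemLp b₀ 2 →
          MHD.HasWeakDeriv 1 u₀ d2u₀ → MHD.HasWeakDeriv 1 b₀ d2b₀ →
          MeasureTheory.MemLp d2u₀ 2 → MeasureTheory.MemLp d2b₀ 2 →
          (MHD.normSq u₀ + MHD.normSq b₀) + (MHD.normSq d2u₀ + MHD.normSq d2b₀) ≤ δ →
        ∀ (T : EReal) (u u1 u2 u12 b b1 b2 b12 : ℝ → MHD.Strip → MHD.Vec)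
          (p : ℝ → MHD.Strip → ℝ),
          MHD.IsSolution ν η T u₀ b₀ u u1 u2 u12 b b1 b2 b12 p →
        ∀ t : ℝ, 0 < t → (t : EReal) < T →
          (MHD.normSq (u t) + MHD.normSq (b t)) + (MHD.normSq (u2 t) + MHD.normSq (b2 t))
            + min ν η * (∫ τ in (0 : ℝ)..t, (MHD.normSq (u1 τ) + MHD.normSq (b1 τ)))
            + min ν η * (∫ τ in (0 : ℝ)..t, (MHD.normSq (u12 τ) + MHD.normSq (b12 τ)))
          ≤ C₀ * δ := by
  -- The threshold is exactly the smallness 2δ ≤ (min ν η / 512)² of the continuity argument, which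
  -- yields the bound 2δ.
  refine ⟨2, two_pos, fun ν η hν hη => ⟨(min ν η / 512) ^ 2 / 2, ?_, ?_⟩⟩
  · have := lt_min hν hη
    positivity
  · intro δ hδ hδ₀ u₀ d2u₀ b₀ d2b₀ hu₀ hb₀ hu hb hdu hdb h0 T u u1 u2 u12 b b1 b2 b12 p h t ht htT
    exact h.energy_le hν hη hδ (by linarith) hu₀ hb₀ hu hb hdu hdb h0 ht htT
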